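/- **Setting.** Fix integers $r,q\ge 1$. On the semi-infinite wedge space (spanned by semi-infinite wedges of half-integer vectors, with fermions $\psi_k,\psi_k^*$, $k\in\mathbb Z+\frac12$) put $\alpha_m=\sum_{k}\psi_{k-m}\psi_k^*$ for $m\neq 0$ and $\mathcal F_{r+1}=\sum_{k} k^{r+1}:\!\psi_k\psi_k^*\!:$, and let $\langle\cdots\rangle$ be the vacuum expectation. For a tuple $\mu=(\mu_1,\dots,\mu_n)$ of positive integers with $|\mu|=\sum_i\mu_i$ and an integer $b\ge 0$, the disconnected $r$-spin $q$-orbifold Hurwitz number with $b$ completed cycles is $$h^{\bullet}_{b;\mu}=\Big\langle \frac{\alpha_q^{|\mu|/q}}{q^{|\mu|/q}(|\mu|/q)!}\,\frac{\mathcal F_{r+1}^b}{(r+1)^b}\prod_{i=1}^n\frac{\alpha_{-\mu_i}}{\mu_i}\Big\rangle$$ (and $0$ if $q\nmid|\mu|$). The connected numbers $h^\circ_{b;\mu}$ are given by inclusion-exclusion over set partitions $P$ of $[n]=\{1,\dots,n\}$: $$\sum_{b\ge0} h^{\circ}_{b;\mu}\frac{\beta^b}{b!}=\sum_{P}(-1)^{|P|-1}(|P|-1)!\prod_{C\in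 P}\sum_{b\ge0} h^{\bullet}_{b;(\mu_i)_{i\in C}}\frac{\beta^b}{b!}.$$ For $g\ge0$, $n\ge1$ the correlator is the formal power series $$H_{g,n}(x_1,\dots,x_n)=\sum_{\mu_1,\dots,\mu_n\ge1}\frac{h^\circ_{b;\mu}}{b!}\,x_1^{\mu_1}\cdots x_n^{\mu_n},\qquad b=\frac{(2g-2+n)q+|\mu|}{qr},$$ where only those $\mu$ contribute for which $b$ is a non-negative integer. Write $D_x=x\partial_x$, $\zeta(z)=e^{z/2}-e^{-z/2}$, and $x_J=(x_j)_{j\in J}$. For $k\in[n]$, $K_0\subseteq[n]\setminus\{k\}$ and $m\ge 1$, operators $Q^{(k)}_{d;K_0,m}$ from functions of $x_1,\dots,x_n,\xi_1,\dots,\xi_m$ to functions of $x_1,\dots,x_n$ are defined by $$\sum_{d\ge0}Q^{(k)}_{d;K_0,m}\,z^{2d}=\frac{z}{\zeta(z)}\prod_{i\in K_0\cup\{k\}}\frac{\zeta(zD_{x_i})}{zD_{x_i}}\circ\Big(\prod_{j=1}^m\frac{\zeta(zD_{\xi_j})}{z}\Big)\Big|_{\xi_1=\dots=\xi_m=x_k},$$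 where the operators $D_{x_i}$ and $D_{x_k}$ act after the specialization $\xi_j=x_k$, on the whole resulting function of $x_1,\dots,x_n$. **Proposition 3.1.** For all $g\ge0$ and $n\ge1$, $$\frac{B_{g,n}}{r!}H_{g,n}(x_1,\dots,x_n)=\sum_{\{k\}\sqcup\bigsqcup_{j=0}^{\ell}K_j=[n]}\frac1{\ell!}\sum_{\substack{m\ge1,\ d\ge0\\|K_0|+m+2d=r+1}}\frac1{m!}\sum_{\substack{\bigsqcup_{j=1}^{\ell}M_j=[m]\\ M_j\ne\emptyset}}\ \sum_{\substack{g_1,\dots,g_\ell\ge0\\ g=\sum_j g_j+m-\ell+d}}Q^{(k)}_{d;K_0,m}\bigg[\prod_{i\in K_0}\frac{x_i}{x_k-x_i}\prod_{j=1}^{\ell}H_{g_j,|K_j|+|M_j|}(x_{K_j},\xi_{M_j})\bigg],$$ where $B_{g,n}=\frac1r\big(2g-2+n+\frac1q\sum_{i=1}^nD_{x_i}\big)$. The first sum is over $k\in[n]$, $\ell\ge0$, and ordered tuples of possibly empty sets $K_0,K_1,\dots,K_\ell$; the third is over ordered tuples $(M_1,\dots,M_\ell)$. The identity holds in the ring of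 formal power series in $x_1,\dots,x_n$ with rational coefficients, localized at the differences $x_i-x_j$ $(i\ne j)$. -/

import Mathlib

open Finset
open scoped Nat

namespace SpinHurwitz

noncomputable section

/-! ### The semi-infinite wedge space

The half-integer `s + 1/2` is encoded by the integer `s`. A basis vector of the wedge space is
the wedge, in decreasing order, of the elements of a set of half-integers which contains
finitely many positive and all but finitely many negative half-integers. -/

/-- Sets of half-integers indexing the basis of the semi-infinite wedge space. -/
def IsMaya (S : Set ℤ) : Prop :=
  {s : ℤ | s ∈ S ∧ 0 ≤ s}.Finite ∧ {s : ℤ | s ∉ S ∧ s < 0}.Finite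

theorem IsMaya.insert {S : Set ℤ} (h : IsMaya S) (k : ℤ) : IsMaya (Insert.insert k S) := by
  refine ⟨(h.1.insert k).subset ?_, h.2.subset ?_⟩
  · rintro s ⟨hs | hs, h0⟩
    · exact Or.inl hs
    · exact Or.inr ⟨hs, h0⟩
  · rintro s ⟨hs, h0⟩
    exact ⟨fun h' => hs (Or.inr h'), h0⟩

theorem IsMaya.erase {S : Set ℤ} (h : IsMaya S) (k : ℤ) : IsMaya (S \ {k}) := by
  refine ⟨h.1.subset ?_, (h.2.insert k).subset ?_⟩
  · rintro s ⟨hs, h0⟩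
    exact ⟨hs.1, h0⟩
  · rintro s ⟨hs, h0⟩
    by_cases hk : s = k
    · exact Or.inl hk
    · exact Or.inr ⟨fun h' => hs ⟨h', hk⟩, h0⟩

/-- The index set of the standard basis of the wedge space. -/
abbrev Maya : Type := {S : Set ℤ // IsMaya S}

/-- The vacuum: all negative half-integers. -/
def vacuum : Maya :=
  ⟨{s | s < 0}, by
    constructor
    · convert Set.finite_empty (α := ℤ) using 1
      ext s
      simp
    · convert Set.finite_empty (α := ℤ) using 1
      ext s
      simp⟩

/-- The semi-infinite wedge space (all charges), over `ℚ`. -/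
abbrev Wedge : Type := Maya →₀ ℚ

/-- The sign picked up when the `k`-th factor is moved past all larger factors of `S`. -/
def wedgeSign (k : ℤ) (S : Maya) : ℚ := (-1) ^ {j : ℤ | j ∈ S.1 ∧ k < j}.ncard

open Classical in
/-- The fermion `ψ_k`: wedge on the left with the `k`-th basis vector. -/
def psi (k : ℤ) : Module.End ℚ Wedge :=
  Finsupp.linearCombination ℚ fun S : Maya =>
    if k ∈ S.1 then 0 else Finsupp.single ⟨Insert.insert k S.1, S.2.insert k⟩ (wedgeSign k S)

open Classical in
/-- The fermion `ψ_k^*`: contraction with the `k`-th basis vector. -/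
def psiStar (k : ℤ) : Module.End ℚ Wedge :=
  Finsupp.linearCombination ℚ fun S : Maya =>
    if k ∈ S.1 then Finsupp.single ⟨S.1 \ {k}, S.2.erase k⟩ (wedgeSign k S) else 0

/-- The generator `α_m = ∑_k ψ_{k-m} ψ_k^*` of the Heisenberg algebra, for `m ≠ 0` (no normal
ordering is needed; `α_0` is not used). On a basis vector the sum is finite, see
`alpha_summand_finite`. -/
def alpha (m : ℤ) : Module.End ℚ Wedge :=
  Finsupp.linearCombination ℚ fun S : Maya =>
    ∑ᶠ k : ℤ, psi (k - m) (psiStar k (Finsupp.single S 1))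

theorem alpha_summand_finite {m : ℤ} (hm : m ≠ 0) (S : Maya) :
    (Function.support fun k : ℤ => psi (k - m) (psiStar k (Finsupp.single S (1 : ℚ)))).Finite := by
  have hfin : ({s : ℤ | s ∈ S.1 ∧ 0 ≤ s} ∪ (fun t => t + m) '' {s : ℤ | s ∉ S.1 ∧ s < 0} ∪
      Set.Icc m 0).Finite :=
    (S.2.1.union (S.2.2.image _)).union (Set.finite_Icc _ _)
  refine hfin.subset fun k hk => ?_
  have hkS : k ∈ S.1 := by
    by_contra h
    exact hk (by simp [psiStar, h])
  have hkm : k - m ∉ S.1 := by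
    intro h
    refine hk ?_
    have h' : k - m ∈ S.1 \ {k} := ⟨h, by simp [hm]⟩
    simp only [psiStar, psi, Finsupp.linearCombination_single, if_pos hkS, one_smul]
    rw [if_pos h', smul_zero]
  by_cases h0 : 0 ≤ k
  · exact Or.inl (Or.inl ⟨hkS, h0⟩)
  by_cases h1 : k - m < 0
  · exact Or.inl (Or.inr ⟨k - m, ⟨hkm, h1⟩, by simp⟩)
  · exact Or.inr ⟨by omega, by omega⟩

/-- The operator `ℱ_p = ∑_k k^p :ψ_k ψ_k^*:` (sum over half-integers `k`, normally ordered),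
diagonal in the standard basis. -/
def calF (p : ℕ) : Module.End ℚ Wedge :=
  Finsupp.linearCombination ℚ fun S : Maya =>
    Finsupp.single S
      (∑ s ∈ S.2.1.toFinset, ((s : ℚ) + 1 / 2) ^ p - ∑ s ∈ S.2.2.toFinset, ((s : ℚ) + 1 / 2) ^ p)

/-- The sandwich `⟨A⟩` of an operator between two vacuum states. -/
def vev (A : Module.End ℚ Wedge) : ℚ := A (Finsupp.single vacuum 1) vacuum

/-! ### Hurwitz numbers -/

/-- The disconnected `r`-spin `q`-orbifold Hurwitz number of `μ = (μ_1, …, μ_n)` with `b`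
completed cycles,
`⟨ α_q^{|μ|/q} / (q^{|μ|/q} (|μ|/q)!) · ℱ_{r+1}^b / (r+1)^b · ∏_i α_{-μ_i} / μ_i ⟩`. -/
def discHurwitz (r q b : ℕ) (μ : List ℕ) : ℚ :=
  if q ∣ μ.sum then
    vev ((1 / ((q : ℚ) ^ (μ.sum / q) * ((μ.sum / q)! : ℚ))) • alpha (q : ℤ) ^ (μ.sum / q) *
      (1 / ((r : ℚ) + 1) ^ b) • calF (r + 1) ^ b *
      (μ.map fun i : ℕ => (1 / (i : ℚ)) • alpha (-(i : ℤ))).prod)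
  else 0

/-- `∑_b h^•_{b;μ} β^b / b!`, as a power series in `β`. -/
def discSeries (r q : ℕ) (μ : List ℕ) : PowerSeries ℚ :=
  PowerSeries.mk fun b => discHurwitz r q b μ / (b ! : ℚ)

section Correlators

variable {σ : Type*} [DecidableEq σ]

/-- Inclusion-exclusion over the set partitions of the (non-empty) set `B` indexing the parts
`ν i`, `i ∈ B`: the series `∑_b h^∘_{b;ν} β^b / b!`. The disconnected numbers do not depend on
the order of the parts, which are listed here in increasing order. -/
def connSeries (r q : ℕ) (B : Finset σ) (ν : σ → ℕ) : PowerSeries ℚ :=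
  ∑ P : Finpartition B, ((-1 : ℚ) ^ (#P.parts - 1) * ((#P.parts - 1)! : ℚ)) •
    ∏ C ∈ P.parts, discSeries r q ((C.val.map ν).sort)

/-- The connected `r`-spin `q`-orbifold Hurwitz number of the tuple `(ν i)_{i ∈ B}` with `b`
completed cycles. -/
def connHurwitz (r q b : ℕ) (B : Finset σ) (ν : σ → ℕ) : ℚ :=
  (b ! : ℚ) * PowerSeries.coeff b (connSeries r q B ν)

/-- The correlator `H_{g,|B|}(x_B) = ∑_μ (h^∘_{g;μ} / b!) ∏_{i ∈ B} x_i^{μ_i}`, over all tuples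
`μ` of positive integers indexed by `B`, with `b = ((2g - 2 + |B|) q + |μ|) / (q r)`; there is no
contribution from `μ` when this is not a non-negative integer. It is a power series in variables
indexed by `σ` which involves only those in `B`. -/
def correlator (r q g : ℕ) (B : Finset σ) : MvPowerSeries σ ℚ := fun ν =>
  let N : ℤ := (2 * (g : ℤ) - 2 + #B) * q + ∑ i ∈ B, (ν i : ℤ)
  let b : ℕ := (N / ((q : ℤ) * r)).toNat
  if ν.support = B ∧ 0 ≤ N ∧ (q : ℤ) * r ∣ N then connHurwitz r q b B ν / (b ! : ℚ) else 0

end Correlators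

/-! ### Power series with poles on the diagonals

For variables `x_i = X (v i)`, `i ∈ [n]`, among the variables indexed by `σ`, the ring of power
series is localized at the differences `x_i - x_j`, `i ≠ j`. -/

/-- The multiplicative set generated by the differences `x_i - x_j` with `i ≠ j`. -/
def diagMonoid {n : ℕ} {τ : Type*} (v : Fin n → τ) : Submonoid (MvPowerSeries τ ℚ) :=
  Submonoid.closure {f | ∃ i j, i ≠ j ∧ f = MvPowerSeries.X (v i) - MvPowerSeries.X (v j)}

/-- Power series with poles along the diagonals `x_i = x_j`. -/
abbrev PolarSeries {n : ℕ} {τ : Type*} (v : Fin n → τ) : Type _ := Localization (diagMonoid v)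

/-- The ring homomorphism `a ↦ a + ε D a` attached to a derivation `D` of `R`, with values in the
dual numbers over a localization of `R`. -/
def dualHom {R : Type*} [CommRing R] [Algebra ℚ R] (M : Submonoid R) (D : Derivation ℚ R R) :
    R →+* TrivSqZeroExt (Localization M) (Localization M) where
  toFun a := TrivSqZeroExt.inl (algebraMap R _ a) + TrivSqZeroExt.inr (algebraMap R _ (D a))
  map_one' := by simp
  map_zero' := by simp
  map_add' a b := by
    ext
    · simp
    · simp only [map_add, TrivSqZeroExt.snd_add, TrivSqZeroExt.snd_inl, TrivSqZeroExt.snd_inr,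
        zero_add]
  map_mul' a b := by
    ext
    · simp
    · simp only [Derivation.leibniz, smul_eq_mul, map_add, map_mul, TrivSqZeroExt.snd_add,
        TrivSqZeroExt.snd_inl, TrivSqZeroExt.snd_inr, TrivSqZeroExt.snd_mul,
        TrivSqZeroExt.fst_add, TrivSqZeroExt.fst_inl, TrivSqZeroExt.fst_inr, zero_add, add_zero,
        op_smul_eq_smul]

theorem dualHom_isUnit {R : Type*} [CommRing R] [Algebra ℚ R] (M : Submonoid R)
    (D : Derivation ℚ R R) (y : M) : IsUnit (dualHom M D y) := by
  rw [TrivSqZeroExt.isUnit_iff_isUnit_fst]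
  simpa [dualHom] using IsLocalization.map_units (Localization M) y

theorem fst_lift_dualHom {R : Type*} [CommRing R] [Algebra ℚ R] (M : Submonoid R)
    (D : Derivation ℚ R R) (x : Localization M) :
    (IsLocalization.lift (dualHom_isUnit M D) x).fst = x := by
  have h : ((TrivSqZeroExt.fstHom (Localization M) (Localization M)
      (Localization M)).toRingHom.comp (IsLocalization.lift (dualHom_isUnit M D))) =
      RingHom.id _ := by
    refine IsLocalization.ringHom_ext M ?_
    ext a
    simp [dualHom]
  exact congrArg (fun f => f x) h

/-- The extension of a derivation to a localization, by the quotient rule (it is the only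
extension). -/
def extendDerivation {R : Type*} [CommRing R] [Algebra ℚ R] (M : Submonoid R)
    (D : Derivation ℚ R R) : Derivation ℚ (Localization M) (Localization M) :=
  Derivation.mk'
    (AddMonoidHom.toRatLinearMap
      { toFun := fun x => (IsLocalization.lift (dualHom_isUnit M D) x).snd
        map_zero' := by simp
        map_add' := fun x y => by simp })
    (fun x y => by
      simp [TrivSqZeroExt.snd_mul, fst_lift_dualHom, mul_comm])

theorem extendDerivation_algebraMap {R : Type*} [CommRing R] [Algebra ℚ R] (M : Submonoid R)
    (D : Derivation ℚ R R) (a : R) :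
    extendDerivation M D (algebraMap R (Localization M) a) = algebraMap R _ (D a) := by
  change (IsLocalization.lift (dualHom_isUnit M D) (algebraMap R (Localization M) a)).snd = _
  rw [IsLocalization.lift_eq]
  change (0 : Localization M) + algebraMap R _ (D a) = _
  rw [zero_add]

/-- The operator `D_{x_s} = x_s ∂/∂x_s` on power series. -/
def euler {τ : Type*} (s : τ) : Derivation ℚ (MvPowerSeries τ ℚ) (MvPowerSeries τ ℚ) :=
  (MvPowerSeries.X s : MvPowerSeries τ ℚ) • MvPowerSeries.pderiv ℚ s

/-- The operator `D_{x_s}` on power series with poles along the diagonals. -/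
def polarEuler {n : ℕ} {τ : Type*} (v : Fin n → τ) (s : τ) : Module.End ℚ (PolarSeries v) :=
  (extendDerivation (diagMonoid v) (euler s) : PolarSeries v →ₗ[ℚ] PolarSeries v)

/-- The factor `x_i / (x_k - x_i)`, for `i ≠ k`. -/
def polarFactor {n : ℕ} {τ : Type*} (v : Fin n → τ) (k i : Fin n) : PolarSeries v :=
  algebraMap (MvPowerSeries τ ℚ) _ (MvPowerSeries.X (v i)) *
    Ring.inverse (algebraMap (MvPowerSeries τ ℚ) (PolarSeries v)
      (MvPowerSeries.X (v k) - MvPowerSeries.X (v i)))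

theorem polarFactor_mul {n : ℕ} {τ : Type*} (v : Fin n → τ) {k i : Fin n} (h : i ≠ k) :
    polarFactor v k i * algebraMap (MvPowerSeries τ ℚ) _
      (MvPowerSeries.X (v k) - MvPowerSeries.X (v i)) =
    algebraMap (MvPowerSeries τ ℚ) (PolarSeries v) (MvPowerSeries.X (v i)) := by
  have hu : IsUnit (algebraMap (MvPowerSeries τ ℚ) (PolarSeries v)
      (MvPowerSeries.X (v k) - MvPowerSeries.X (v i))) :=
    IsLocalization.map_units (PolarSeries v)
      (⟨_, Submonoid.subset_closure ⟨k, i, h.symm, rfl⟩⟩ : diagMonoid v)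
  rw [polarFactor, mul_assoc, Ring.inverse_mul_cancel _ hu, mul_one]

/-- Renaming of the variables `x_1, …, x_n, ξ_1, …, ξ_m` by which every `ξ_j` becomes `x_k`. -/
def mergeVar {n m : ℕ} (k : Fin n) : Fin n ⊕ Fin m → Fin n := Sum.elim id fun _ => k

theorem diagMonoid_le_comap {n m : ℕ} (k : Fin n) :
    diagMonoid (Sum.inl : Fin n → Fin n ⊕ Fin m) ≤ (diagMonoid (id : Fin n → Fin n)).comap
      ((MvPowerSeries.rename (mergeVar (m := m) k) :
        MvPowerSeries (Fin n ⊕ Fin m) ℚ →ₐ[ℚ] MvPowerSeries (Fin n) ℚ) :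
        MvPowerSeries (Fin n ⊕ Fin m) ℚ →+* MvPowerSeries (Fin n) ℚ) := by
  rw [diagMonoid, Submonoid.closure_le]
  rintro f ⟨i, j, hij, rfl⟩
  refine Submonoid.subset_closure ⟨i, j, hij, ?_⟩
  simp [mergeVar]

/-- The specialization `ξ_1 = ⋯ = ξ_m = x_k`. -/
def specialize {n m : ℕ} (k : Fin n) :
    PolarSeries (Sum.inl : Fin n → Fin n ⊕ Fin m) →ₐ[ℚ] PolarSeries (id : Fin n → Fin n) :=
  (IsLocalization.map (PolarSeries (id : Fin n → Fin n)) _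
    (diagMonoid_le_comap (m := m) k)).toRatAlgHom

/-! ### The operators `Q^{(k)}_{d;K₀,m}` -/

/-- `ζ(z) = e^{z/2} - e^{-z/2}`. -/
def zetaSeries : PowerSeries ℚ :=
  PowerSeries.rescale (1 / 2 : ℚ) (PowerSeries.exp ℚ) -
    PowerSeries.rescale (-1 / 2 : ℚ) (PowerSeries.exp ℚ)

/-- `ζ(z) / z` (the constant term of `ζ` vanishes). -/
def zetaOverZ : PowerSeries ℚ := PowerSeries.mk fun j => PowerSeries.coeff (j + 1) zetaSeries

/-- `ζ(zD) / (zD)`, as a power series in `z` with operator coefficients. -/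
def zetaOverZD {V : Type*} [AddCommGroup V] [Module ℚ V] (D : Module.End ℚ V) :
    PowerSeries (Module.End ℚ V) :=
  PowerSeries.mk fun j => PowerSeries.coeff (j + 1) zetaSeries • D ^ j

/-- `ζ(zD) / z`, as a power series in `z` with operator coefficients. -/
def zetaDOverZ {V : Type*} [AddCommGroup V] [Module ℚ V] (D : Module.End ℚ V) :
    PowerSeries (Module.End ℚ V) :=
  PowerSeries.mk fun j => PowerSeries.coeff (j + 1) zetaSeries • D ^ (j + 1)

/-- `z / ζ(z) · ∏_{i ∈ K} ζ(z D_{x_i}) / (z D_{x_i})`; the factors commute, and are composed here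
in the order of the indices. -/
def outerSeries {n : ℕ} (K : Finset (Fin n)) :
    PowerSeries (Module.End ℚ (PolarSeries (id : Fin n → Fin n))) :=
  PowerSeries.map (algebraMap ℚ _) zetaOverZ⁻¹ *
    (K.sort.map fun i => zetaOverZD (polarEuler (id : Fin n → Fin n) i)).prod

/-- `∏_{j=1}^m ζ(z D_{ξ_j}) / z`; the factors commute. -/
def innerSeries (n m : ℕ) :
    PowerSeries (Module.End ℚ (PolarSeries (Sum.inl : Fin n → Fin n ⊕ Fin m))) :=
  ((List.finRange m).map fun j =>
    zetaDOverZ (polarEuler (Sum.inl : Fin n → Fin n ⊕ Fin m) (Sum.inr j))).prod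

/-- The operator `Q^{(k)}_{d;K₀,m}`: the coefficient of `z^{2d}` in
`z / ζ(z) ∏_{i ∈ K₀ ∪ {k}} ζ(z D_{x_i}) / (z D_{x_i}) ∘ [ξ_j = x_k] ∘ ∏_{j=1}^m ζ(z D_{ξ_j}) / z`.
It takes functions of `x_1, …, x_n, ξ_1, …, ξ_m` to functions of `x_1, …, x_n`. -/
def Qop {n : ℕ} (k : Fin n) (d : ℕ) (K₀ : Finset (Fin n)) (m : ℕ) :
    PolarSeries (Sum.inl : Fin n → Fin n ⊕ Fin m) →ₗ[ℚ] PolarSeries (id : Fin n → Fin n) :=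
  ∑ a ∈ antidiagonal (2 * d),
    PowerSeries.coeff a.1 (outerSeries (Insert.insert k K₀)) ∘ₗ
      (specialize (m := m) k).toLinearMap ∘ₗ PowerSeries.coeff a.2 (innerSeries n m)

/-- The operator `B_{g,n} = (1/r) (2g - 2 + n + (1/q) ∑_i D_{x_i})`. -/
def Bop (r q g : ℕ) {n : ℕ} (f : MvPowerSeries (Fin n) ℚ) : MvPowerSeries (Fin n) ℚ :=
  (1 / (r : ℚ)) • ((2 * (g : ℚ) - 2 + n) • f + (1 / (q : ℚ)) • ∑ i, euler i f)

/-- The sets `A j` are pairwise disjoint with union `S`; they may be empty. -/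
def IsSplitting {ι α : Type*} [Fintype ι] [DecidableEq α] (A : ι → Finset α) (S : Finset α) :
    Prop :=
  (∀ i j, i ≠ j → Disjoint (A i) (A j)) ∧ univ.biUnion A = S

instance {ι α : Type*} [Fintype ι] [DecidableEq ι] [DecidableEq α] (A : ι → Finset α)
    (S : Finset α) : Decidable (IsSplitting A S) := by
  unfold IsSplitting
  infer_instance

end

end SpinHurwitz

open Finset
open scoped Nat

namespace SpinHurwitz

noncomputable section

set_option linter.unusedSectionVars false

/-! ### Canonical anticommutation relations -/

/-! The identity is the cut-and-join equation of the completed cycle, read coefficient by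
coefficient in the `x_i`.

Operators. `ℱ_{r+1}` is bilinear in the fermions. Commutators of bilinear operators are determined
up to a scalar by their commutators with single fermions (Jacobi identity and Schur's lemma,
`eq_smul_one_of_commute`), and the scalar vanishes when neither operator lowers the energy. Moved to
the right through the `α_{-ν_i}`, the operator `ℱ_{r+1}` absorbs the parts in some subset `L`, each
at the cost of `ζ(ν_i z)/ν_i` in an exponential symbol (`exc_mul_bos`). What remains is a
one-excitation operator on the vacuum, which a recursion (`exc_vac_recursion`) turns into bosons
(`exc_vac_eq`). Hence the parts in `L` are joined and cut again into `a_1, …, a_m`, with weight the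
coefficient of `z^{r+1}` in `ζ(z)⁻¹ ∏_{i ∈ L} ζ(ν_i z)/ν_i ∏_j ζ(a_j z)` (`calF_bos_vac`). This is
the symbol of `Q`: counting powers of `z`, and using parity, only `#L + m + 2d = r + 2` contributes.

Connectedness. Under subset convolution the connected series is the logarithm of the disconnected
one. Taking its derivative in `β` divides out every component that contains none of the new parts,
leaving the sum over components `K_j ⊔ M_j` with `M_j ≠ ∅` (`derivative_connSeries`).

Genus. The Riemann–Hurwitz relations of the components add up to that of the whole, with `g = ∑ g_j
+ m - ℓ + d` (`genus_relation`). Induction on the number of cycles shows that every nonzero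
connected number has a genus which is a non-negative integer (`exists_isGenus`), so sums over cycle
numbers and sums over genera agree (`sum_coeff_corrProd`).

Poles. With `L = K₀ ∪ {k}` fixed, the sum over `k` is Lagrange interpolation: `∑_k x_k^s ∏_{i ≠ k}
x_i/(x_k - x_i)` is the sum of all monomials of degree `s` in which every `x_i`, `i ∈ L`, has
positive exponent (`poleSum_lagrange`). This encodes the joining, and the specialization `ξ_j = x_k`
encodes the cutting. The operators in `Q` are diagonal on monomials, so the right-hand side becomes
a power series with explicit coefficients (`sum_Qop`).

On the left, `B_{g,n}` multiplies a monomial by its number `b` of cycles, which is the effect of the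
derivative in `β` (`smul_Bop_correlator_eq_recSeries`). -/

theorem finite_above (S : Maya) (k : ℤ) : {j : ℤ | j ∈ S.1 ∧ k < j}.Finite := by
  refine (S.2.1.union (Set.finite_Ico k 0)).subset ?_
  rintro j ⟨hj, hk⟩
  by_cases h : 0 ≤ j
  · exact Or.inl ⟨hj, h⟩
  · exact Or.inr ⟨hk.le, by omega⟩

/-- The sign of exchanging the factors `i` and `j`, seen from `i`. -/
def swapSign (i j : ℤ) : ℚ := if i < j then -1 else 1

theorem swapSign_mul_self (i j : ℤ) : swapSign i j * swapSign i j = 1 := by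
  unfold swapSign; split_ifs <;> norm_num

theorem swapSign_comm {i j : ℤ} (h : i ≠ j) : swapSign i j = -swapSign j i := by
  unfold swapSign; split_ifs <;> first | omega | norm_num

theorem wedgeSign_mul_self (i : ℤ) (S : Maya) : wedgeSign i S * wedgeSign i S = 1 := by
  rw [wedgeSign, ← pow_add, ← two_mul, pow_mul]; norm_num

/-- Insertion of a factor. -/
def ins (k : ℤ) (S : Maya) : Maya := ⟨insert k S.1, S.2.insert k⟩

/-- Removal of a factor. -/
def del (k : ℤ) (S : Maya) : Maya := ⟨S.1 \ {k}, S.2.erase k⟩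

theorem mem_ins {j k : ℤ} {S : Maya} : j ∈ (ins k S).1 ↔ j = k ∨ j ∈ S.1 := Iff.rfl

theorem mem_del {j k : ℤ} {S : Maya} : j ∈ (del k S).1 ↔ j ∈ S.1 ∧ j ≠ k := Iff.rfl

theorem ins_del {k : ℤ} {S : Maya} (h : k ∈ S.1) : ins k (del k S) = S := by
  apply Subtype.ext; ext j
  change (j = k ∨ (j ∈ S.1 ∧ j ≠ k)) ↔ j ∈ S.1
  by_cases hj : j = k
  · subst hj; simpa using h
  · simp [hj]

theorem del_ins {k : ℤ} {S : Maya} (h : k ∉ S.1) : del k (ins k S) = S := by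
  apply Subtype.ext; ext j
  change ((j = k ∨ j ∈ S.1) ∧ j ≠ k) ↔ j ∈ S.1
  by_cases hj : j = k
  · subst hj; simpa using h
  · simp [hj]

theorem ins_comm (i j : ℤ) (S : Maya) : ins i (ins j S) = ins j (ins i S) :=
  Subtype.ext (Set.insert_comm _ _ _)

theorem del_comm (i j : ℤ) (S : Maya) : del i (del j S) = del j (del i S) :=
  Subtype.ext (by ext; simp only [mem_del]; tauto)

theorem ins_del_comm {i j : ℤ} (h : i ≠ j) (S : Maya) : ins i (del j S) = del j (ins i S) := by
  apply Subtype.ext; ext t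
  simp only [mem_ins, mem_del]
  by_cases ht : t = i
  · subst ht; simp [h]
  · simp [ht]

theorem wedgeSign_ins {i j : ℤ} {S : Maya} (h : j ∉ S.1) :
    wedgeSign i (ins j S) = swapSign i j * wedgeSign i S := by
  unfold wedgeSign swapSign
  split_ifs with hij
  · have : {t : ℤ | t ∈ (ins j S).1 ∧ i < t} = insert j {t : ℤ | t ∈ S.1 ∧ i < t} := by
      ext t
      simp only [mem_ins, Set.mem_ofPred_eq, Set.mem_insert_iff]
      by_cases ht : t = j
      · subst ht; simp [hij]
      · simp [ht]
    rw [this, Set.ncard_insert_of_notMem (fun h' => h h'.1) (finite_above S i), pow_succ]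
    ring
  · have : {t : ℤ | t ∈ (ins j S).1 ∧ i < t} = {t : ℤ | t ∈ S.1 ∧ i < t} := by
      ext t
      simp only [mem_ins, Set.mem_ofPred_eq]
      by_cases ht : t = j
      · subst ht; simp [hij]
      · simp [ht]
    rw [this, one_mul]

theorem wedgeSign_del {i j : ℤ} {S : Maya} (h : j ∈ S.1) :
    wedgeSign i (del j S) = swapSign i j * wedgeSign i S := by
  have h1 : j ∉ (del j S).1 := fun h' => (mem_del.1 h').2 rfl
  have := wedgeSign_ins (i := i) h1
  rw [ins_del h] at this
  rw [this, ← mul_assoc, swapSign_mul_self, one_mul]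

theorem psi_single_of_mem {k : ℤ} {S : Maya} (h : k ∈ S.1) (c : ℚ) :
    psi k (Finsupp.single S c) = 0 := by
  simp [psi, h]

theorem psi_single_of_notMem {k : ℤ} {S : Maya} (h : k ∉ S.1) (c : ℚ) :
    psi k (Finsupp.single S c) = Finsupp.single (ins k S) (c * wedgeSign k S) := by
  simp [psi, h, ins]

theorem psiStar_single_of_mem {k : ℤ} {S : Maya} (h : k ∈ S.1) (c : ℚ) :
    psiStar k (Finsupp.single S c) = Finsupp.single (del k S) (c * wedgeSign k S) := by
  simp [psiStar, h, del]

theorem psiStar_single_of_notMem {k : ℤ} {S : Maya} (h : k ∉ S.1) (c : ℚ) :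
    psiStar k (Finsupp.single S c) = 0 := by
  simp [psiStar, h]

theorem psi_psi_single (i j : ℤ) (S : Maya) :
    psi i (psi j (Finsupp.single S 1)) = -psi j (psi i (Finsupp.single S 1)) := by
  by_cases hij : i = j
  · subst hij
    by_cases hi : i ∈ S.1
    · simp [psi_single_of_mem hi]
    · rw [psi_single_of_notMem hi, psi_single_of_mem (mem_ins.2 (Or.inl rfl))]; simp
  by_cases hi : i ∈ S.1 <;> by_cases hj : j ∈ S.1
  · simp [psi_single_of_mem hi, psi_single_of_mem hj]
  · rw [psi_single_of_mem hi, psi_single_of_notMem hj,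
      psi_single_of_mem (mem_ins.2 (Or.inr hi))]; simp
  · rw [psi_single_of_mem hj, psi_single_of_notMem hi,
      psi_single_of_mem (mem_ins.2 (Or.inr hj))]; simp
  · rw [psi_single_of_notMem hi, psi_single_of_notMem hj,
      psi_single_of_notMem (by rw [mem_ins]; tauto), psi_single_of_notMem (by rw [mem_ins]; tauto),
      wedgeSign_ins hj, wedgeSign_ins hi, swapSign_comm hij, ins_comm, ← Finsupp.single_neg]
    congr 1; ring

theorem psiStar_psiStar_single (i j : ℤ) (S : Maya) :
    psiStar i (psiStar j (Finsupp.single S 1)) = -psiStar j (psiStar i (Finsupp.single S 1)) := by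
  by_cases hij : i = j
  · subst hij
    by_cases hi : i ∈ S.1
    · rw [psiStar_single_of_mem hi, psiStar_single_of_notMem (by simp [mem_del])]; simp
    · simp [psiStar_single_of_notMem hi]
  by_cases hi : i ∈ S.1 <;> by_cases hj : j ∈ S.1
  · rw [psiStar_single_of_mem hi, psiStar_single_of_mem hj,
      psiStar_single_of_mem (mem_del.2 ⟨hi, hij⟩),
      psiStar_single_of_mem (mem_del.2 ⟨hj, Ne.symm hij⟩),
      wedgeSign_del hj, wedgeSign_del hi, swapSign_comm hij, del_comm, ← Finsupp.single_neg]
    congr 1; ring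
  · rw [psiStar_single_of_notMem hj, psiStar_single_of_mem hi,
      psiStar_single_of_notMem (by rw [mem_del]; tauto)]; simp
  · rw [psiStar_single_of_notMem hi, psiStar_single_of_mem hj,
      psiStar_single_of_notMem (by rw [mem_del]; tauto)]; simp
  · simp [psiStar_single_of_notMem hi, psiStar_single_of_notMem hj]

theorem psi_psiStar_single (i j : ℤ) (S : Maya) :
    psi i (psiStar j (Finsupp.single S 1)) =
      (if i = j then Finsupp.single S 1 else 0) - psiStar j (psi i (Finsupp.single S 1)) := by
  by_cases hij : i = j
  · subst hij
    by_cases hi : i ∈ S.1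
    · rw [psi_single_of_mem hi, psiStar_single_of_mem hi,
        psi_single_of_notMem (by simp [mem_del]), wedgeSign_del hi, ins_del hi]
      simp [swapSign, wedgeSign_mul_self]
    · rw [psi_single_of_notMem hi, psiStar_single_of_notMem hi,
        psiStar_single_of_mem (mem_ins.2 (Or.inl rfl)), wedgeSign_ins hi, del_ins hi]
      simp [swapSign, wedgeSign_mul_self]
  rw [if_neg hij, zero_sub]
  by_cases hi : i ∈ S.1 <;> by_cases hj : j ∈ S.1
  · rw [psi_single_of_mem hi, psiStar_single_of_mem hj,
      psi_single_of_mem (mem_del.2 ⟨hi, hij⟩)]; simp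
  · simp [psi_single_of_mem hi, psiStar_single_of_notMem hj]
  · rw [psi_single_of_notMem hi, psiStar_single_of_mem hj,
      psiStar_single_of_mem (mem_ins.2 (Or.inr hj)),
      psi_single_of_notMem (by rw [mem_del]; tauto),
      wedgeSign_del hj, wedgeSign_ins hi, swapSign_comm hij, ins_del_comm hij,
      ← Finsupp.single_neg]
    congr 1; ring
  · rw [psi_single_of_notMem hi, psiStar_single_of_notMem hj,
      psiStar_single_of_notMem (by rw [mem_ins]; tauto)]; simp

theorem wedge_hom_ext {T U : Module.End ℚ Wedge}
    (h : ∀ S, T (Finsupp.single S 1) = U (Finsupp.single S 1)) : T = U := by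
  refine Finsupp.lhom_ext fun S c => ?_
  rw [← mul_one c, ← smul_eq_mul, ← Finsupp.smul_single, map_smul, map_smul, h]

theorem psi_mul_psi (i j : ℤ) : psi i * psi j = -(psi j * psi i) :=
  wedge_hom_ext fun S => psi_psi_single i j S

theorem psiStar_mul_psiStar (i j : ℤ) : psiStar i * psiStar j = -(psiStar j * psiStar i) :=
  wedge_hom_ext fun S => psiStar_psiStar_single i j S

theorem psi_mul_psiStar (i j : ℤ) :
    psi i * psiStar j = (if i = j then 1 else 0) - psiStar j * psi i := by
  refine wedge_hom_ext fun S => ?_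
  rw [Module.End.mul_apply, psi_psiStar_single]
  split_ifs <;> simp

theorem psiStar_mul_psi (i j : ℤ) :
    psiStar i * psi j = (if j = i then 1 else 0) - psi j * psiStar i := by
  rw [psi_mul_psiStar]; abel

/-- The vacuum vector. -/
def vac : Wedge := Finsupp.single vacuum 1

theorem psi_vac {k : ℤ} (h : k < 0) : psi k vac = 0 := psi_single_of_mem h 1

theorem psiStar_vac {k : ℤ} (h : 0 ≤ k) : psiStar k vac = 0 :=
  psiStar_single_of_notMem (by simp [vacuum, h]) 1

/-! ### Coefficients of fermion images, and the role of the vacuum -/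

theorem psi_apply_of_notMem {k : ℤ} {S : Maya} (h : k ∉ S.1) (v : Wedge) : psi k v S = 0 := by
  induction v using Finsupp.induction_linear with
  | zero => simp
  | add v w hv hw => simp [hv, hw]
  | single U c =>
    by_cases hU : k ∈ U.1
    · simp [psi_single_of_mem hU]
    · rw [psi_single_of_notMem hU, Finsupp.single_apply, if_neg]
      rintro rfl
      exact h (mem_ins.2 (Or.inl rfl))

theorem psiStar_apply_of_mem {k : ℤ} {S : Maya} (h : k ∈ S.1) (v : Wedge) :
    psiStar k v S = 0 := by
  induction v using Finsupp.induction_linear with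
  | zero => simp
  | add v w hv hw => simp [hv, hw]
  | single U c =>
    by_cases hU : k ∈ U.1
    · rw [psiStar_single_of_mem hU, Finsupp.single_apply, if_neg]
      rintro rfl
      exact (mem_del.1 h).2 rfl
    · simp [psiStar_single_of_notMem hU]

theorem psi_apply_ins {k : ℤ} {S : Maya} (h : k ∉ S.1) (v : Wedge) :
    psi k v (ins k S) = v S * wedgeSign k S := by
  induction v using Finsupp.induction_linear with
  | zero => simp
  | add v w hv hw => simp [hv, hw, add_mul]
  | single U c =>
    by_cases hU : k ∈ U.1
    · rw [psi_single_of_mem hU, Finsupp.single_apply, if_neg]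
      · simp
      · rintro rfl; exact h hU
    · rw [psi_single_of_notMem hU, Finsupp.single_apply, Finsupp.single_apply]
      by_cases hUS : U = S
      · subst hUS; simp
      · rw [if_neg, if_neg hUS, zero_mul]
        intro h'
        rw [← del_ins hU, h', del_ins h] at hUS
        exact hUS rfl

theorem psiStar_apply_del {k : ℤ} {S : Maya} (h : k ∈ S.1) (v : Wedge) :
    psiStar k v (del k S) = v S * wedgeSign k S := by
  induction v using Finsupp.induction_linear with
  | zero => simp
  | add v w hv hw => simp [hv, hw, add_mul]
  | single U c =>
    by_cases hU : k ∈ U.1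
    · rw [psiStar_single_of_mem hU, Finsupp.single_apply, Finsupp.single_apply]
      by_cases hUS : U = S
      · subst hUS; simp
      · rw [if_neg, if_neg hUS, zero_mul]
        intro h'
        rw [← ins_del hU, h', ins_del h] at hUS
        exact hUS rfl
    · rw [psiStar_single_of_notMem hU, Finsupp.single_apply, if_neg]
      · simp
      · rintro rfl; exact hU h

theorem wedgeSign_ne_zero (k : ℤ) (S : Maya) : wedgeSign k S ≠ 0 :=
  fun h => by simpa [h] using wedgeSign_mul_self k S

/-- The vacuum is characterised by the annihilation operators. -/
theorem eq_smul_vac {v : Wedge} (h1 : ∀ k < 0, psi k v = 0) (h2 : ∀ k, 0 ≤ k → psiStar k v = 0) :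
    v = v vacuum • vac := by
  ext S
  rw [Finsupp.smul_apply, vac, Finsupp.single_apply]
  split_ifs with hS
  · simp [← hS]
  rw [smul_zero]
  -- A state other than the vacuum differs from it at some level `k`. An occupied `k ≥ 0` is
  -- detected by `psiStar k`, an empty `k < 0` by `psi k`; both annihilate `v`, so the coefficient
  -- at `S` vanishes.
  have hne : ∃ k, ¬ (k ∈ S.1 ↔ k < 0) := by
    by_contra! h'
    exact hS (Subtype.ext (Set.ext fun k => (h' k).symm))
  obtain ⟨k, hk⟩ := hne
  by_cases hkS : k ∈ S.1
  · have := psiStar_apply_del hkS v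
    rw [h2 k (by by_contra h'; exact hk ⟨fun _ => by omega, fun _ => hkS⟩)] at this
    exact (mul_eq_zero.1 this.symm).resolve_right (wedgeSign_ne_zero _ _)
  · have := psi_apply_ins hkS v
    rw [h1 k (by by_contra h'; exact hk ⟨fun h => (hkS h).elim, fun h => (h' h).elim⟩)] at this
    exact (mul_eq_zero.1 this.symm).resolve_right (wedgeSign_ne_zero _ _)

/-- The vacuum generates the wedge space under the fermions. -/
theorem single_mem_of_invariant (p : Submodule ℚ Wedge) (h0 : vac ∈ p)
    (h1 : ∀ k, ∀ v ∈ p, psi k v ∈ p) (h2 : ∀ k, ∀ v ∈ p, psiStar k v ∈ p) (S : Maya) :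
    Finsupp.single S 1 ∈ p := by
  -- Induction on the number of particles at levels `≥ 0` plus the number of holes at levels `< 0`:
  -- a particle is put back by `psi`, a hole by `psiStar`.
  have key : ∀ N : ℕ, ∀ S : Maya,
      {s : ℤ | s ∈ S.1 ∧ 0 ≤ s}.ncard + {s : ℤ | s ∉ S.1 ∧ s < 0}.ncard = N →
      Finsupp.single S 1 ∈ p := by
    intro N
    induction N with
    | zero =>
      intro S hS
      obtain ⟨e1, e2⟩ := Nat.add_eq_zero_iff.1 hS
      rw [Set.ncard_eq_zero S.2.1] at e1
      rw [Set.ncard_eq_zero S.2.2] at e2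
      have : S = vacuum := by
        apply Subtype.ext; ext k
        constructor
        · intro hk
          by_contra h'
          have : k ∈ {s : ℤ | s ∈ S.1 ∧ 0 ≤ s} := ⟨hk, not_lt.1 h'⟩
          rw [e1] at this; exact this
        · intro hk
          by_contra h'
          have : k ∈ {s : ℤ | s ∉ S.1 ∧ s < 0} := ⟨h', hk⟩
          rw [e2] at this; exact this
      rw [this]; exact h0
    | succ N ih =>
      intro S hS
      by_cases hp : ∃ k, k ∈ S.1 ∧ 0 ≤ k
      · obtain ⟨k, hk, hk0⟩ := hp
        have e1 : {s : ℤ | s ∈ S.1 ∧ 0 ≤ s} = insert k {s : ℤ | s ∈ (del k S).1 ∧ 0 ≤ s} := by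
          ext s; simp only [Set.mem_ofPred_eq, mem_del, Set.mem_insert_iff]
          by_cases hs : s = k
          · subst hs; simp [hk, hk0]
          · simp [hs]
        have e2 : {s : ℤ | s ∉ S.1 ∧ s < 0} = {s : ℤ | s ∉ (del k S).1 ∧ s < 0} := by
          ext s; simp only [Set.mem_ofPred_eq, mem_del]
          constructor
          · rintro ⟨a, b⟩; exact ⟨fun h => a h.1, b⟩
          · rintro ⟨a, b⟩; exact ⟨fun h => a ⟨h, by omega⟩, b⟩
        rw [e1, e2, Set.ncard_insert_of_notMem (fun h => (mem_del.1 h.1).2 rfl)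
          (del k S).2.1] at hS
        have hm := h1 k _ (ih (del k S) (by omega))
        rw [psi_single_of_notMem (fun h => (mem_del.1 h).2 rfl), ins_del hk, one_mul] at hm
        have := p.smul_mem (wedgeSign k (del k S)) hm
        rwa [Finsupp.smul_single, smul_eq_mul, wedgeSign_mul_self] at this
      · have hn : ∃ k, k ∉ S.1 ∧ k < 0 := by
          by_contra! h'
          push Not at hp
          have a1 : {s : ℤ | s ∈ S.1 ∧ 0 ≤ s} = ∅ := by
            ext s; simp only [Set.mem_ofPred_eq, Set.mem_empty_iff_false, iff_false, not_and, not_le]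
            exact hp s
          have a2 : {s : ℤ | s ∉ S.1 ∧ s < 0} = ∅ := by
            ext s; simp only [Set.mem_ofPred_eq, Set.mem_empty_iff_false, iff_false, not_and, not_lt]
            exact h' s
          rw [a1, a2] at hS; simp at hS
        obtain ⟨k, hk, hk0⟩ := hn
        have e1 : {s : ℤ | s ∉ S.1 ∧ s < 0} = insert k {s : ℤ | s ∉ (ins k S).1 ∧ s < 0} := by
          ext s; simp only [Set.mem_ofPred_eq, mem_ins, Set.mem_insert_iff]
          by_cases hs : s = k
          · subst hs; simp [hk, hk0]
          · simp [hs]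
        have e2 : {s : ℤ | s ∈ S.1 ∧ 0 ≤ s} = {s : ℤ | s ∈ (ins k S).1 ∧ 0 ≤ s} := by
          ext s; simp only [Set.mem_ofPred_eq, mem_ins]
          constructor
          · rintro ⟨a, b⟩; exact ⟨Or.inr a, b⟩
          · rintro ⟨a | a, b⟩
            · omega
            · exact ⟨a, b⟩
        rw [e1, e2, Set.ncard_insert_of_notMem (fun h => h.1 (mem_ins.2 (Or.inl rfl)))
          (ins k S).2.2] at hS
        have hm := h2 k _ (ih (ins k S) (by omega))
        rw [psiStar_single_of_mem (mem_ins.2 (Or.inl rfl)), del_ins hk, one_mul] at hm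
        have := p.smul_mem (wedgeSign k (ins k S)) hm
        rwa [Finsupp.smul_single, smul_eq_mul, wedgeSign_mul_self] at this
  exact key _ S rfl

/-- Schur's lemma for the fermions. -/
theorem eq_smul_one_of_commute {T : Module.End ℚ Wedge} (h1 : ∀ k, T * psi k = psi k * T)
    (h2 : ∀ k, T * psiStar k = psiStar k * T) : T = vev T • 1 := by
  -- `T` preserves the annihilation conditions that single out the vacuum. The kernel of `T - vev T
  -- • 1` then contains the vacuum and is stable under all fermions, so it is the whole space.
  have hv : T vac = vev T • vac := by
    refine eq_smul_vac (fun k hk => ?_) (fun k hk => ?_)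
    · rw [← Module.End.mul_apply, ← h1, Module.End.mul_apply, psi_vac hk, map_zero]
    · rw [← Module.End.mul_apply, ← h2, Module.End.mul_apply, psiStar_vac hk, map_zero]
  refine wedge_hom_ext fun S => ?_
  have := single_mem_of_invariant (LinearMap.ker (T - vev T • 1)) (by simp [hv])
    (fun k v hv => ?_) (fun k v hv => ?_) S
  · simpa [sub_eq_zero] using this
  · rw [LinearMap.mem_ker] at hv ⊢
    have : (T - vev T • 1) * psi k = psi k * (T - vev T • 1) := by
      rw [sub_mul, mul_sub, h1]; simp
    rw [← Module.End.mul_apply, this, Module.End.mul_apply, hv, map_zero]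
  · rw [LinearMap.mem_ker] at hv ⊢
    have : (T - vev T • 1) * psiStar k = psiStar k * (T - vev T • 1) := by
      rw [sub_mul, mul_sub, h2]; simp
    rw [← Module.End.mul_apply, this, Module.End.mul_apply, hv, map_zero]

/-! ### Bilinear operators in the fermions -/

theorem wedge_mul_neg (T U : Module.End ℚ Wedge) : T * -U = -(T * U) := mul_neg T U

theorem wedge_neg_mul (T U : Module.End ℚ Wedge) : -T * U = -(T * U) := neg_mul T U

theorem commutator_mul {A : Type*} [Ring A] (T p s : A) :
    T * (p * s) - p * s * T = (T * p - p * T) * s + p * (T * s - s * T) := by noncomm_ring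

/-- Jacobi identity for operators whose commutator with a fermion `x` is a multiple of a shifted
fermion: `[T, U] - V` commutes with `x` as soon as the scalar of `V` is the one produced by `[T,
U]`. -/
theorem commutator_jacobi {A : Type*} [Ring A] [Algebra ℚ A] {T U V x y y' w : A}
    {f f' g g' h : ℚ} (hT : T * x - x * T = f • y') (hU : U * x - x * U = g • y)
    (hV : V * x - x * V = h • w) (hT' : T * y - y * T = f' • w) (hU' : U * y' - y' * U = g' • w)
    (e : h = g * f' - f * g') : (T * U - U * T - V) * x = x * (T * U - U * T - V) := by
  have : (T * U - U * T - V) * x - x * (T * U - U * T - V) =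
      T * (U * x - x * U) - (U * x - x * U) * T
        - (U * (T * x - x * T) - (T * x - x * T) * U) - (V * x - x * V) := by noncomm_ring
  rw [← sub_eq_zero, this, hT, hU, hV, mul_smul_comm, smul_mul_assoc, mul_smul_comm,
    smul_mul_assoc, ← smul_sub, ← smul_sub, hT', hU', e]
  module

theorem add_neg_smul_eq_sub {A : Type*} [AddCommGroup A] [Module ℚ A] (c : ℚ) (u v : A) :
    u + (-c) • v = u - c • v := by module

/-- The normally ordered product `:ψ_{k-a} ψ_k^*:`. -/
def normalPair (a k : ℤ) : Module.End ℚ Wedge :=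
  psi (k - a) * psiStar k - if a = 0 ∧ k < 0 then 1 else 0

/-- The operator `∑_k f(k) :ψ_{k-a} ψ_k^*:`. -/
def bil (a : ℤ) (f : ℤ → ℚ) : Module.End ℚ Wedge :=
  Finsupp.linearCombination ℚ fun S : Maya =>
    ∑ᶠ k : ℤ, f k • normalPair a k (Finsupp.single S 1)

theorem psi_psiStar_single_self (k : ℤ) (S : Maya) [Decidable (k ∈ S.1)] :
    psi k (psiStar k (Finsupp.single S 1)) = if k ∈ S.1 then Finsupp.single S 1 else 0 := by
  split_ifs with h
  · rw [psiStar_single_of_mem h, psi_single_of_notMem (fun h' => (mem_del.1 h').2 rfl),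
      wedgeSign_del h, ins_del h]
    simp [swapSign, wedgeSign_mul_self]
  · simp [psiStar_single_of_notMem h]

open Classical in
theorem normalPair_zero_single (k : ℤ) (S : Maya) :
    normalPair 0 k (Finsupp.single S 1) =
      ((if k ∈ S.1 then 1 else 0) - (if k < 0 then 1 else 0) : ℚ) • Finsupp.single S (1 : ℚ) := by
  simp only [normalPair, sub_zero, LinearMap.sub_apply, Module.End.mul_apply,
    psi_psiStar_single_self, true_and]
  split_ifs <;> simp

theorem normalPair_support_finite (a : ℤ) (S : Maya) :
    (Function.support fun k : ℤ => normalPair a k (Finsupp.single S (1 : ℚ))).Finite := by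
  by_cases ha : a = 0
  · subst ha
    refine (S.2.1.union S.2.2).subset fun k hk => ?_
    rw [Function.mem_support, normalPair_zero_single] at hk
    by_cases h1 : k ∈ S.1
    · by_cases h2 : k < 0
      · simp [h1, h2] at hk
      · exact Or.inl ⟨h1, by omega⟩
    · by_cases h2 : k < 0
      · exact Or.inr ⟨h1, h2⟩
      · simp [h1, h2] at hk
  · simpa [normalPair, ha] using alpha_summand_finite ha S

open Filter in
/-- `T` is the operator `∑_k f(k) :ψ_{k-a} ψ_k^*:`. -/
def IsBil (T : Module.End ℚ Wedge) (a : ℤ) (f : ℤ → ℚ) : Prop :=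
  ∀ v, ∀ᶠ t : Finset ℤ in atTop, T v = ∑ k ∈ t, f k • normalPair a k v

open Filter in
theorem isBil_bil (a : ℤ) (f : ℤ → ℚ) : IsBil (bil a f) a f := by
  intro v
  induction v using Finsupp.induction_linear with
  | zero => simp
  | add v w hv hw =>
    filter_upwards [hv, hw] with t h1 h2
    simp [h1, h2, sum_add_distrib]
  | single S c =>
    have hfin := normalPair_support_finite a S
    filter_upwards [eventually_ge_atTop hfin.toFinset] with t ht
    rw [bil, Finsupp.linearCombination_single, finsum_eq_sum_of_support_subset _ (s := t),
      smul_sum]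
    · refine sum_congr rfl fun k _ => ?_
      rw [smul_comm, ← map_smul, Finsupp.smul_single, smul_eq_mul, mul_one]
    · intro k hk
      refine ht (hfin.mem_toFinset.2 fun h => hk ?_)
      simp [h]

theorem alpha_eq_bil {m : ℤ} (hm : m ≠ 0) : alpha m = bil m 1 := by
  simp [alpha, bil, normalPair, hm]

theorem calF_eq_bil (p : ℕ) : calF p = bil 0 fun k => ((k : ℚ) + 1 / 2) ^ p := by
  classical
  refine wedge_hom_ext fun S => ?_
  rw [calF, bil, Finsupp.linearCombination_single, Finsupp.linearCombination_single, one_smul,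
    one_smul, finsum_eq_sum_of_support_subset _ (s := S.2.1.toFinset ∪ S.2.2.toFinset),
    sum_union]
  · rw [sub_eq_add_neg, ← sum_neg_distrib, Finsupp.single_add, Finsupp.single_finsetSum,
      Finsupp.single_finsetSum]
    congr 1 <;> refine sum_congr rfl fun k hk => ?_
    · obtain ⟨h1, h2⟩ := S.2.1.mem_toFinset.1 hk
      rw [normalPair_zero_single, if_pos h1, if_neg (not_lt.2 h2)]; simp
    · obtain ⟨h1, h2⟩ := S.2.2.mem_toFinset.1 hk
      rw [normalPair_zero_single, if_neg h1, if_pos h2]; simp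
  · rw [Finset.disjoint_left]
    intro k h1 h2
    exact (S.2.2.mem_toFinset.1 h2).1 (S.2.1.mem_toFinset.1 h1).1
  · intro k hk
    rw [Function.mem_support, normalPair_zero_single] at hk
    by_cases h1 : k ∈ S.1
    · by_cases h2 : k < 0
      · simp [h1, h2] at hk
      · exact mem_union_left _ (S.2.1.mem_toFinset.2 ⟨h1, by omega⟩)
    · by_cases h2 : k < 0
      · exact mem_union_right _ (S.2.2.mem_toFinset.2 ⟨h1, h2⟩)
      · simp [h1, h2] at hk

/-! ### Commutators of bilinear operators with single fermions -/

theorem normalPair_mul_psi (a k j : ℤ) :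
    normalPair a k * psi j - psi j * normalPair a k = if j = k then psi (k - a) else 0 := by
  have e1 : psi (k - a) * psiStar k * psi j = (if j = k then psi (k - a) else 0) +
      psi j * (psi (k - a) * psiStar k) := by
    rw [mul_assoc, psiStar_mul_psi, mul_sub, ← mul_assoc (psi (k - a)), psi_mul_psi (k - a) j,
      wedge_neg_mul, sub_neg_eq_add, mul_assoc]
    split_ifs <;> simp
  rw [normalPair, sub_mul, mul_sub, e1]
  split_ifs <;> simp

theorem normalPair_mul_psiStar (a k j : ℤ) :
    normalPair a k * psiStar j - psiStar j * normalPair a k =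
      if j + a = k then -psiStar k else 0 := by
  have e1 : psi (k - a) * psiStar k * psiStar j = (if j + a = k then -psiStar k else 0) +
      psiStar j * (psi (k - a) * psiStar k) := by
    rw [mul_assoc, psiStar_mul_psiStar, wedge_mul_neg, ← mul_assoc, psi_mul_psiStar, sub_mul]
    have : k - a = j ↔ j + a = k := by omega
    simp only [this]
    split_ifs
    · simp only [mul_assoc, one_mul]; abel
    · simp [mul_assoc]
  rw [normalPair, sub_mul, mul_sub, e1]
  split_ifs <;> simp

namespace IsBil

open Filter

variable {T U : Module.End ℚ Wedge} {a b : ℤ} {f g : ℤ → ℚ}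

theorem comm_psi (h : IsBil T a f) (j : ℤ) :
    T * psi j - psi j * T = f j • psi (j - a) := by
  refine LinearMap.ext fun v => ?_
  -- One finite set computes `T` both on `v` and on `psi j v` and contains `j`. The commutator
  -- becomes a finite sum in which only `k = j` survives.
  obtain ⟨t, h1, h2, h3⟩ := ((h v).and ((h (psi j v)).and (eventually_ge_atTop {j}))).exists
  simp only [LinearMap.sub_apply, Module.End.mul_apply, LinearMap.smul_apply]
  rw [h1, h2, map_sum, ← sum_sub_distrib]
  simp only [map_smul, ← smul_sub]
  have : ∀ k, normalPair a k (psi j v) - psi j (normalPair a k v) =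
      (if j = k then psi (k - a) else 0) v := fun k => by
    rw [← normalPair_mul_psi]; rfl
  simp only [this]
  rw [sum_eq_single j]
  · simp
  · intro k _ hk; simp [Ne.symm hk]
  · intro h; exact absurd (h3 (mem_singleton_self j)) h

theorem comm_psiStar (h : IsBil T a f) (j : ℤ) :
    T * psiStar j - psiStar j * T = (-f (j + a)) • psiStar (j + a) := by
  refine LinearMap.ext fun v => ?_
  obtain ⟨t, h1, h2, h3⟩ := ((h v).and ((h (psiStar j v)).and
    (eventually_ge_atTop {j + a}))).exists
  simp only [LinearMap.sub_apply, Module.End.mul_apply, LinearMap.smul_apply]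
  rw [h1, h2, map_sum, ← sum_sub_distrib]
  simp only [map_smul, ← smul_sub]
  have : ∀ k, normalPair a k (psiStar j v) - psiStar j (normalPair a k v) =
      (if j + a = k then -psiStar k else 0) v := fun k => by
    rw [← normalPair_mul_psiStar]; rfl
  simp only [this]
  rw [sum_eq_single (j + a)]
  · simp
  · intro k _ hk; simp [Ne.symm hk]
  · intro h; exact absurd (h3 (mem_singleton_self _)) h

/-- For `a ≤ 0` the normally ordered pair can be written, up to sign, with leftmost factor `psi` of
a level `≥ 0` or `psiStar` of a level `< 0`. The image of either has no vacuum component. -/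
theorem normalPair_apply_vacuum (ha : a ≤ 0) (k : ℤ) (v : Wedge) :
    normalPair a k v vacuum = 0 := by
  by_cases h0 : a = 0
  · subst h0
    by_cases hk : k < 0
    · have : normalPair 0 k = -(psiStar k * psi k) := by
        simp [normalPair, hk, psi_mul_psiStar]
      rw [this]
      simp only [LinearMap.neg_apply, Module.End.mul_apply, Finsupp.neg_apply, neg_eq_zero]
      exact psiStar_apply_of_mem hk _
    · simp only [normalPair, hk, sub_zero, and_false, if_false, Module.End.mul_apply]
      exact psi_apply_of_notMem hk _
  · by_cases hk : k - a < 0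
    · simp only [normalPair, h0, false_and, if_false, sub_zero, psi_mul_psiStar]
      rw [if_neg (by omega), zero_sub, LinearMap.neg_apply, Finsupp.neg_apply, neg_eq_zero]
      exact psiStar_apply_of_mem (S := vacuum) (show k < 0 by omega) _
    · simp only [normalPair, h0, false_and, if_false, sub_zero, Module.End.mul_apply]
      exact psi_apply_of_notMem hk _

theorem apply_vacuum (h : IsBil T a f) (ha : a ≤ 0) (v : Wedge) : T v vacuum = 0 := by
  obtain ⟨t, ht⟩ := (h v).exists
  rw [ht, Finsupp.finsetSum_apply]
  exact sum_eq_zero fun k _ => by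
    rw [Finsupp.smul_apply, normalPair_apply_vacuum ha, smul_zero]

/-- A term survives on the vacuum only if it lifts a filled level `k < 0` to an empty level `k + a ≥
0`. -/
theorem apply_vac (h : IsBil T (-a) f) (ha : 0 ≤ a) :
    T vac = ∑ k ∈ Ico (-a) 0, f k • psi (k + a) (psiStar k vac) := by
  obtain ⟨t, h1, h2⟩ := ((h vac).and (eventually_ge_atTop (Ico (-a) 0))).exists
  rw [h1, ← sum_subset h2]
  · refine sum_congr rfl fun k hk => ?_
    have : ¬ (-a = 0 ∧ k < 0) := by rw [mem_Ico] at hk; omega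
    rw [normalPair, if_neg this]; simp
  · intro k _ hk
    rw [mem_Ico] at hk
    rcases lt_or_ge k 0 with h0 | h0
    · have hk' : k + a < 0 := by omega
      rcases eq_or_ne a 0 with rfl | ha0
      · have : normalPair (-0) k = -(psiStar k * psi k) := by
          simp [normalPair, h0, psi_mul_psiStar]
        rw [this]; simp [psi_vac h0]
      · have : normalPair (-a) k = -(psiStar k * psi (k + a)) := by
          simp [normalPair, psi_mul_psiStar, ha0]
        rw [this]; simp [psi_vac hk']
    · have : ¬ (-a = 0 ∧ k < 0) := by omega
      rw [normalPair, if_neg this]; simp [psiStar_vac h0]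

theorem comm_pair (h : IsBil T a f) (p k : ℤ) :
    T * (psi p * psiStar k) - psi p * psiStar k * T =
      f p • (psi (p - a) * psiStar k) - f (k + a) • (psi p * psiStar (k + a)) := by
  have e1 := h.comm_psi p
  have e2 := h.comm_psiStar k
  have : T * (psi p * psiStar k) - psi p * psiStar k * T =
      (T * psi p - psi p * T) * psiStar k + psi p * (T * psiStar k - psiStar k * T) :=
    commutator_mul _ _ _
  rw [this, e1, e2, mul_smul_comm, smul_mul_assoc]
  exact add_neg_smul_eq_sub _ _ _

/-- By the Jacobi identity `[T, U] - V` commutes with every fermion, so Schur's lemma makes it a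
scalar. This scalar is the central term, computable on the vacuum alone. -/
theorem comm_sub_commute {V : Module.End ℚ Wedge} (hT : IsBil T a f) (hU : IsBil U b g)
    (hV : IsBil V (a + b) fun j => f (j - b) * g j - f j * g (j - a)) :
    T * U - U * T - V = vev (T * U - U * T - V) • 1 := by
  refine eq_smul_one_of_commute (fun j => ?_) (fun j => ?_)
  · have e1 := hT.comm_psi (j - b)
    have e2 := hU.comm_psi (j - a)
    rw [show j - b - a = j - (a + b) by ring] at e1
    rw [show j - a - b = j - (a + b) by ring] at e2
    exact commutator_jacobi (hT.comm_psi j) (hU.comm_psi j) (hV.comm_psi j) e1 e2 (by ring)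
  · have e1 := hT.comm_psiStar (j + b)
    have e2 := hU.comm_psiStar (j + a)
    have e3 := hV.comm_psiStar j
    rw [show j + b + a = j + (a + b) by ring] at e1
    rw [show j + a + b = j + (a + b) by ring] at e2
    refine commutator_jacobi (hT.comm_psiStar j) (hU.comm_psiStar j) e3 e1 e2 ?_
    rw [show j + (a + b) - b = j + a by ring, show j + (a + b) - a = j + b by ring]
    ring

/-- Commutators of bilinear operators, away from the central term. -/
theorem comm_of_nonpos {V : Module.End ℚ Wedge} (hT : IsBil T a f) (hU : IsBil U b g)
    (hV : IsBil V (a + b) fun j => f (j - b) * g j - f j * g (j - a)) (ha : a ≤ 0) (hb : b ≤ 0) :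
    T * U = U * T + V := by
  have h := hT.comm_sub_commute hU hV
  -- No image of an operator with shift `≤ 0` has a vacuum component, so the central term is zero.
  have h0 : vev (T * U - U * T - V) = 0 := by
    simp only [vev, LinearMap.sub_apply, Module.End.mul_apply, Finsupp.sub_apply]
    rw [hT.apply_vacuum ha, hU.apply_vacuum hb, hV.apply_vacuum (by omega)]; simp
  rw [h0, zero_smul, sub_sub, sub_eq_zero] at h
  exact h

theorem vac_eq_zero (h : IsBil T a f) (ha : 0 ≤ a) : T vac = 0 := by
  obtain ⟨t, h1⟩ := (h vac).exists
  rw [h1]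
  refine sum_eq_zero fun k _ => ?_
  rcases lt_or_ge k 0 with h0 | h0
  · rcases eq_or_ne a 0 with rfl | ha0
    · have : normalPair 0 k = -(psiStar k * psi k) := by
        simp [normalPair, h0, psi_mul_psiStar]
      rw [this]; simp [psi_vac h0]
    · have : normalPair a k = -(psiStar k * psi (k - a)) := by
        simp [normalPair, psi_mul_psiStar, ha0]
      rw [this]; simp [psi_vac (show k - a < 0 by omega)]
  · have : ¬ (a = 0 ∧ k < 0) := by omega
    simp [normalPair, this, psiStar_vac h0]

end IsBil

theorem bil_zero (a : ℤ) : bil a 0 = 0 := by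
  refine wedge_hom_ext fun S => ?_
  simp [bil]

theorem isBil_alpha {m : ℤ} (hm : m ≠ 0) : IsBil (alpha m) m 1 := by
  rw [alpha_eq_bil hm]; exact isBil_bil m 1

theorem isBil_zero (a : ℤ) : IsBil 0 a 0 := by
  simpa [bil_zero] using isBil_bil a 0

theorem alpha_neg_commute {m n : ℤ} (hm : 0 < m) (hn : 0 < n) :
    alpha (-m) * alpha (-n) = alpha (-n) * alpha (-m) := by
  have := (isBil_alpha (m := -m) (by omega)).comm_of_nonpos
    (isBil_alpha (m := -n) (by omega)) (V := 0) (by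
      convert isBil_zero _ using 1; ext; simp) (by omega) (by omega)
  simpa using this

theorem vev_pair_vac {p k : ℤ} (hk : k < 0) :
    psi p (psiStar k vac) vacuum = if p = k then 1 else 0 := by
  rw [← Module.End.mul_apply, psi_mul_psiStar, LinearMap.sub_apply, Finsupp.sub_apply,
    Module.End.mul_apply, psiStar_apply_of_mem (S := vacuum) hk]
  split_ifs <;> simp [vac]

/-- The Heisenberg relations between annihilation and creation operators. -/
theorem alpha_comm {q m : ℤ} (hq : 0 < q) (hm : 0 < m) :
    alpha q * alpha (-m) = alpha (-m) * alpha q + (if q = m then (q : ℚ) else 0) • 1 := by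
  have hT := isBil_alpha (m := q) (by omega)
  have hU := isBil_alpha (m := -m) (by omega)
  have h := hT.comm_sub_commute hU (V := 0) (by
      convert isBil_zero _ using 1; ext; simp)
  rw [sub_zero] at h
  rw [← sub_eq_iff_eq_add', h]
  congr 1
  simp only [vev, LinearMap.sub_apply, Module.End.mul_apply, Finsupp.sub_apply]
  change alpha q (alpha (-m) vac) vacuum - alpha (-m) (alpha q vac) vacuum = _
  rw [hU.apply_vacuum (by omega), hU.apply_vac hm.le, sub_zero, map_sum,
    Finsupp.finsetSum_apply]
  -- Each of the `m` pairs created by `α_{-m}` contributes `1` when `q = m` and `0` otherwise, which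
  -- sums to the central term.
  have key : ∀ k ∈ Ico (-m) 0, (alpha q) ((1 : ℤ → ℚ) k • psi (k + m) (psiStar k vac)) vacuum =
      if q = m then 1 else 0 := by
    intro k hk
    rw [mem_Ico] at hk
    have hc := congrArg (fun X => X vac) (hT.comm_pair (k + m) k)
    simp only [LinearMap.sub_apply, Module.End.mul_apply,
      hT.vac_eq_zero hq.le, map_zero, sub_zero, Pi.one_apply, one_smul] at hc ⊢
    rw [hc, Finsupp.sub_apply, vev_pair_vac hk.2,
      psi_apply_of_notMem (S := vacuum) (show ¬ (k + m < 0) by omega), sub_zero]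
    have : k + m - q = k ↔ q = m := by omega
    simp only [this]
  rw [sum_congr rfl key]
  split_ifs with h
  · subst h
    simp
    exact_mod_cast Int.toNat_of_nonneg hq.le
  · simp

/-! ### Excitation operators -/

/-- The operator `∑_k f(k + A/2) :ψ_{k+A} ψ_k^*:` (over half-integers `k`), raising the energy
by `A`. -/
def exc (A : ℕ) (f : ℚ → ℚ) : Module.End ℚ Wedge :=
  bil (-(A : ℤ)) fun k => f ((k : ℚ) + 1 / 2 + A / 2)

/-- The central difference `f(x + a/2) - f(x - a/2)`. -/
def centralDiff (a : ℕ) (f : ℚ → ℚ) : ℚ → ℚ := fun x => f (x + a / 2) - f (x - a / 2)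

theorem isBil_exc (A : ℕ) (f : ℚ → ℚ) :
    IsBil (exc A f) (-(A : ℤ)) fun k => f ((k : ℚ) + 1 / 2 + A / 2) := isBil_bil _ _

theorem calF_eq_exc (p : ℕ) : calF p = exc 0 fun x => x ^ p := by
  rw [calF_eq_bil, exc]
  congr 1; ext k; simp

/-- In `exc` the function is evaluated midway between source and target level. With this convention
the two products in the commutator sample `f` at points symmetric about the new midpoint. -/
theorem exc_mul_alpha (A : ℕ) (f : ℚ → ℚ) {m : ℕ} (hm : 0 < m) :
    exc A f * alpha (-(m : ℤ)) =
      alpha (-(m : ℤ)) * exc A f + exc (A + m) (centralDiff m f) := by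
  refine (isBil_exc A f).comm_of_nonpos (isBil_alpha (by omega)) ?_ (by omega) (by omega)
  convert isBil_exc (A + m) (centralDiff m f) using 1
  · push_cast; ring
  · ext j
    simp only [centralDiff, Pi.one_apply, mul_one]
    push_cast
    congr 2 <;> ring

theorem exc_zero_vac (f : ℚ → ℚ) : exc 0 f vac = 0 :=
  (isBil_exc 0 f).vac_eq_zero (by simp)

/-- The vacuum with a particle at level `i` and a hole at level `-1-j`. -/
def pairState (i j : ℕ) : Wedge := psi i (psiStar (-1 - j) vac)

theorem sum_Ico_neg {M : Type*} [AddCommMonoid M] (N : ℕ) (F : ℤ → M) :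
    ∑ k ∈ Ico (-((N + 1 : ℕ) : ℤ)) 0, F k = ∑ x ∈ antidiagonal N, F (-1 - x.2) := by
  refine sum_bij' (fun k _ => ((k + (N + 1)).toNat, (-1 - k).toNat)) (fun x _ => -1 - (x.2 : ℤ))
    ?_ ?_ ?_ ?_ ?_
  · intro k hk; rw [mem_Ico] at hk; rw [HasAntidiagonal.mem_antidiagonal]; push_cast at hk; omega
  · intro x hx; rw [HasAntidiagonal.mem_antidiagonal] at hx; rw [mem_Ico]; push_cast; omega
  · intro k hk; rw [mem_Ico] at hk; simp only; omega
  · rintro ⟨x, y⟩ hx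
    rw [HasAntidiagonal.mem_antidiagonal] at hx; simp only at hx ⊢
    ext <;> simp only <;> omega
  · intro k hk; rw [mem_Ico] at hk; congr 1; simp only; omega

theorem exc_succ_vac (N : ℕ) (f : ℚ → ℚ) :
    exc (N + 1) f vac = ∑ x ∈ antidiagonal N, f (((x.1 : ℚ) - x.2) / 2) • pairState x.1 x.2 := by
  rw [(isBil_exc (N + 1) f).apply_vac (by omega), sum_Ico_neg]
  refine sum_congr rfl fun x hx => ?_
  rw [HasAntidiagonal.mem_antidiagonal] at hx
  subst hx
  congr 1
  · congr 1; push_cast; ring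
  · rw [pairState]
    congr 2; push_cast; ring

theorem alpha_neg_vac (N : ℕ) :
    alpha (-((N + 1 : ℕ) : ℤ)) vac = ∑ x ∈ antidiagonal N, pairState x.1 x.2 := by
  rw [(isBil_alpha (m := -((N + 1 : ℕ) : ℤ)) (by omega)).apply_vac (by omega), sum_Ico_neg]
  refine sum_congr rfl fun x hx => ?_
  rw [HasAntidiagonal.mem_antidiagonal] at hx
  subst hx
  rw [Pi.one_apply, one_smul, pairState]
  congr 2; push_cast; ring

/-- The three contributions: the particle moves up, the hole moves down (with a sign), or a second
pair is created. -/
theorem alpha_neg_pairState (a i j : ℕ) :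
    alpha (-((a + 1 : ℕ) : ℤ)) (pairState i j) =
      pairState (i + (a + 1)) j - pairState i (j + (a + 1)) +
        ∑ x ∈ antidiagonal a, psi i (psiStar (-1 - j) (pairState x.1 x.2)) := by
  have h := congrArg (fun X => X vac)
    ((isBil_alpha (m := -((a + 1 : ℕ) : ℤ)) (by omega)).comm_pair i (-1 - j))
  simp only [LinearMap.sub_apply, Module.End.mul_apply, Pi.one_apply, one_smul] at h
  rw [sub_eq_iff_eq_add, alpha_neg_vac, map_sum, map_sum] at h
  rw [pairState, h, pairState, pairState,
    show (i : ℤ) - -((a + 1 : ℕ) : ℤ) = ((i + (a + 1) : ℕ) : ℤ) by push_cast; ring,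
    show (-1 - j : ℤ) + -((a + 1 : ℕ) : ℤ) = -1 - ((j + (a + 1) : ℕ) : ℤ) by push_cast; ring]

/-- The vacuum with two particles and two holes. -/
def twoPairState (x : (ℕ × ℕ) × (ℕ × ℕ)) : Wedge :=
  psi x.1.1 (psiStar (-1 - x.1.2) (pairState x.2.1 x.2.2))

theorem psi_psi (i j : ℤ) (v : Wedge) : psi i (psi j v) = -psi j (psi i v) := by
  have := congrArg (fun X => X v) (psi_mul_psi i j); exact this

theorem psiStar_psiStar (i j : ℤ) (v : Wedge) :
    psiStar i (psiStar j v) = -psiStar j (psiStar i v) := by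
  have := congrArg (fun X => X v) (psiStar_mul_psiStar i j); exact this

theorem psiStar_psi {i j : ℤ} (h : j ≠ i) (v : Wedge) :
    psiStar i (psi j v) = -psi j (psiStar i v) := by
  have := congrArg (fun X => X v) (psiStar_mul_psi i j)
  simpa [h] using this

theorem twoPairState_eq (x : (ℕ × ℕ) × (ℕ × ℕ)) :
    twoPairState x =
      -psi x.1.1 (psi x.2.1 (psiStar (-1 - x.1.2) (psiStar (-1 - x.2.2) vac))) := by
  rw [twoPairState, pairState, psiStar_psi (by omega), map_neg]

theorem twoPairState_swap_fst (i j k l : ℕ) :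
    twoPairState ((k, j), (i, l)) = -twoPairState ((i, j), (k, l)) := by
  simp only [twoPairState_eq]
  rw [psi_psi]

theorem twoPairState_swap_snd (i j k l : ℕ) :
    twoPairState ((i, l), (k, j)) = -twoPairState ((i, j), (k, l)) := by
  simp only [twoPairState_eq]
  rw [psiStar_psiStar, map_neg, map_neg]

/-- Particle-hole quadruples of total level `N - 1`. -/
def quads (N : ℕ) : Finset ((ℕ × ℕ) × (ℕ × ℕ)) :=
  ((range N ×ˢ range N) ×ˢ (range N ×ˢ range N)).filter
    fun x => x.1.1 + x.1.2 + (x.2.1 + x.2.2) + 1 = N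

theorem mem_quads {N : ℕ} {x : (ℕ × ℕ) × (ℕ × ℕ)} :
    x ∈ quads N ↔ x.1.1 + x.1.2 + (x.2.1 + x.2.2) + 1 = N := by
  simp only [quads, mem_filter, mem_product, mem_range]
  omega

theorem eq_zero_of_eq_neg_self {v : Wedge} (h : v = -v) : v = 0 := by
  ext S
  have := congrArg (fun w => w S) h
  simp only [Finsupp.neg_apply] at this
  simp only [Finsupp.zero_apply]
  linarith

/-- Of the two values in the central difference, the first is symmetric in the two particles and the
second in the two holes. The state is antisymmetric under both exchanges, so each half of the sum
equals its own negative. -/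
theorem sum_quads_eq_zero (N : ℕ) (f : ℚ → ℚ) :
    ∑ x ∈ quads N, centralDiff (x.2.1 + x.2.2 + 1) f (((x.1.1 : ℚ) - x.1.2) / 2) •
      twoPairState x = 0 := by
  have h1 : ∑ x ∈ quads N, f (((x.1.1 : ℚ) + x.2.1 + 1 + x.2.2 - x.1.2) / 2) • twoPairState x
      = 0 := by
    refine eq_zero_of_eq_neg_self ?_
    rw [← sum_neg_distrib]
    refine sum_nbij' (fun x => ((x.2.1, x.1.2), (x.1.1, x.2.2)))
      (fun x => ((x.2.1, x.1.2), (x.1.1, x.2.2))) ?_ ?_ (fun _ _ => rfl) (fun _ _ => rfl) ?_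
    · intro x hx; rw [mem_quads] at *; simp only; omega
    · intro x hx; rw [mem_quads] at *; simp only; omega
    · rintro ⟨⟨i, j⟩, ⟨k, l⟩⟩ -
      simp only
      rw [twoPairState_swap_fst i j k l, smul_neg, neg_neg]
      congr 2; ring
  have h2 : ∑ x ∈ quads N, f (((x.1.1 : ℚ) - x.2.1 - 1 - x.2.2 - x.1.2) / 2) • twoPairState x
      = 0 := by
    refine eq_zero_of_eq_neg_self ?_
    rw [← sum_neg_distrib]
    refine sum_nbij' (fun x => ((x.1.1, x.2.2), (x.2.1, x.1.2)))
      (fun x => ((x.1.1, x.2.2), (x.2.1, x.1.2))) ?_ ?_ (fun _ _ => rfl) (fun _ _ => rfl) ?_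
    · intro x hx; rw [mem_quads] at *; simp only; omega
    · intro x hx; rw [mem_quads] at *; simp only; omega
    · rintro ⟨⟨i, j⟩, ⟨k, l⟩⟩ -
      simp only
      rw [twoPairState_swap_snd i j k l, smul_neg, neg_neg]
      congr 2; ring
  rw [← sub_eq_zero.2 (h1.trans h2.symm), ← sum_sub_distrib]
  refine sum_congr rfl fun x _ => ?_
  rw [← sub_smul, centralDiff]
  congr 3 <;> push_cast <;> ring

theorem sum_quads {M : Type*} [AddCommMonoid M] (N : ℕ) (F : (ℕ × ℕ) × (ℕ × ℕ) → M) :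
    ∑ x ∈ quads N, F x = ∑ a ∈ range N, ∑ y ∈ antidiagonal (N - a - 1),
      ∑ z ∈ antidiagonal a, F (y, z) := by
  simp only [← sum_product']
  rw [sum_sigma']
  refine sum_bij' (fun x _ => ⟨x.2.1 + x.2.2, x⟩) (fun y _ => y.2) ?_ ?_ ?_ ?_ ?_
  · intro x hx
    rw [mem_quads] at hx
    simp only [mem_sigma, mem_product, mem_range, HasAntidiagonal.mem_antidiagonal, and_true]
    omega
  · rintro ⟨a, x⟩ hx
    simp only [mem_sigma, mem_product, mem_range, HasAntidiagonal.mem_antidiagonal] at hx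
    rw [mem_quads]; simp only; omega
  · intros; rfl
  · rintro ⟨a, x⟩ hx
    simp only [mem_sigma, mem_product, mem_range, HasAntidiagonal.mem_antidiagonal] at hx
    obtain ⟨-, -, rfl⟩ := hx
    rfl
  · intros; rfl

theorem sum_shift_fst {M : Type*} [AddCommMonoid M] (N : ℕ) (F : ℕ → ℕ × ℕ → M) :
    ∑ a ∈ range N, ∑ y ∈ antidiagonal (N - a - 1), F a (y.1 + (a + 1), y.2) =
      ∑ x ∈ antidiagonal N, ∑ a ∈ range x.1, F a x := by
  rw [sum_sigma', sum_sigma']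
  refine sum_bij' (fun x _ => ⟨(x.2.1 + (x.1 + 1), x.2.2), x.1⟩)
    (fun y _ => ⟨y.2, (y.1.1 - (y.2 + 1), y.1.2)⟩) ?_ ?_ ?_ ?_ ?_
  · rintro ⟨a, x⟩ hx
    simp only [mem_sigma, mem_range, HasAntidiagonal.mem_antidiagonal] at hx ⊢; omega
  · rintro ⟨a, x⟩ hx
    simp only [mem_sigma, mem_range, HasAntidiagonal.mem_antidiagonal] at hx ⊢; omega
  · rintro ⟨a, x⟩ hx; simp
  · rintro ⟨⟨x, y⟩, a⟩ hx
    simp only [mem_sigma, mem_range, HasAntidiagonal.mem_antidiagonal] at hx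
    simp only [Sigma.mk.injEq, Prod.mk.injEq, and_true, heq_eq_eq]; omega
  · intros; rfl

theorem sum_shift_snd {M : Type*} [AddCommMonoid M] (N : ℕ) (F : ℕ → ℕ × ℕ → M) :
    ∑ a ∈ range N, ∑ y ∈ antidiagonal (N - a - 1), F a (y.1, y.2 + (a + 1)) =
      ∑ x ∈ antidiagonal N, ∑ a ∈ range x.2, F a x := by
  rw [sum_sigma', sum_sigma']
  refine sum_bij' (fun x _ => ⟨(x.2.1, x.2.2 + (x.1 + 1)), x.1⟩)
    (fun y _ => ⟨y.2, (y.1.1, y.1.2 - (y.2 + 1))⟩) ?_ ?_ ?_ ?_ ?_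
  · rintro ⟨a, x⟩ hx
    simp only [mem_sigma, mem_range, HasAntidiagonal.mem_antidiagonal] at hx ⊢; omega
  · rintro ⟨a, x⟩ hx
    simp only [mem_sigma, mem_range, HasAntidiagonal.mem_antidiagonal] at hx ⊢; omega
  · rintro ⟨a, x⟩ hx; simp
  · rintro ⟨⟨x, y⟩, a⟩ hx
    simp only [mem_sigma, mem_range, HasAntidiagonal.mem_antidiagonal] at hx
    simp only [Sigma.mk.injEq, Prod.mk.injEq, true_and, and_true, heq_eq_eq]; omega
  · intros; rfl

/-- The row of points `i - N/2`, `N = x.1 + x.2`, is re-centred at its point `(x.1 - x.2)/2`, which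
has `x.1` points below it and `x.2` above. -/
theorem sum_levels (x : ℕ × ℕ) (f : ℚ → ℚ) :
    ∑ i ∈ range (x.1 + x.2 + 1), f (i - ((x.1 + x.2 : ℕ) : ℚ) / 2) =
      ∑ a ∈ range x.1, f (((x.1 : ℚ) - x.2) / 2 - (a + 1)) + f (((x.1 : ℚ) - x.2) / 2) +
        ∑ a ∈ range x.2, f (((x.1 : ℚ) - x.2) / 2 + (a + 1)) := by
  rw [show x.1 + x.2 + 1 = (x.1 + 1) + x.2 by ring, sum_range_add, sum_range_succ,
    ← sum_range_reflect]
  congr 1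
  · congr 1
    · refine sum_congr rfl fun a ha => ?_
      rw [mem_range] at ha
      congr 1
      rw [Nat.cast_sub (by omega), Nat.cast_sub (by omega)]
      push_cast; ring
    · congr 1; push_cast; ring
  · refine sum_congr rfl fun a ha => ?_
    congr 1; push_cast; ring

/-- The recursion expressing one-excitation states through the Heisenberg algebra. -/
theorem exc_vac_recursion (N : ℕ) (f : ℚ → ℚ) :
    ((N + 1 : ℕ) : ℚ) • exc (N + 1) f vac =
      ∑ a ∈ range N, alpha (-((a + 1 : ℕ) : ℤ)) (exc (N - a) (centralDiff (a + 1) f) vac) +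
        (∑ i ∈ range (N + 1), f (i - (N : ℚ) / 2)) • alpha (-((N + 1 : ℕ) : ℤ)) vac := by
  have h1 : ∀ a ∈ range N,
      alpha (-((a + 1 : ℕ) : ℤ)) (exc (N - a) (centralDiff (a + 1) f) vac) =
        (∑ y ∈ antidiagonal (N - a - 1),
          (f (((((y.1 + (a + 1) : ℕ) : ℚ) - y.2) / 2)) -
            f (((((y.1 + (a + 1) : ℕ) : ℚ) - y.2) / 2) - (a + 1))) • pairState (y.1 + (a + 1)) y.2)
        - (∑ y ∈ antidiagonal (N - a - 1),
          (f (((((y.1 : ℚ) - (y.2 + (a + 1) : ℕ)) / 2)) + (a + 1)) -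
            f (((((y.1 : ℚ) - (y.2 + (a + 1) : ℕ)) / 2)))) • pairState y.1 (y.2 + (a + 1)))
        + ∑ y ∈ antidiagonal (N - a - 1), ∑ z ∈ antidiagonal a,
          centralDiff (z.1 + z.2 + 1) f (((y.1 : ℚ) - y.2) / 2) • twoPairState (y, z) := by
    intro a ha
    rw [mem_range] at ha
    obtain ⟨t, ht⟩ : ∃ t, N - a = t + 1 := ⟨N - a - 1, by omega⟩
    rw [ht, exc_succ_vac, map_sum, Nat.add_sub_cancel, ← sum_sub_distrib, ← sum_add_distrib]
    refine sum_congr rfl fun y _ => ?_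
    rw [map_smul, alpha_neg_pairState, smul_add, smul_sub, smul_sum]
    congr 1
    · congr 2
      · rw [centralDiff]; congr 2 <;> push_cast <;> ring
      · rw [centralDiff]; congr 2 <;> push_cast <;> ring
    · refine sum_congr rfl fun z hz => ?_
      rw [HasAntidiagonal.mem_antidiagonal] at hz
      rw [hz]; rfl
  rw [sum_congr rfl h1, sum_add_distrib, sum_sub_distrib,
    ← sum_quads N (fun x => centralDiff (x.2.1 + x.2.2 + 1) f (((x.1.1 : ℚ) - x.1.2) / 2) •
      twoPairState x), sum_quads_eq_zero, add_zero,
    sum_shift_fst N (fun a x => (f (((x.1 : ℚ) - x.2) / 2) -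
      f (((x.1 : ℚ) - x.2) / 2 - (a + 1))) • pairState x.1 x.2),
    sum_shift_snd N (fun a x => (f (((x.1 : ℚ) - x.2) / 2 + (a + 1)) -
      f (((x.1 : ℚ) - x.2) / 2)) • pairState x.1 x.2),
    exc_succ_vac, alpha_neg_vac, smul_sum, smul_sum, ← sum_sub_distrib, ← sum_add_distrib]
  refine sum_congr rfl fun x hx => ?_
  rw [HasAntidiagonal.mem_antidiagonal] at hx
  subst hx
  rw [← sum_smul, ← sum_smul, ← sub_smul, ← add_smul, smul_smul]
  congr 1
  -- With `y = (x.1 - x.2)/2`, the moves of the particle and of the hole give `(x.1 + x.2) f(y)`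
  -- minus the values of `f` at all other points of the row. The sum over the row restores those
  -- values and adds `f(y)` once more.
  rw [sum_levels, sum_sub_distrib, sum_sub_distrib]
  simp only [sum_const, card_range, nsmul_eq_mul]
  push_cast
  ring

/-! ### Exponential symbols -/

/-- The exponential series `e^{x z}`. -/
def expz (x : ℚ) : PowerSeries ℚ := PowerSeries.rescale x (PowerSeries.exp ℚ)

theorem expz_mul (x y : ℚ) : expz x * expz y = expz (x + y) :=
  PowerSeries.exp_mul_exp_eq_exp_add x y

/-- `ζ(a z) / z`. -/
def zetaScaledOverZ (a : ℚ) : PowerSeries ℚ :=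
  PowerSeries.mk fun j => PowerSeries.coeff (j + 1) zetaSeries * a ^ (j + 1)

/-- `ζ(a z) / (a z)`. -/
def zetaScaledOverAZ (a : ℚ) : PowerSeries ℚ :=
  PowerSeries.mk fun j => PowerSeries.coeff (j + 1) zetaSeries * a ^ j

theorem X_mul_zetaScaledOverZ (a : ℚ) :
    PowerSeries.X * zetaScaledOverZ a = expz (a / 2) - expz (-a / 2) := by
  ext j
  rcases j with _ | j
  · rw [PowerSeries.coeff_zero_X_mul]
    simp only [expz, map_sub, PowerSeries.coeff_rescale]; simp
  · rw [PowerSeries.coeff_succ_X_mul]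
    simp only [zetaScaledOverZ, PowerSeries.coeff_mk, zetaSeries, expz, map_sub,
      PowerSeries.coeff_rescale, sub_mul]
    rw [div_pow, div_pow, div_pow, div_pow, one_pow, neg_pow a]
    ring

theorem zetaScaledOverZ_eq (a : ℚ) : zetaScaledOverZ a = a • zetaScaledOverAZ a := by
  ext j
  simp only [zetaScaledOverZ, zetaScaledOverAZ, PowerSeries.coeff_mk, PowerSeries.coeff_smul,
    smul_eq_mul]
  ring

theorem zetaScaledOverZ_zero : zetaScaledOverZ 0 = 0 := by
  rw [zetaScaledOverZ_eq, zero_smul]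

theorem zetaScaledOverZ_one : zetaScaledOverZ 1 = zetaOverZ := by
  ext j; simp [zetaScaledOverZ, zetaOverZ]

theorem constantCoeff_zetaOverZ : PowerSeries.constantCoeff zetaOverZ = 1 := by
  rw [← PowerSeries.coeff_zero_eq_constantCoeff_apply]
  simp only [zetaOverZ, PowerSeries.coeff_mk, zetaSeries, map_sub, PowerSeries.coeff_rescale,
    PowerSeries.coeff_exp]
  norm_num

theorem zetaOverZ_mul_inv : zetaOverZ * zetaOverZ⁻¹ = 1 :=
  PowerSeries.mul_inv_cancel _ (by rw [constantCoeff_zetaOverZ]; norm_num)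

/-- Multiplication by `ζ(z)` makes the sum telescope to `ζ((N+1)z)`. -/
theorem sum_expz (N : ℕ) :
    ∑ i ∈ range (N + 1), expz (i - (N : ℚ) / 2) =
      zetaOverZ⁻¹ * zetaScaledOverZ ((N + 1 : ℕ) : ℚ) := by
  have h : PowerSeries.X * (zetaOverZ * ∑ i ∈ range (N + 1), expz (i - (N : ℚ) / 2)) =
      PowerSeries.X * zetaScaledOverZ ((N + 1 : ℕ) : ℚ) := by
    rw [← mul_assoc, ← zetaScaledOverZ_one, X_mul_zetaScaledOverZ, X_mul_zetaScaledOverZ, mul_sum]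
    have : ∀ i ∈ range (N + 1), (expz (1 / 2) - expz (-1 / 2)) * expz (i - (N : ℚ) / 2) =
        expz (((i + 1 : ℕ) : ℚ) - (N + 1 : ℕ) / 2) - expz ((i : ℚ) - (N + 1 : ℕ) / 2) := by
      intro i _
      rw [sub_mul, expz_mul, expz_mul]
      congr 2 <;> push_cast <;> ring
    rw [sum_congr rfl this, sum_range_sub fun i : ℕ => expz ((i : ℚ) - (N + 1 : ℕ) / 2)]
    congr 2 <;> push_cast <;> ring
  have h' := mul_left_cancel₀ PowerSeries.X_ne_zero h
  rw [← h', ← mul_assoc, mul_comm _ zetaOverZ, zetaOverZ_mul_inv, one_mul]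

/-- The function `x ↦ [z^p] w(z) e^{x z}`. -/
def expCoeff (p : ℕ) (w : PowerSeries ℚ) : ℚ → ℚ := fun x => PowerSeries.coeff p (w * expz x)

theorem expCoeff_one (p : ℕ) : (fun x : ℚ => x ^ p) = (p ! : ℚ) • expCoeff p 1 := by
  ext x
  have : (p ! : ℚ) ≠ 0 := by positivity
  simp [expCoeff, expz, PowerSeries.coeff_rescale, PowerSeries.coeff_exp]
  field_simp

theorem expCoeff_smul (p : ℕ) (c : ℚ) (w : PowerSeries ℚ) :
    expCoeff p (c • w) = c • expCoeff p w := by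
  ext x; simp [expCoeff]

/-- Exponentials are eigenfunctions of the central difference, with eigenvalue `ζ(az)`. Iterated
commutators therefore only multiply symbols. -/
theorem centralDiff_expCoeff (a p : ℕ) (w : PowerSeries ℚ) :
    centralDiff a (expCoeff p w) = expCoeff p (w * (PowerSeries.X * zetaScaledOverZ a)) := by
  ext x
  rw [centralDiff, expCoeff, expCoeff, expCoeff, X_mul_zetaScaledOverZ, mul_assoc, sub_mul,
    expz_mul, expz_mul, mul_sub, map_sub]
  congr 4 <;> ring

theorem bil_smul (a : ℤ) (c : ℚ) (f : ℤ → ℚ) : bil a (c • f) = c • bil a f := by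
  refine wedge_hom_ext fun S => ?_
  simp only [bil, LinearMap.smul_apply, Finsupp.linearCombination_single, one_smul,
    Pi.smul_apply, smul_assoc]
  rw [smul_finsum]

theorem exc_smul (A : ℕ) (c : ℚ) (f : ℚ → ℚ) : exc A (c • f) = c • exc A f := by
  rw [exc, exc, ← bil_smul]; rfl

/-! ### Bosonic states -/

/-- The creation operator `α_{-i} / i`, which vanishes for `i = 0`. -/
def cre (i : ℕ) : Module.End ℚ Wedge := (1 / (i : ℚ)) • alpha (-(i : ℤ))

theorem cre_zero : cre 0 = 0 := by simp [cre]

theorem cre_commute (i j : ℕ) : Commute (cre i) (cre j) := by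
  rcases Nat.eq_zero_or_pos i with rfl | hi
  · rw [cre_zero]; exact Commute.zero_left _
  rcases Nat.eq_zero_or_pos j with rfl | hj
  · rw [cre_zero]; exact Commute.zero_right _
  · have : Commute (alpha (-(i : ℤ))) (alpha (-(j : ℤ))) :=
      alpha_neg_commute (by omega) (by omega)
    exact (this.smul_left _).smul_right _

/-- The product of the creation operators of a multiset. -/
def bos (s : Multiset ℕ) : Module.End ℚ Wedge :=
  (s.map cre).noncommProd (by
    intro x hx y hy _
    obtain ⟨i, -, rfl⟩ := Multiset.mem_map.1 hx
    obtain ⟨j, -, rfl⟩ := Multiset.mem_map.1 hy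
    exact cre_commute i j)

theorem bos_zero : bos 0 = 1 := rfl

theorem bos_cons (i : ℕ) (s : Multiset ℕ) : bos (i ::ₘ s) = cre i * bos s := by
  simp [bos, Multiset.noncommProd_cons]

theorem bos_add (s t : Multiset ℕ) : bos (s + t) = bos s * bos t := by
  simp [bos, Multiset.noncommProd_add]

theorem bos_coe (l : List ℕ) :
    bos l = (l.map fun i : ℕ => (1 / (i : ℚ)) • alpha (-(i : ℤ))).prod := by
  simp only [bos, Multiset.map_coe, Multiset.noncommProd_coe]
  rfl

theorem exc_mul_cre (A : ℕ) (f : ℚ → ℚ) {i : ℕ} (hi : 0 < i) :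
    exc A f * cre i = cre i * exc A f + (1 / (i : ℚ)) • exc (A + i) (centralDiff i f) := by
  rw [cre, mul_smul_comm, exc_mul_alpha A f hi, smul_add, smul_mul_assoc]

theorem exc_mul_cre_expCoeff (A p : ℕ) (w : PowerSeries ℚ) {i : ℕ} (hi : 0 < i) :
    exc A (expCoeff p w) * cre i = cre i * exc A (expCoeff p w) +
      exc (A + i) (expCoeff p (w * (PowerSeries.X * zetaScaledOverAZ i))) := by
  rw [exc_mul_cre A _ hi, centralDiff_expCoeff, ← exc_smul, ← expCoeff_smul, zetaScaledOverZ_eq,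
    mul_smul_comm, mul_smul_comm, smul_smul, one_div, inv_mul_cancel₀ (by positivity), one_smul]

/-- Each creation operator is either passed or absorbed by a commutator. Absorption raises the
energy by `ν i` and multiplies the symbol by `ζ(ν_i z)/ν_i`; `L` is the set of absorbed ones. -/
theorem exc_mul_bos {ι : Type*} [DecidableEq ι] (S : Finset ι) (ν : ι → ℕ)
    (hν : ∀ i ∈ S, 0 < ν i) (A p : ℕ) (w : PowerSeries ℚ) :
    exc A (expCoeff p w) * bos (S.val.map ν) =
      ∑ L ∈ S.powerset, bos ((S \ L).val.map ν) * exc (A + ∑ i ∈ L, ν i)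
        (expCoeff p (w * ∏ i ∈ L, (PowerSeries.X * zetaScaledOverAZ (ν i)))) := by
  induction S using Finset.induction_on generalizing A w with
  | empty => simp [bos_zero]
  | insert j S hj ih =>
    have hν' : ∀ i ∈ S, 0 < ν i := fun i hi => hν i (mem_insert_of_mem hi)
    rw [insert_val_of_notMem hj, Multiset.map_cons, bos_cons, ← mul_assoc,
      exc_mul_cre_expCoeff _ _ _ (hν j (mem_insert_self j S)), add_mul, mul_assoc, ih hν', ih hν',
      sum_powerset_insert hj, mul_sum]
    congr 1
    · refine sum_congr rfl fun L hL => ?_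
      have hjL : j ∉ L := fun h => hj (mem_powerset.1 hL h)
      rw [insert_sdiff_of_notMem _ hjL, insert_val_of_notMem (fun h => hj (mem_sdiff.1 h).1),
        Multiset.map_cons, bos_cons, mul_assoc]
    · refine sum_congr rfl fun L hL => ?_
      have hjL : j ∉ L := fun h => hj (mem_powerset.1 hL h)
      rw [sum_insert hjL, prod_insert hjL, insert_sdiff_insert, sdiff_insert_of_notMem hj,
        add_assoc, mul_assoc]

/-- Tuples of `m` naturals with sum `A`. -/
abbrev tuples (m A : ℕ) : Finset (Fin m → ℕ) := piAntidiag univ A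

theorem mem_tuples {m A : ℕ} {a : Fin m → ℕ} : a ∈ tuples m A ↔ ∑ j, a j = A := by
  simp [mem_piAntidiag]

theorem sum_tuples_succ {M : Type*} [AddCommMonoid M] (m A : ℕ) (F : (Fin (m + 1) → ℕ) → M) :
    ∑ a ∈ tuples (m + 1) A, F a =
      ∑ x ∈ antidiagonal A, ∑ a ∈ tuples m x.2, F (Fin.cons x.1 a) := by
  rw [sum_sigma']
  refine sum_bij' (fun a _ => ⟨(a 0, ∑ j, Fin.tail a j), Fin.tail a⟩)
    (fun y _ => Fin.cons y.1.1 y.2) ?_ ?_ ?_ ?_ ?_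
  · intro a ha
    rw [mem_tuples, Fin.sum_univ_succ] at ha
    simp only [mem_sigma, HasAntidiagonal.mem_antidiagonal, mem_tuples, and_true]
    exact ha
  · rintro ⟨⟨x, y⟩, a⟩ h
    simp only [mem_sigma, HasAntidiagonal.mem_antidiagonal, mem_tuples] at h
    rw [mem_tuples, Fin.sum_univ_succ]
    simp [h.1, h.2]
  · intro a _; simp
  · rintro ⟨⟨x, y⟩, a⟩ h
    simp only [mem_sigma, HasAntidiagonal.mem_antidiagonal, mem_tuples] at h
    simp [h.2]
  · intro a _; simp

/-- `A` is the sum of the entries, and by symmetry every entry contributes as much as entry `0`.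
This trades the energy factor of the recursion for a marked first entry. -/
theorem sum_tuples_symm {M : Type*} [AddCommMonoid M] [Module ℚ M] (m A : ℕ)
    (F : (Fin (m + 1) → ℕ) → M)
    (hF : ∀ (e : Equiv.Perm (Fin (m + 1))) a, F (a ∘ e) = F a) :
    (A : ℚ) • ∑ a ∈ tuples (m + 1) A, F a =
      ((m + 1 : ℕ) : ℚ) • ∑ a ∈ tuples (m + 1) A, (a 0 : ℚ) • F a := by
  have h1 : (A : ℚ) • ∑ a ∈ tuples (m + 1) A, F a =
      ∑ j : Fin (m + 1), ∑ a ∈ tuples (m + 1) A, (a j : ℚ) • F a := by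
    rw [sum_comm, smul_sum]
    refine sum_congr rfl fun a ha => ?_
    rw [← sum_smul, ← Nat.cast_sum, mem_tuples.1 ha]
  have h2 : ∀ j : Fin (m + 1), ∑ a ∈ tuples (m + 1) A, (a j : ℚ) • F a =
      ∑ a ∈ tuples (m + 1) A, (a 0 : ℚ) • F a := by
    intro j
    refine sum_nbij' (fun a => a ∘ Equiv.swap 0 j) (fun a => a ∘ Equiv.swap 0 j) ?_ ?_ ?_ ?_ ?_
    · intro a ha
      rw [mem_tuples] at ha ⊢
      rw [← ha]; exact Equiv.sum_comp (Equiv.swap 0 j) a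
    · intro a ha
      rw [mem_tuples] at ha ⊢
      rw [← ha]; exact Equiv.sum_comp (Equiv.swap 0 j) a
    · intro a _; ext i; simp
    · intro a _; ext i; simp
    · intro a _; rw [hF]; simp
  rw [h1, sum_congr rfl fun j _ => h2 j, sum_const, card_univ, Fintype.card_fin, Nat.cast_smul_eq_nsmul]

/-- The symbol `z^{m-1} · z / ζ(z) · ∏_j ζ(a_j z) / z`. -/
def creSymbol {m : ℕ} (a : Fin m → ℕ) : PowerSeries ℚ :=
  PowerSeries.X ^ (m - 1) * (zetaOverZ⁻¹ * ∏ j, zetaScaledOverZ (a j))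

/-- The multiset of the entries of a tuple. -/
abbrev entries {m : ℕ} (a : Fin m → ℕ) : Multiset ℕ := (univ : Finset (Fin m)).val.map a

theorem entries_comp {m : ℕ} (a : Fin m → ℕ) (e : Equiv.Perm (Fin m)) :
    entries (a ∘ e) = entries a := by
  rw [entries, entries, ← Multiset.map_map]
  congr 1
  exact congrArg Finset.val (map_univ_equiv e)

theorem entries_cons {m : ℕ} (x : ℕ) (a : Fin m → ℕ) :
    entries (Fin.cons x a : Fin (m + 1) → ℕ) = x ::ₘ entries a := by
  rw [entries, Fin.univ_succ]
  simp [Function.comp_def]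

theorem cre_smul_self {i : ℕ} (hi : 0 < i) : (i : ℚ) • cre i = alpha (-(i : ℤ)) := by
  rw [cre, smul_smul, mul_one_div, div_self (by positivity), one_smul]

/-- One-excitation states in terms of bosons. -/
theorem exc_vac_eq (A : ℕ) (hA : 0 < A) (M : ℕ) (hM : A ≤ M) (p : ℕ) (w : PowerSeries ℚ) :
    exc A (expCoeff p w) vac = ∑ m ∈ range M, (1 / ((m + 1)! : ℚ)) •
      ∑ a ∈ tuples (m + 1) A, PowerSeries.coeff p (w * creSymbol a) • bos (entries a) vac := by
  induction A using Nat.strong_induction_on generalizing M w with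
  | _ A ih =>
  obtain ⟨N, rfl⟩ : ∃ N, A = N + 1 := ⟨A - 1, by omega⟩
  obtain ⟨M, rfl⟩ : ∃ M', M = M' + 1 := ⟨M - 1, by omega⟩
  have hne : ((N + 1 : ℕ) : ℚ) ≠ 0 := by positivity
  have inj : Function.Injective fun v : Wedge => ((N + 1 : ℕ) : ℚ) • v :=
    smul_right_injective Wedge hne
  apply inj
  simp only
  rw [exc_vac_recursion, smul_sum]
  -- By symmetry the factor `N + 1` marks the first part `x.1`; combined with `cre x.1` it gives
  -- back `α_{-x.1}`, the operator on the left in the recursion.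
  have e1 : ∀ m ∈ range (M + 1), ((N + 1 : ℕ) : ℚ) • (1 / ((m + 1)! : ℚ)) •
      ∑ a ∈ tuples (m + 1) (N + 1),
        PowerSeries.coeff p (w * creSymbol a) • bos (entries a) vac =
      (1 / (m ! : ℚ)) • ∑ x ∈ antidiagonal (N + 1), ∑ a ∈ tuples m x.2,
        PowerSeries.coeff p (w * (PowerSeries.X ^ m * (zetaOverZ⁻¹ * (zetaScaledOverZ x.1 *
          ∏ j, zetaScaledOverZ (a j))))) • (x.1 : ℚ) • cre x.1 (bos (entries a) vac) := by
    intro m _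
    rw [smul_comm, sum_tuples_symm, smul_smul, sum_tuples_succ]
    · congr 1
      · rw [Nat.factorial_succ]; push_cast; field_simp
      · refine sum_congr rfl fun x _ => sum_congr rfl fun a _ => ?_
        rw [entries_cons, bos_cons, smul_comm, creSymbol, Fin.prod_univ_succ]
        simp
    · intro e a
      rw [entries_comp, creSymbol, creSymbol]
      congr 4
      congr 1
      exact Equiv.prod_comp e fun j => zetaScaledOverZ (a j)
  -- Tuples with at least two entries match the induction hypothesis applied to the states of energy
  -- `N - b`. The one-entry tuple, `m = 0`, matches the last term of the recursion.
  rw [sum_congr rfl e1, sum_range_succ' _ M]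
  congr 1
  · have e2 : ∀ m ∈ range M, (1 / ((m + 1)! : ℚ)) • ∑ x ∈ antidiagonal (N + 1),
        ∑ a ∈ tuples (m + 1) x.2,
        PowerSeries.coeff p (w * (PowerSeries.X ^ (m + 1) * (zetaOverZ⁻¹ * (zetaScaledOverZ x.1 *
          ∏ j, zetaScaledOverZ (a j))))) • (x.1 : ℚ) • cre x.1 (bos (entries a) vac) =
        ∑ b ∈ range N, (1 / ((m + 1)! : ℚ)) • ∑ a ∈ tuples (m + 1) (N - b),
          PowerSeries.coeff p (w * (PowerSeries.X * zetaScaledOverZ ((b + 1 : ℕ) : ℚ)) *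
            creSymbol a) • alpha (-((b + 1 : ℕ) : ℤ)) (bos (entries a) vac) := by
      intro m _
      rw [← smul_sum]
      congr 1
      rw [Nat.sum_antidiagonal_eq_sum_range_succ_mk, sum_range_succ', sum_range_succ]
      have z1 : ∑ a ∈ tuples (m + 1) (N + 1 - 0),
          PowerSeries.coeff p (w * (PowerSeries.X ^ (m + 1) * (zetaOverZ⁻¹ *
            (zetaScaledOverZ ((0 : ℕ) : ℚ) * ∏ j, zetaScaledOverZ (a j))))) • ((0 : ℕ) : ℚ) •
              cre 0 (bos (entries a) vac) = 0 := by simp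
      -- A first part `N + 1` leaves only zeros for the other entries, and `ζ(0) = 0` kills the
      -- symbol. The same vanishing is why tuples longer than the energy may be left out.
      have z2 : ∑ a ∈ tuples (m + 1) (N + 1 - (N + 1)),
          PowerSeries.coeff p (w * (PowerSeries.X ^ (m + 1) * (zetaOverZ⁻¹ *
            (zetaScaledOverZ ((N + 1 : ℕ) : ℚ) * ∏ j, zetaScaledOverZ (a j))))) •
              ((N + 1 : ℕ) : ℚ) • cre (N + 1) (bos (entries a) vac) = 0 := by
        refine sum_eq_zero fun a ha => ?_
        rw [mem_tuples, Nat.sub_self] at ha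
        have : a 0 = 0 := (sum_eq_zero_iff.1 ha) 0 (mem_univ _)
        rw [Fin.prod_univ_succ, this, Nat.cast_zero, zetaScaledOverZ_zero]
        simp
      simp only [z1, z2, add_zero]
      refine sum_congr rfl fun b hb => ?_
      rw [mem_range] at hb
      rw [show N + 1 - (b + 1) = N - b by omega]
      refine sum_congr rfl fun a _ => ?_
      rw [← LinearMap.smul_apply, cre_smul_self (Nat.succ_pos b), creSymbol, Nat.add_sub_cancel]
      congr 2
      ring
    rw [sum_congr rfl e2, sum_comm]
    refine sum_congr rfl fun b hb => ?_
    rw [mem_range] at hb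
    rw [centralDiff_expCoeff, ih (N - b) (by omega) (by omega) M (by omega), map_sum]
    refine sum_congr rfl fun m _ => ?_
    rw [map_smul, map_sum]
    congr 1
    refine sum_congr rfl fun a _ => ?_
    rw [map_smul]
  · rw [Nat.sum_antidiagonal_eq_sum_range_succ_mk, sum_range_succ _ (N + 1),
      sum_eq_zero (s := range (N + 1)) (f := fun x => ∑ a ∈ tuples 0 (N + 1 - x), _), zero_add]
    · simp only [Nat.sub_self, piAntidiag_zero, sum_singleton]
      have hc : ∀ v, ((N + 1 : ℕ) : ℚ) • cre (N + 1) v = alpha (-((N + 1 : ℕ) : ℤ)) v := fun v => by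
        rw [← LinearMap.smul_apply, cre_smul_self (Nat.succ_pos N)]
      rw [hc]
      have : ∑ i ∈ range (N + 1), expCoeff p w (i - (N : ℚ) / 2) =
          PowerSeries.coeff p (w * (zetaOverZ⁻¹ * zetaScaledOverZ ((N + 1 : ℕ) : ℚ))) := by
        rw [← sum_expz, mul_sum, map_sum]; rfl
      rw [this]
      simp [entries, bos_zero]
    · intro x hx
      rw [mem_range] at hx
      have : tuples 0 (N + 1 - x) = ∅ := by
        ext a
        simp only [mem_tuples, univ_eq_empty, sum_empty, notMem_empty, iff_false]
        omega
      simp [this]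

/-- The coefficient of a cut-and-join term in which the parts `ν i`, `i ∈ L`, are joined and cut
into the parts `a`. -/
def cutJoinWeight {ι : Type*} (p : ℕ) (L : Finset ι) (ν : ι → ℕ) {m : ℕ} (a : Fin m → ℕ) : ℚ :=
  PowerSeries.coeff p ((∏ i ∈ L, (PowerSeries.X * zetaScaledOverAZ (ν i))) * creSymbol a)

/-- The action of `ℱ_p` on bosonic states. -/
theorem calF_bos_vac {ι : Type*} [DecidableEq ι] (S : Finset ι) (ν : ι → ℕ)
    (hν : ∀ i ∈ S, 0 < ν i) (p M : ℕ) (hM : ∑ i ∈ S, ν i ≤ M) :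
    calF p (bos (S.val.map ν) vac) =
      ∑ L ∈ S.powerset with L.Nonempty, ∑ m ∈ range M, ∑ a ∈ tuples (m + 1) (∑ i ∈ L, ν i),
        ((p ! : ℚ) * (1 / ((m + 1)! : ℚ)) * cutJoinWeight p L ν a) •
          bos ((S \ L).val.map ν + entries a) vac := by
  rw [calF_eq_exc, expCoeff_one, exc_smul, LinearMap.smul_apply, ← Module.End.mul_apply,
    exc_mul_bos S ν hν, LinearMap.sum_apply, sum_filter, smul_sum]
  refine sum_congr rfl fun L hL => ?_
  rw [mem_powerset] at hL
  rw [Module.End.mul_apply, zero_add]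
  split_ifs with hne
  · have hpos : 0 < ∑ i ∈ L, ν i := sum_pos (fun i hi => hν i (hL hi)) hne
    rw [exc_vac_eq _ hpos M ((sum_le_sum_of_subset hL).trans hM), map_sum, smul_sum]
    refine sum_congr rfl fun m _ => ?_
    rw [map_smul, map_sum, smul_sum, smul_sum]
    refine sum_congr rfl fun a _ => ?_
    rw [map_smul, smul_smul, smul_smul, bos_add, one_mul, cutJoinWeight, Module.End.mul_apply]
  · rw [not_nonempty_iff_eq_empty] at hne
    subst hne
    rw [sum_empty, exc_zero_vac, map_zero, smul_zero]

/-! ### Cut-and-join for the disconnected numbers -/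

theorem discHurwitz_sort (r q b : ℕ) (s : Multiset ℕ) :
    discHurwitz r q b s.sort = if q ∣ s.sum then
      1 / ((q : ℚ) ^ (s.sum / q) * ((s.sum / q)! : ℚ)) * (1 / ((r : ℚ) + 1) ^ b) *
        (alpha q ^ (s.sum / q)) ((calF (r + 1) ^ b) (bos s vac)) vacuum else 0 := by
  have h1 : s.sort.sum = s.sum := by rw [← Multiset.sum_coe, Multiset.sort_eq]
  have h2 : ((s.sort.map fun i : ℕ => (1 / (i : ℚ)) • alpha (-(i : ℤ))).prod) = bos s := by
    rw [← bos_coe, Multiset.sort_eq]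
  rw [discHurwitz, h1, h2]
  congr 1
  simp only [vev, Module.End.mul_apply, LinearMap.smul_apply, map_smul, Finsupp.smul_apply,
    smul_eq_mul]
  rw [← mul_assoc, mul_comm (1 / ((r : ℚ) + 1) ^ b)]
  rfl

theorem coeff_discSeries (r q b : ℕ) (l : List ℕ) :
    PowerSeries.coeff b (discSeries r q l) = discHurwitz r q b l / (b ! : ℚ) := by
  rw [discSeries, PowerSeries.coeff_mk]

theorem discSeries_nil (r q : ℕ) : discSeries r q (0 : Multiset ℕ).sort = 1 := by
  ext b
  rw [coeff_discSeries, discHurwitz_sort, bos_zero, PowerSeries.coeff_one]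
  rcases b with _ | b
  · simp [vac]
  · rw [pow_succ (calF (r + 1)), Module.End.mul_apply, Module.End.one_apply, calF_eq_exc,
      exc_zero_vac]
    simp

open PowerSeries in
-- The derivative releases one factor `ℱ_{r+1}`, which acts on the bosonic state. Cutting and
-- joining preserves the sum of the parts, so the `α_q` factor and its normalization are common to
-- all terms; `(r+1)!` over `r + 1` leaves `r!`.
theorem derivative_discSeries {ι : Type*} [DecidableEq ι] (r q : ℕ) (S : Finset ι) (ν : ι → ℕ)
    (hν : ∀ i ∈ S, 0 < ν i) (M : ℕ) (hM : ∑ i ∈ S, ν i ≤ M) :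
    d⁄dX ℚ (discSeries r q (S.val.map ν).sort) =
      ∑ L ∈ S.powerset with L.Nonempty, ∑ m ∈ range M, ∑ a ∈ tuples (m + 1) (∑ i ∈ L, ν i),
        ((r ! : ℚ) * (1 / ((m + 1)! : ℚ)) * cutJoinWeight (r + 1) L ν a) •
          discSeries r q ((S \ L).val.map ν + entries a).sort := by
  ext b
  rw [coeff_derivative, coeff_discSeries, discHurwitz_sort, pow_succ (calF (r + 1)),
    Module.End.mul_apply, calF_bos_vac S ν hν (r + 1) M hM]
  simp only [map_sum, Finsupp.finsetSum_apply, coeff_discSeries, map_smul,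
    Finsupp.smul_apply, smul_eq_mul]
  have hsum : ∀ L ∈ S.powerset.filter (·.Nonempty), ∀ m, ∀ a ∈ tuples (m + 1) (∑ i ∈ L, ν i),
      ((S \ L).val.map ν + entries a).sum = (S.val.map ν).sum := by
    intro L hL m a ha
    rw [mem_filter, mem_powerset] at hL
    rw [mem_tuples] at ha
    rw [Multiset.sum_add]
    change ∑ i ∈ S \ L, ν i + ∑ j, a j = ∑ i ∈ S, ν i
    rw [ha, sum_sdiff hL.1]
  have e : ∀ L ∈ S.powerset.filter (·.Nonempty), ∀ m ∈ range M,
      ∀ a ∈ tuples (m + 1) (∑ i ∈ L, ν i),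
      (r ! : ℚ) * (1 / ((m + 1)! : ℚ)) * cutJoinWeight (r + 1) L ν a *
        (discHurwitz r q b ((S \ L).val.map ν + entries a).sort / (b ! : ℚ)) =
      (if q ∣ (S.val.map ν).sum then 1 / ((q : ℚ) ^ ((S.val.map ν).sum / q) *
        (((S.val.map ν).sum / q)! : ℚ)) * (1 / ((r : ℚ) + 1) ^ (b + 1)) / (b ! : ℚ) else 0) *
        (((r + 1)! : ℚ) * (1 / ((m + 1)! : ℚ)) * cutJoinWeight (r + 1) L ν a *
        (alpha q ^ ((S.val.map ν).sum / q)) ((calF (r + 1) ^ b)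
          (bos ((S \ L).val.map ν + entries a) vac)) vacuum) := by
    intro L hL m _ a ha
    rw [discHurwitz_sort, hsum L hL m a ha, Nat.factorial_succ r]
    split_ifs
    · push_cast; field_simp; ring
    · simp
  rw [sum_congr rfl fun L hL => sum_congr rfl fun m hm => sum_congr rfl fun a ha =>
    e L hL m hm a ha]
  simp only [← mul_sum]
  split_ifs
  · rw [Nat.factorial_succ b]; push_cast; field_simp
  · simp

/-! ### Initial condition: no completed cycles -/

theorem alpha_mul_cre {q i : ℕ} (hq : 0 < q) (hi : 0 < i) :
    alpha q * cre i = cre i * alpha q + (if q = i then 1 else 0 : ℚ) • 1 := by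
  rw [cre, mul_smul_comm, alpha_comm (by omega) (by omega), smul_add, smul_mul_assoc, smul_smul]
  congr 2
  have hi' : (i : ℚ) ≠ 0 := by positivity
  by_cases h : q = i
  · subst h; simp [hi']
  · rw [if_neg h, if_neg (by exact_mod_cast h), mul_zero]

theorem alpha_mul_bos {q : ℕ} (hq : 0 < q) (s : Multiset ℕ) (hs : ∀ i ∈ s, 0 < i) :
    alpha q * bos s = bos s * alpha q + (s.count q : ℚ) • bos (s.erase q) := by
  induction s using Multiset.induction_on with
  | empty => simp [bos_zero]
  | cons i s ih =>
    have hi : 0 < i := hs i (Multiset.mem_cons_self i s)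
    rw [bos_cons, ← mul_assoc, alpha_mul_cre hq hi, add_mul, mul_assoc,
      ih fun j hj => hs j (Multiset.mem_cons_of_mem hj), mul_add, mul_smul_comm, smul_mul_assoc,
      one_mul, mul_assoc, add_assoc]
    congr 1
    by_cases h : q = i
    · subst h
      rw [Multiset.erase_cons_head, Multiset.count_cons_self, if_pos rfl]
      by_cases hq' : q ∈ s
      · rw [← bos_cons, Multiset.cons_erase hq', ← add_smul]; push_cast; rfl
      · simp [Multiset.count_eq_zero_of_notMem hq']
    · rw [if_neg h, zero_smul, add_zero, Multiset.erase_cons_tail _ (Ne.symm h),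
        Multiset.count_cons_of_ne h, bos_cons]

/-- `α_q` kills the vacuum, so each of the `k` factors must contract a part equal to `q`. If all
parts are `q` there are exactly `k` of them, contracted in `k!` ways. -/
theorem alpha_pow_bos_vac {q : ℕ} (hq : 0 < q) (k : ℕ) (s : Multiset ℕ) (hs : ∀ i ∈ s, 0 < i)
    (hsum : s.sum = q * k) :
    (alpha q ^ k) (bos s vac) vacuum = if ∀ i ∈ s, i = q then (k ! : ℚ) else 0 := by
  induction k generalizing s with
  | zero =>
    have : s = 0 := by
      rw [Multiset.eq_zero_iff_forall_notMem]
      intro i hi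
      have h1 := Multiset.single_le_sum (fun _ _ => Nat.zero_le _) i hi
      have h2 := hs i hi
      omega
    subst this
    simp [bos_zero, vac]
  | succ k ih =>
    rw [pow_succ, Module.End.mul_apply, ← Module.End.mul_apply (alpha q), alpha_mul_bos hq s hs,
      LinearMap.add_apply, Module.End.mul_apply, (isBil_alpha (m := q) (by omega)).vac_eq_zero
      (by omega), map_zero, zero_add, LinearMap.smul_apply, map_smul, Finsupp.smul_apply,
      smul_eq_mul]
    by_cases hqs : q ∈ s
    · obtain ⟨t, rfl⟩ := Multiset.exists_cons_of_mem hqs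
      rw [Multiset.sum_cons] at hsum
      rw [Multiset.erase_cons_head, ih t (fun i hi => hs i (Multiset.mem_cons_of_mem hi))
        (by rw [mul_add, mul_one] at hsum; omega), Multiset.count_cons_self]
      simp only [Multiset.mem_cons, forall_eq_or_imp, true_and]
      split_ifs with h
      · have ht := Multiset.eq_replicate_card.2 h
        have hc : t.count q = t.card := Multiset.count_eq_card.2 fun x hx => (h x hx).symm
        rw [ht, Multiset.sum_replicate, smul_eq_mul] at hsum
        have : t.card = k := by
          have : q * t.card = q * k := by rw [mul_comm q t.card]; rw [mul_add, mul_one] at hsum; omega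
          exact Nat.eq_of_mul_eq_mul_left hq this
        rw [hc, this, Nat.factorial_succ]; push_cast; ring
      · ring
    · rw [Multiset.count_eq_zero_of_notMem hqs, Nat.cast_zero, zero_mul, if_neg]
      intro h
      have : s = 0 := by
        rw [Multiset.eq_zero_iff_forall_notMem]
        intro i hi
        exact hqs (h i hi ▸ hi)
      subst this
      rw [Multiset.sum_zero] at hsum
      have : 0 < q * (k + 1) := by positivity
      omega

/-- The `k!` contractions cancel the normalization, which leaves a product over the parts.
Multiplicativity forces the logarithm at `β = 0` to live on singletons. -/
theorem coeff_zero_discSeries {ι : Type*} (r : ℕ) {q : ℕ} (hq : 0 < q) (S : Finset ι) (ν : ι → ℕ)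
    (hν : ∀ i ∈ S, 0 < ν i) :
    PowerSeries.coeff 0 (discSeries r q (S.val.map ν).sort) =
      ∏ i ∈ S, if ν i = q then 1 / (q : ℚ) else 0 := by
  have hpos : ∀ i ∈ S.val.map ν, 0 < i := by
    intro i hi
    obtain ⟨j, hj, rfl⟩ := Multiset.mem_map.1 hi
    exact hν j hj
  have hall : (∀ i ∈ S.val.map ν, i = q) ↔ ∀ i ∈ S, ν i = q := by
    simp only [Multiset.mem_map, forall_exists_index, and_imp, forall_apply_eq_imp_iff₂, mem_val]
  rw [coeff_discSeries, discHurwitz_sort, pow_zero, pow_zero (calF (r + 1)), Module.End.one_apply]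
  by_cases h : ∀ i ∈ S, ν i = q
  · have hs : (S.val.map ν).sum = q * #S := by
      change ∑ i ∈ S, ν i = _
      rw [sum_congr rfl h, sum_const, smul_eq_mul, mul_comm]
    rw [hs, if_pos (Dvd.intro _ rfl), Nat.mul_div_cancel_left _ hq, alpha_pow_bos_vac hq _ _ hpos hs,
      if_pos (hall.2 h), prod_congr rfl fun i hi => if_pos (h i hi), prod_const]
    have : ((#S)! : ℚ) ≠ 0 := by positivity
    simp
    field_simp
  · have hz : (∏ i ∈ S, if ν i = q then 1 / (q : ℚ) else 0) = 0 := by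
      push Not at h
      obtain ⟨i, hi, hne⟩ := h
      exact prod_eq_zero hi (if_neg hne)
    rw [hz]
    split_ifs with hd
    · rw [alpha_pow_bos_vac hq _ _ hpos (Nat.mul_div_cancel' hd).symm, if_neg (fun h' => h (hall.1 h'))]
      simp
    · simp

/-! ### Set functions under subset convolution -/

/-- Functions on the finite subsets of `σ`, multiplied by subset convolution. -/
def SetFun (σ R : Type*) : Type _ := Finset σ → R

namespace SetFun

variable {σ τ R : Type*} [DecidableEq σ] [DecidableEq τ] [CommRing R] [Algebra ℚ R]

instance : AddCommGroup (SetFun σ R) := inferInstanceAs (AddCommGroup (Finset σ → R))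

instance : Module ℚ (SetFun σ R) := inferInstanceAs (Module ℚ (Finset σ → R))

/-- A set function from its values. -/
def mk (f : Finset σ → R) : SetFun σ R := f

theorem mk_apply (f : Finset σ → R) (S : Finset σ) : mk f S = f S := rfl

instance : Mul (SetFun σ R) := ⟨fun f g => mk fun S => ∑ T ∈ S.powerset, f T * g (S \ T)⟩

instance : One (SetFun σ R) := ⟨mk fun S => if S = ∅ then 1 else 0⟩

theorem mul_apply (f g : SetFun σ R) (S : Finset σ) :
    (f * g) S = ∑ T ∈ S.powerset, f T * g (S \ T) := rfl

theorem one_apply (S : Finset σ) : (1 : SetFun σ R) S = if S = ∅ then 1 else 0 := rfl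

theorem add_apply (f g : SetFun σ R) (S : Finset σ) : (f + g) S = f S + g S := rfl

theorem sub_apply (f g : SetFun σ R) (S : Finset σ) : (f - g) S = f S - g S := rfl

theorem zero_apply (S : Finset σ) : (0 : SetFun σ R) S = 0 := rfl

theorem smul_apply (c : ℚ) (f : SetFun σ R) (S : Finset σ) : (c • f) S = c • f S := rfl

@[ext] theorem ext {f g : SetFun σ R} (h : ∀ S, f S = g S) : f = g := funext h

/-- Evaluation at a set. -/
def evalHom (S : Finset σ) : SetFun σ R →ₗ[ℚ] R where
  toFun f := f S
  map_add' _ _ := rfl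
  map_smul' _ _ := rfl

theorem sum_apply {ι : Type*} (s : Finset ι) (f : ι → SetFun σ R) (S : Finset σ) :
    (∑ i ∈ s, f i) S = ∑ i ∈ s, f i S :=
  map_sum (evalHom (R := R) S) f s

theorem convolution_comm (f g : SetFun σ R) : f * g = g * f := by
  ext S
  rw [mul_apply, mul_apply]
  refine sum_nbij' (fun T => S \ T) (fun T => S \ T) ?_ ?_ ?_ ?_ ?_
  · intro T _; exact mem_powerset.2 sdiff_subset
  · intro T _; exact mem_powerset.2 sdiff_subset
  · intro T hT; exact Finset.sdiff_sdiff_eq_self (mem_powerset.1 hT)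
  · intro T hT; exact Finset.sdiff_sdiff_eq_self (mem_powerset.1 hT)
  · intro T hT; rw [Finset.sdiff_sdiff_eq_self (mem_powerset.1 hT), mul_comm]

theorem one_convolution (f : SetFun σ R) : 1 * f = f := by
  ext S
  rw [mul_apply, sum_eq_single ∅]
  · simp [one_apply]
  · intro T _ hT; simp [one_apply, hT]
  · simp

theorem convolution_assoc (f g h : SetFun σ R) : f * g * h = f * (g * h) := by
  ext S
  simp only [mul_apply, sum_mul, mul_sum]
  rw [sum_sigma', sum_sigma']
  refine sum_bij' (fun x _ => ⟨x.2, x.1 \ x.2⟩) (fun x _ => ⟨x.1 ∪ x.2, x.1⟩) ?_ ?_ ?_ ?_ ?_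
  · rintro ⟨T, U⟩ hx
    simp only [mem_sigma, mem_powerset] at hx ⊢
    exact ⟨hx.2.trans hx.1, sdiff_subset_sdiff hx.1 (Subset.refl _)⟩
  · rintro ⟨U, V⟩ hx
    simp only [mem_sigma, mem_powerset] at hx ⊢
    exact ⟨union_subset hx.1 (hx.2.trans sdiff_subset), subset_union_left⟩
  · rintro ⟨T, U⟩ hx
    simp only [mem_sigma, mem_powerset] at hx
    simp only [union_sdiff_of_subset hx.2]
  · rintro ⟨U, V⟩ hx
    simp only [mem_sigma, mem_powerset] at hx
    have : (U ∪ V) \ U = V := by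
      rw [union_sdiff_left, sdiff_eq_self_of_disjoint]
      exact (subset_sdiff.1 hx.2).2
    simp only [this]
  · rintro ⟨T, U⟩ hx
    simp only [mem_sigma, mem_powerset] at hx
    simp only
    rw [mul_assoc, sdiff_sdiff_left, sup_eq_union, union_sdiff_of_subset hx.2]

theorem convolution_add (f g h : SetFun σ R) : f * (g + h) = f * g + f * h := by
  ext S
  simp only [mul_apply, add_apply, mul_add, sum_add_distrib]

instance : CommRing (SetFun σ R) where
  __ := (inferInstance : AddCommGroup (SetFun σ R))
  mul_assoc := convolution_assoc
  one_mul := one_convolution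
  mul_one f := by rw [convolution_comm, one_convolution]
  left_distrib := convolution_add
  right_distrib f g h := by
    rw [convolution_comm, convolution_add, convolution_comm h f, convolution_comm h g]
  zero_mul f := by ext S; simp [mul_apply, zero_apply]
  mul_zero f := by ext S; simp [mul_apply, zero_apply]
  mul_comm := convolution_comm

theorem smul_convolution (c : ℚ) (f g : SetFun σ R) : c • f * g = c • (f * g) := by
  ext S; simp [mul_apply, smul_apply, smul_sum]

instance : Algebra ℚ (SetFun σ R) :=
  Algebra.ofModule smul_convolution fun c f g => by
    rw [mul_comm, smul_convolution, mul_comm]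

theorem mul_empty (f g : SetFun σ R) : (f * g) ∅ = f ∅ * g ∅ := by simp [mul_apply]

/-- A set with fewer than `l` elements has no `l` disjoint nonempty subsets. Over a finite index set
this nilpotency makes truncated series exact. -/
theorem pow_apply_eq_zero {f : SetFun σ R} (hf : f ∅ = 0) (l : ℕ) (S : Finset σ) (h : #S < l) :
    (f ^ l) S = 0 := by
  induction l generalizing S with
  | zero => omega
  | succ l ih =>
    rw [pow_succ', mul_apply]
    refine sum_eq_zero fun T hT => ?_
    rw [mem_powerset] at hT
    rcases T.eq_empty_or_nonempty with rfl | hne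
    · rw [hf, zero_mul]
    · rw [ih, mul_zero]
      have h1 := card_sdiff_add_card_eq_card hT
      have h2 := hne.card_pos
      omega

theorem pow_eq_zero_of_empty [Fintype σ] {f : SetFun σ R} (hf : f ∅ = 0) :
    f ^ (Fintype.card σ + 1) = 0 := by
  ext S
  exact pow_apply_eq_zero hf _ S (Nat.lt_succ_of_le (card_le_univ S))

/-- The derivation multiplying the value at `S` by the cardinality of `S`. -/
def cardDer : Derivation ℚ (SetFun σ R) (SetFun σ R) :=
  Derivation.mk'
    { toFun := fun f => mk fun S => (#S : ℚ) • f S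
      map_add' := fun f g => by ext S; simp [add_apply, mk_apply]
      map_smul' := fun c f => by
        ext S
        simp only [smul_apply, RingHom.id_apply, mk_apply]
        rw [smul_comm] }
    (fun f g => by
      ext S
      simp only [LinearMap.coe_mk, AddHom.coe_mk, smul_eq_mul, mk_apply]
      rw [add_apply, mul_comm g, mul_apply, mul_apply, mul_apply, smul_sum, ← sum_add_distrib]
      refine sum_congr rfl fun T hT => ?_
      rw [← card_sdiff_add_card_eq_card (mem_powerset.1 hT)]
      push_cast
      rw [mk_apply, mk_apply, add_smul, mul_smul_comm, smul_mul_assoc])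

theorem cardDer_apply (f : SetFun σ R) (S : Finset σ) : cardDer f S = (#S : ℚ) • f S := rfl

/-- A derivation of the coefficients. -/
def mapDer (d : Derivation ℚ R R) : Derivation ℚ (SetFun σ R) (SetFun σ R) :=
  Derivation.mk'
    { toFun := fun f => mk fun S => d (f S)
      map_add' := fun f g => by ext S; simp [add_apply, mk_apply]
      map_smul' := fun c f => by ext S; simp [smul_apply, mk_apply] }
    (fun f g => by
      ext S
      simp only [LinearMap.coe_mk, AddHom.coe_mk, smul_eq_mul, mk_apply]
      rw [add_apply, mul_comm g, mul_apply, mul_apply, mul_apply, map_sum, ← sum_add_distrib]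
      refine sum_congr rfl fun T hT => ?_
      rw [mk_apply, mk_apply, Derivation.leibniz, smul_eq_mul, smul_eq_mul, mul_comm (g _)])

theorem mapDer_apply (d : Derivation ℚ R R) (f : SetFun σ R) (S : Finset σ) :
    mapDer d f S = d (f S) := rfl

end SetFun

/-! ### Truncated exponentials and logarithms -/

/-- The truncated logarithm of `1 + X`. -/
def logTrunc {A : Type*} [CommRing A] [Algebra ℚ A] (k : ℕ) (X : A) : A :=
  ∑ l ∈ range k, ((-1 : ℚ) ^ l / (l + 1)) • X ^ (l + 1)

section LogExp

variable {A : Type*} [CommRing A] [Algebra ℚ A]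

theorem one_add_mul_geom {k : ℕ} {X : A} (h : X ^ k = 0) :
    (1 + X) * ∑ l ∈ range k, (-X) ^ l = 1 := by
  have := mul_neg_geom_sum (-X) k
  rw [sub_neg_eq_add, neg_pow, h, mul_zero, sub_zero] at this
  exact this

/-- The truncation is exact because `X ^ k = 0`; the geometric series is the inverse of `1 + X`. -/
theorem derivation_logTrunc (D : Derivation ℚ A A) {k : ℕ} {X : A} (h : X ^ k = 0) :
    (1 + X) * D (logTrunc k X) = D X := by
  have : D (logTrunc k X) = (∑ l ∈ range k, (-X) ^ l) * D X := by
    rw [logTrunc, map_sum, sum_mul]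
    refine sum_congr rfl fun l _ => ?_
    rw [Derivation.map_smul, Derivation.leibniz_pow, Nat.add_sub_cancel, ← Nat.cast_smul_eq_nsmul ℚ,
      smul_smul, show ((-1 : ℚ) ^ l / (l + 1)) * ((l + 1 : ℕ) : ℚ) = (-1) ^ l by
        push_cast; field_simp, smul_eq_mul, neg_pow X, ← smul_mul_assoc, Algebra.smul_def]
    simp
  rw [this, ← mul_assoc, one_add_mul_geom h, one_mul]

theorem derivation_exp (D : Derivation ℚ A A) {X : A} (h : IsNilpotent X) :
    D (IsNilpotent.exp X) = IsNilpotent.exp X * D X := by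
  obtain ⟨k, hk⟩ := h
  have hk' : X ^ (k + 1) = 0 := by rw [pow_succ, hk, zero_mul]
  conv_lhs => rw [IsNilpotent.exp_eq_sum hk']
  rw [IsNilpotent.exp_eq_sum hk, map_sum, sum_range_succ', sum_mul]
  simp only [pow_zero, Derivation.map_smul, Derivation.map_one_eq_zero, smul_zero, add_zero]
  refine sum_congr rfl fun l _ => ?_
  rw [Derivation.leibniz_pow, Nat.add_sub_cancel, ← Nat.cast_smul_eq_nsmul ℚ, smul_smul,
    smul_eq_mul, smul_mul_assoc]
  congr 1
  rw [Nat.factorial_succ]; push_cast; field_simp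

theorem map_logTrunc {B : Type*} [CommRing B] [Algebra ℚ B] (F : A →+* B) (k : ℕ) (X : A) :
    F (logTrunc k X) = logTrunc k (F X) := by
  simp [logTrunc, map_sum, map_rat_smul]

end LogExp

/-! ### Exponential, logarithm and change of index set for set functions -/

namespace SetFun

variable {σ τ R : Type*} [DecidableEq σ] [DecidableEq τ] [CommRing R] [Algebra ℚ R]

/-- Cardinalities of nonempty sets are invertible in `ℚ`: a set function is determined by its
derivative under `cardDer` and its value at `∅`. -/
theorem eq_of_cardDer_eq {f g : SetFun σ R} (h : cardDer f = cardDer g) (h0 : f ∅ = g ∅) :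
    f = g := by
  ext S
  rcases S.eq_empty_or_nonempty with rfl | hS
  · exact h0
  · have := congrArg (fun f => ((#S : ℚ)⁻¹) • f S) h
    simp only [cardDer_apply, smul_smul] at this
    rwa [inv_mul_cancel₀ (by exact_mod_cast hS.card_pos.ne'), one_smul, one_smul] at this

theorem exp_empty [Fintype σ] {f : SetFun σ R} (hf : f ∅ = 0) : IsNilpotent.exp f ∅ = 1 := by
  rw [IsNilpotent.exp_eq_sum (pow_eq_zero_of_empty hf), sum_apply, sum_range_succ']
  rw [sum_eq_zero]
  · simp [one_apply, smul_apply]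
  · intro l _
    rw [smul_apply, pow_succ, mul_empty, hf, mul_zero, smul_zero]

theorem isNilpotent_of_empty [Fintype σ] {f : SetFun σ R} (hf : f ∅ = 0) : IsNilpotent f :=
  ⟨_, pow_eq_zero_of_empty hf⟩

theorem logTrunc_empty {f : SetFun σ R} (hf : f ∅ = 0) (k : ℕ) : logTrunc k f ∅ = 0 := by
  rw [logTrunc, sum_apply]
  exact sum_eq_zero fun l _ => by rw [smul_apply, pow_succ, mul_empty, hf, mul_zero, smul_zero]

/-- Both sides solve `cardDer f = f * cardDer (logTrunc k X)` with value `1` at `∅`. Their quotient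
`V * G` has derivative zero, hence is `1`. -/
theorem exp_logTrunc [Fintype σ] {X : SetFun σ R} (hX : X ∅ = 0) {k : ℕ} (hk : X ^ k = 0) :
    IsNilpotent.exp (logTrunc k X) = 1 + X := by
  set V := IsNilpotent.exp (logTrunc k X) with hV
  set G := ∑ l ∈ range k, (-X) ^ l with hG
  have hWG : (1 + X) * G = 1 := one_add_mul_geom hk
  have hL0 := logTrunc_empty hX k
  have hlog := derivation_logTrunc cardDer hk
  have hexp : cardDer V = V * cardDer (logTrunc k X) :=
    derivation_exp cardDer (isNilpotent_of_empty hL0)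
  have hG' : cardDer ((1 + X) * G) = 0 := by rw [hWG]; simp
  have hV0 : V ∅ = 1 := exp_empty hL0
  rw [Derivation.leibniz, smul_eq_mul, smul_eq_mul, map_add, Derivation.map_one_eq_zero,
    zero_add] at hG'
  have key : V * G = 1 := by
    refine eq_of_cardDer_eq ?_ ?_
    · rw [Derivation.leibniz, smul_eq_mul, smul_eq_mul, Derivation.map_one_eq_zero, hexp]
      linear_combination (V * G) * hG' + V * G * G * hlog -
        (V * cardDer G + V * G * cardDer (logTrunc k X)) * hWG
    · have h0 : G ∅ = 1 := by
        have := congrArg (fun f => f ∅) hWG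
        simpa [mul_empty, add_apply, one_apply, hX] using this
      rw [mul_empty, hV0, h0, one_apply, if_pos rfl, mul_one]
  calc V = V * G * (1 + X) := by rw [mul_assoc, mul_comm G, hWG, mul_one]
    _ = 1 + X := by rw [key, one_mul]

/-- Restriction along an injection. -/
def restrict (e : σ ↪ τ) : SetFun τ R →+* SetFun σ R where
  toFun f := mk fun S => f (S.map e)
  map_zero' := rfl
  map_add' _ _ := rfl
  map_one' := by ext S; simp [one_apply, mk_apply]
  map_mul' f g := by
    ext S
    simp only [mul_apply, mk_apply]
    symm
    refine sum_of_injOn (fun T => T.map e) (fun _ _ _ _ h => map_injective e h) ?_ ?_ ?_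
    · intro T hT
      rw [mem_coe, mem_powerset] at hT ⊢
      exact map_subset_map.2 hT
    · intro T hT hT'
      rw [mem_powerset, subset_map_iff] at hT
      obtain ⟨U, hU, rfl⟩ := hT
      exact absurd ⟨U, by simpa using hU, rfl⟩ hT'
    · intro T _
      rw [Finset.map_sdiff]

theorem restrict_apply (e : σ ↪ τ) (f : SetFun τ R) (S : Finset σ) :
    restrict e f S = f (S.map e) := rfl

/-- Extension by zero to the sets which meet the second summand. -/
def extend (τ : Type*) [DecidableEq τ] : SetFun σ R →+* SetFun (σ ⊕ τ) R where
  toFun f := mk fun S => if S.toRight = ∅ then f S.toLeft else 0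
  map_zero' := by ext S; simp [zero_apply, mk_apply]
  map_add' f g := by ext S; simp only [add_apply, mk_apply]; split_ifs <;> simp
  map_one' := by
    ext S
    simp only [one_apply, mk_apply]
    by_cases h : S.toRight = ∅
    · rw [if_pos h]
      have : S = ∅ ↔ S.toLeft = ∅ := by
        conv_lhs => rw [← toLeft_disjSum_toRight (u := S), h, disjSum_eq_empty]
        simp
      simp only [this]
    · rw [if_neg h, if_neg]
      rintro rfl; exact h (by ext; simp)
  map_mul' f g := by
    ext S
    simp only [mul_apply, mk_apply]
    by_cases h : S.toRight = ∅
    · rw [if_pos h]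
      refine sum_of_injOn (fun T => T.disjSum ∅) ?_ ?_ ?_ ?_
      · intro T _ U _ hTU
        simpa only [toLeft_disjSum] using congrArg toLeft hTU
      · intro T hT
        rw [mem_coe, mem_powerset] at hT ⊢
        rw [← toLeft_disjSum_toRight (u := S), h]
        exact disjSum_mono hT (Subset.refl _)
      · intro T hT hT'
        rw [mem_powerset] at hT
        refine absurd ⟨T.toLeft, ?_, ?_⟩ hT'
        · rw [mem_coe, mem_powerset]; exact toLeft_subset_toLeft hT
        · have : T.toRight = ∅ := by
            rw [← subset_empty, ← h]; exact toRight_subset_toRight hT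
          simp only
          rw [← this, toLeft_disjSum_toRight]
      · intro T hT
        simp only [toRight_sdiff, toLeft_sdiff, h, toLeft_disjSum, toRight_disjSum, sdiff_self,
          if_true, bot_eq_empty]
    · rw [if_neg h]
      symm
      refine sum_eq_zero fun T hT => ?_
      by_cases h1 : T.toRight = ∅
      · rw [if_neg (c := (S \ T).toRight = ∅), mul_zero]
        rwa [toRight_sdiff, h1, sdiff_empty]
      · rw [if_neg h1, zero_mul]

theorem extend_apply (f : SetFun σ R) (S : Finset (σ ⊕ τ)) :
    extend τ f S = if S.toRight = ∅ then f S.toLeft else 0 := rfl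

/-- The values at the sets containing the second summand. -/
def top [Fintype τ] (f : SetFun (σ ⊕ τ) R) : SetFun σ R := mk fun S => f (S.disjSum univ)

/-- The extended factor vanishes on sets meeting the second summand, so in the convolution the other
factor takes all of that summand and only `S` is split. -/
theorem top_mul_extend [Fintype τ] (f : SetFun (σ ⊕ τ) R) (g : SetFun σ R) :
    top (f * extend τ g) = top f * g := by
  ext S
  rw [mul_apply, top, mk_apply, mul_apply]
  symm
  refine sum_of_injOn (fun T => T.disjSum univ) ?_ ?_ ?_ ?_
  · intro T _ U _ hTU
    simpa only [toLeft_disjSum] using congrArg toLeft hTU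
  · intro T hT
    rw [mem_coe, mem_powerset] at hT ⊢
    exact disjSum_mono hT (Subset.refl _)
  · intro T hT hT'
    rw [extend_apply, if_neg, mul_zero]
    intro h
    rw [mem_powerset] at hT
    refine hT' ⟨T.toLeft, ?_, ?_⟩
    · rw [mem_coe, mem_powerset]; simpa using toLeft_subset_toLeft hT
    · have : T.toRight = univ := by
        rw [toRight_sdiff, toRight_disjSum, sdiff_eq_empty_iff_subset] at h
        exact univ_subset_iff.1 h
      simp only
      rw [← this, toLeft_disjSum_toRight]
  · intro T hT
    simp [extend_apply, toRight_sdiff, toLeft_sdiff, top, mk_apply]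

end SetFun

/-! ### Ordered splittings and set partitions -/

theorem isSplitting_iff {ι α : Type*} [Fintype ι] [DecidableEq α] {A : ι → Finset α}
    {S : Finset α} : IsSplitting A S ↔ (∀ i, A i ⊆ S) ∧ ∀ x ∈ S, ∃! i, x ∈ A i := by
  constructor
  · rintro ⟨h1, rfl⟩
    refine ⟨fun i => subset_biUnion_of_mem A (mem_univ i), fun x hx => ?_⟩
    obtain ⟨i, -, hi⟩ := mem_biUnion.1 hx
    refine ⟨i, hi, fun j hj => ?_⟩
    by_contra hne
    exact disjoint_left.1 (h1 j i hne) hj hi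
  · rintro ⟨h1, h2⟩
    refine ⟨fun i j hij => disjoint_left.2 fun x hi hj => ?_, ?_⟩
    · exact hij ((h2 x (h1 i hi)).unique hi hj)
    · ext x
      rw [mem_biUnion]
      constructor
      · rintro ⟨i, -, hi⟩; exact h1 i hi
      · intro hx; obtain ⟨i, hi, -⟩ := h2 x hx; exact ⟨i, mem_univ i, hi⟩

theorem isSplitting_cons {α : Type*} [DecidableEq α] {l : ℕ} {T : Finset α}
    {A : Fin l → Finset α} {S : Finset α} :
    IsSplitting (Fin.cons T A : Fin (l + 1) → Finset α) S ↔ T ⊆ S ∧ IsSplitting A (S \ T) := by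
  simp only [IsSplitting]
  constructor
  · rintro ⟨h1, rfl⟩
    have hu : univ.biUnion (Fin.cons T A : Fin (l + 1) → Finset α) = T ∪ univ.biUnion A := by
      ext x; simp [Fin.exists_fin_succ]
    rw [hu]
    refine ⟨subset_union_left, fun i j hij => ?_, ?_⟩
    · simpa using h1 i.succ j.succ (fun h => hij (Fin.succ_injective _ h))
    · rw [union_sdiff_left, sdiff_eq_self_of_disjoint]
      rw [disjoint_biUnion_left]
      intro i _
      simpa using h1 i.succ 0 (Fin.succ_ne_zero i)
  · rintro ⟨hT, h1, h2⟩
    have hd : ∀ i, Disjoint (A i) T := by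
      intro i
      have : A i ⊆ S \ T := by rw [← h2]; exact subset_biUnion_of_mem A (mem_univ i)
      exact (subset_sdiff.1 this).2
    constructor
    · intro i j
      refine Fin.cases ?_ (fun i => ?_) i <;> refine Fin.cases ?_ (fun j => ?_) j
      · intro h; exact absurd rfl h
      · intro _; simpa using (hd j).symm
      · intro _; simpa using hd i
      · intro h; simpa using h1 i j (fun h' => h (by rw [h']))
    · have hu : univ.biUnion (Fin.cons T A : Fin (l + 1) → Finset α) = T ∪ univ.biUnion A := by
        ext x; simp [Fin.exists_fin_succ]
      rw [hu, h2, union_sdiff_of_subset hT]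

theorem SetFun.pow_apply {σ R : Type*} [DecidableEq σ] [Fintype σ] [CommRing R] [Algebra ℚ R]
    (f : SetFun σ R) (l : ℕ) (B : Finset σ) :
    (f ^ l) B = ∑ A : Fin l → Finset σ with IsSplitting A B, ∏ j, f (A j) := by
  induction l generalizing B with
  | zero =>
    rw [pow_zero, one_apply]
    by_cases h : B = ∅
    · subst h
      rw [if_pos rfl, filter_true_of_mem]
      · simp
      · intro A _; exact ⟨fun i => i.elim0, by simp⟩
    · rw [if_neg h, filter_false_of_mem]
      · simp
      · rintro A _ ⟨-, h2⟩; simp at h2; exact h h2.symm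
  | succ l ih =>
    rw [pow_succ', SetFun.mul_apply]
    simp only [ih, mul_sum]
    rw [sum_sigma']
    refine sum_bij' (fun x _ => Fin.cons x.1 x.2) (fun A _ => ⟨A 0, Fin.tail A⟩) ?_ ?_ ?_ ?_ ?_
    · rintro ⟨T, A⟩ hx
      simp only [mem_sigma, mem_powerset, mem_filter, mem_univ, true_and] at hx ⊢
      exact isSplitting_cons.2 hx
    · intro A hA
      simp only [mem_sigma, mem_powerset, mem_filter, mem_univ, true_and] at hA ⊢
      rw [← isSplitting_cons, Fin.cons_self_tail]
      exact hA
    · rintro ⟨T, A⟩ _; simp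
    · intro A _; simp
    · rintro ⟨T, A⟩ _; simp [Fin.prod_univ_succ]

/-- An ordered splitting into nonempty blocks is a set partition with a labelling of its `l` blocks,
and there are `l!` labellings. -/
theorem sum_splittings_eq {σ R : Type*} [DecidableEq σ] [Fintype σ] [CommRing R] [Algebra ℚ R]
    (F : Finset σ → R) (l : ℕ) (B : Finset σ) :
    ∑ A : Fin l → Finset σ with IsSplitting A B ∧ ∀ j, (A j).Nonempty, ∏ j, F (A j) =
      (l ! : ℚ) • ∑ P : Finpartition B with #P.parts = l, ∏ C ∈ P.parts, F C := by
  have h1 : ∀ P ∈ (univ : Finset (Finpartition B)).filter (fun P => #P.parts = l),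
      (l ! : ℚ) • ∏ C ∈ P.parts, F C = ∑ e : Fin l ≃ P.parts, ∏ j, F (e j).1 := by
    intro P hP
    rw [mem_filter] at hP
    have e0 : Fin l ≃ P.parts := (equivFinOfCardEq hP.2).symm
    have : ∀ e : Fin l ≃ P.parts, ∏ j, F (e j).1 = ∏ C ∈ P.parts, F C := by
      intro e
      rw [Equiv.prod_comp e fun C => F C.1, prod_coe_sort]
    rw [sum_congr rfl fun e _ => this e, sum_const, card_univ, Fintype.card_equiv e0,
      Fintype.card_fin, Nat.cast_smul_eq_nsmul]
  rw [smul_sum, sum_congr rfl h1, sum_sigma']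
  symm
  refine sum_bij (fun x _ => fun j => (x.2 j).1) ?_ ?_ ?_ ?_
  · rintro ⟨P, e⟩ _
    simp only [mem_filter, mem_univ, true_and]
    refine ⟨⟨fun i j hij => ?_, ?_⟩, fun j => P.nonempty_of_mem_parts (e j).2⟩
    · exact P.disjoint (e i).2 (e j).2 fun h => hij (e.injective (Subtype.ext h))
    · conv_rhs => rw [← P.biUnion_parts]
      ext x
      simp only [mem_biUnion, mem_univ, true_and, id]
      constructor
      · rintro ⟨j, hj⟩; exact ⟨_, (e j).2, hj⟩
      · rintro ⟨C, hC, hx⟩; exact ⟨e.symm ⟨C, hC⟩, by simpa using hx⟩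
  · rintro ⟨P, e⟩ _ ⟨P', e'⟩ _ h
    simp only at h
    have hP : P = P' := by
      ext C
      constructor
      · intro hC
        have := congrFun h (e.symm ⟨C, hC⟩)
        simp only [Equiv.apply_symm_apply] at this
        rw [this]; exact (e' _).2
      · intro hC
        have := congrFun h (e'.symm ⟨C, hC⟩)
        simp only [Equiv.apply_symm_apply] at this
        rw [← this]; exact (e _).2
    subst hP
    congr 1
    exact Equiv.ext fun j => Subtype.ext (congrFun h j)
  · intro A hA
    simp only [mem_filter, mem_univ, true_and] at hA
    obtain ⟨⟨hd, hu⟩, hne⟩ := hA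
    have hinj : Function.Injective A := by
      intro i j hij
      by_contra h
      have := hd i j h
      rw [hij, disjoint_self_iff_empty] at this
      exact (hne j).ne_empty this
    let P : Finpartition B :=
      { parts := univ.image A
        supIndep := by
          rw [supIndep_iff_pairwiseDisjoint]
          intro C hC C' hC' hCC
          rw [coe_image, Set.mem_image] at hC hC'
          obtain ⟨i, -, rfl⟩ := hC
          obtain ⟨j, -, rfl⟩ := hC'
          exact hd i j fun h => hCC (by rw [h])
        sup_parts := by
          rw [sup_image, Function.id_comp, sup_eq_biUnion, hu]
        bot_notMem := by
          intro h
          obtain ⟨j, -, hj⟩ := mem_image.1 h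
          exact (hne j).ne_empty hj }
    let e : Fin l ≃ P.parts := Equiv.ofBijective
      (fun j => ⟨A j, mem_image_of_mem A (mem_univ j)⟩)
      ⟨fun i j h => hinj (congrArg Subtype.val h), by
        rintro ⟨C, hC⟩
        obtain ⟨j, -, rfl⟩ := mem_image.1 hC
        exact ⟨j, rfl⟩⟩
    refine ⟨⟨P, e⟩, ?_, rfl⟩
    simp only [mem_sigma, mem_filter, mem_univ, true_and, and_true]
    change #(univ.image A) = l
    rw [card_image_of_injective _ hinj, card_univ, Fintype.card_fin]
  · intros; rfl

/-! ### Cut-and-join for the connected numbers -/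

section Connected

open PowerSeries (derivative)

variable {σ : Type*} [DecidableEq σ]

/-- The disconnected series as a set function. -/
def discFun (r q : ℕ) (ν : σ → ℕ) : SetFun σ (PowerSeries ℚ) :=
  SetFun.mk fun S => discSeries r q (S.val.map ν).sort

theorem discFun_apply (r q : ℕ) (ν : σ → ℕ) (S : Finset σ) :
    discFun r q ν S = discSeries r q (S.val.map ν).sort := rfl

theorem discFun_sub_one_empty (r q : ℕ) (ν : σ → ℕ) : (discFun r q ν - 1) ∅ = 0 := by
  rw [SetFun.sub_apply, discFun_apply, SetFun.one_apply, if_pos rfl, empty_val, Multiset.map_zero,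
    discSeries_nil, sub_self]

theorem discFun_sub_one_pow [Fintype σ] (r q : ℕ) (ν : σ → ℕ) {k : ℕ}
    (hk : Fintype.card σ < k) : (discFun r q ν - 1) ^ k = 0 :=
  pow_eq_zero_of_le hk (SetFun.pow_eq_zero_of_empty (discFun_sub_one_empty r q ν))

/-- The connected series as a set function. -/
def connFun (k r q : ℕ) (ν : σ → ℕ) : SetFun σ (PowerSeries ℚ) := logTrunc k (discFun r q ν - 1)

theorem sum_splittings_of_empty {R : Type*} [Fintype σ] [CommRing R] [Algebra ℚ R]
    (F : Finset σ → R) (hF : F ∅ = 0) (l : ℕ) (B : Finset σ) :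
    ∑ A : Fin l → Finset σ with IsSplitting A B, ∏ j, F (A j) =
      ∑ A : Fin l → Finset σ with IsSplitting A B ∧ ∀ j, (A j).Nonempty, ∏ j, F (A j) := by
  symm
  refine sum_subset (fun A hA => ?_) (fun A hA hA' => ?_)
  · simp only [mem_filter, mem_univ, true_and] at hA ⊢; exact hA.1
  · simp only [mem_filter, mem_univ, true_and] at hA hA'
    have : ∃ j, ¬ (A j).Nonempty := by
      by_contra! h; exact hA' ⟨hA, h⟩
    obtain ⟨j, hj⟩ := this
    exact prod_eq_zero (mem_univ j) (by rw [not_nonempty_iff_eq_empty.1 hj, hF])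

/-- The coefficient `(-1)^l/(l+1)` of the logarithm times the `(l+1)!` orderings of the blocks is
the inclusion-exclusion coefficient `(-1)^l l!`. Truncating at `k ≥ #B` is harmless, a partition of
`B` having at most `#B` blocks. -/
theorem connFun_apply [Fintype σ] (k r q : ℕ) (ν : σ → ℕ) {B : Finset σ} (hB : B.Nonempty)
    (hk : #B ≤ k) : connFun k r q ν B = connSeries r q B ν := by
  have hX := discFun_sub_one_empty r q ν
  rw [connFun, logTrunc, SetFun.sum_apply]
  have h1 : ∀ l ∈ range k, (((-1 : ℚ) ^ l / (l + 1)) • (discFun r q ν - 1) ^ (l + 1)) B =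
      ∑ P : Finpartition B with #P.parts = l + 1,
        ((-1 : ℚ) ^ (#P.parts - 1) * ((#P.parts - 1)! : ℚ)) •
          ∏ C ∈ P.parts, discSeries r q ((C.val.map ν).sort) := by
    intro l _
    have e := sum_splittings_eq (fun S => (discFun r q ν - 1) S) (l + 1) B
    rw [SetFun.smul_apply, SetFun.pow_apply, sum_splittings_of_empty _ hX]
    refine (congrArg (fun x => ((-1 : ℚ) ^ l / (l + 1)) • x) e).trans ?_
    rw [smul_smul, smul_sum]
    refine sum_congr rfl fun P hP => ?_
    rw [mem_filter] at hP
    congr 1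
    · rw [hP.2, Nat.add_sub_cancel, Nat.factorial_succ]; push_cast; field_simp
    · refine prod_congr rfl fun C hC => ?_
      rw [SetFun.sub_apply, SetFun.one_apply, if_neg (P.nonempty_of_mem_parts hC).ne_empty, sub_zero,
        discFun_apply]
  rw [sum_congr rfl h1, connSeries]
  have h2 : ∀ P ∈ (univ : Finset (Finpartition B)), #P.parts - 1 ∈ range k := by
    intro P _
    have := P.card_parts_le_card
    have := hB.card_pos
    rw [mem_range]; omega
  rw [← sum_fiberwise_of_maps_to h2]
  refine sum_congr rfl fun l _ => ?_
  refine sum_congr ?_ fun _ _ => rfl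
  ext P
  simp only [mem_filter, mem_univ, true_and]
  have : 0 < #P.parts := by
    rw [card_pos]
    exact P.parts_nonempty hB.ne_empty
  omega

variable [Fintype σ]

/-- The weights of the cut-and-join terms with new parts `a`, as a set function. -/
def weightFun (r : ℕ) (ν : σ → ℕ) (m : ℕ) (a : Fin (m + 1) → ℕ) : SetFun σ (PowerSeries ℚ) :=
  SetFun.mk fun L => if L.Nonempty ∧ ∑ j, a j = ∑ i ∈ L, ν i then
    ((r ! : ℚ) * (1 / ((m + 1)! : ℚ)) * cutJoinWeight (r + 1) L ν a) • 1 else 0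

/-- All tuples with entries at most `M`. -/
abbrev box (M m : ℕ) : Finset (Fin (m + 1) → ℕ) := Fintype.piFinset fun _ => range (M + 1)

/-- The box of tuples does not depend on `L`, so the cut-and-join sum becomes a convolution;
`weightFun` discards the tuples with the wrong sum. -/
theorem sum_weightFun (r : ℕ) (ν : σ → ℕ) (M : ℕ) (hM : ∑ i, ν i ≤ M)
    (f : ∀ m, (Fin (m + 1) → ℕ) → SetFun σ (PowerSeries ℚ)) (B : Finset σ) :
    (∑ m ∈ range M, ∑ a ∈ box M m, weightFun r ν m a * f m a) B =
      ∑ L ∈ B.powerset with L.Nonempty, ∑ m ∈ range M, ∑ a ∈ tuples (m + 1) (∑ i ∈ L, ν i),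
        ((r ! : ℚ) * (1 / ((m + 1)! : ℚ)) * cutJoinWeight (r + 1) L ν a) • f m a (B \ L) := by
  simp only [SetFun.sum_apply, SetFun.mul_apply]
  rw [sum_congr rfl fun m _ => sum_comm, sum_comm, sum_filter]
  refine sum_congr rfl fun L hL => ?_
  split_ifs with hne
  · refine sum_congr rfl fun m _ => ?_
    have hsub : tuples (m + 1) (∑ i ∈ L, ν i) ⊆ box M m := by
      intro a ha
      rw [mem_tuples] at ha
      rw [Fintype.mem_piFinset]
      intro j
      have h1 := single_le_sum (f := a) (fun _ _ => Nat.zero_le _) (mem_univ j)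
      have h2 := sum_le_sum_of_subset (f := ν) (subset_univ L)
      rw [mem_range]; omega
    rw [← sum_subset hsub]
    · refine sum_congr rfl fun a ha => ?_
      rw [mem_tuples] at ha
      rw [weightFun, SetFun.mk_apply, if_pos ⟨hne, ha⟩, smul_mul_assoc, one_mul]
    · intro a _ ha
      rw [mem_tuples] at ha
      rw [weightFun, SetFun.mk_apply, if_neg (fun h => ha h.2), zero_mul]
  · refine sum_eq_zero fun m _ => sum_eq_zero fun a _ => ?_
    rw [weightFun, SetFun.mk_apply, if_neg (fun h => hne h.1), zero_mul]

theorem map_elim_disjSum (ν : σ → ℕ) {m : ℕ} (a : Fin m → ℕ) (S : Finset σ) (T : Finset (Fin m)) :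
    (S.disjSum T).val.map (Sum.elim ν a) = S.val.map ν + T.val.map a := by
  simp [val_disjSum, Multiset.disjSum, Multiset.map_map, Function.comp_def]

/-- The state after cutting contains all the new parts `a`; it is the disconnected function of the
enlarged index set at sets containing the whole of `Fin (m + 1)`. -/
theorem mapDer_discFun (r q : ℕ) (ν : σ → ℕ) (hν : ∀ i, 0 < ν i) (M : ℕ) (hM : ∑ i, ν i ≤ M) :
    SetFun.mapDer (derivative ℚ) (discFun r q ν) = ∑ m ∈ range M, ∑ a ∈ box M m,
      weightFun r ν m a * SetFun.top (discFun r q (Sum.elim ν a)) := by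
  ext1 B
  rw [sum_weightFun r ν M hM, SetFun.mapDer_apply, discFun_apply,
    derivative_discSeries r q B ν (fun i _ => hν i) M
      ((sum_le_sum_of_subset (subset_univ B)).trans hM)]
  refine sum_congr rfl fun L _ => sum_congr rfl fun m _ => sum_congr rfl fun a _ => ?_
  rw [SetFun.top, SetFun.mk_apply, discFun_apply, map_elim_disjSum]

/-- The connected components of a surface with boundary parts in `σ` and `[m]` which meet `[m]`. -/
def linkFun (k r q : ℕ) (ν : σ → ℕ) {m : ℕ} (a : Fin m → ℕ) :
    SetFun (σ ⊕ Fin m) (PowerSeries ℚ) :=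
  connFun k r q (Sum.elim ν a) - SetFun.extend (Fin m) (connFun k r q ν)

theorem connFun_empty (k r q : ℕ) (ν : σ → ℕ) : connFun k r q ν ∅ = 0 :=
  SetFun.logTrunc_empty (discFun_sub_one_empty r q ν) k

theorem linkFun_empty (k r q : ℕ) (ν : σ → ℕ) {m : ℕ} (a : Fin m → ℕ) :
    linkFun k r q ν a ∅ = 0 := by
  rw [linkFun, SetFun.sub_apply, connFun_empty, SetFun.extend_apply]
  have h1 : (∅ : Finset (σ ⊕ Fin m)).toRight = ∅ := by ext; simp
  have h2 : (∅ : Finset (σ ⊕ Fin m)).toLeft = ∅ := by ext; simp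
  rw [if_pos h1, h2, connFun_empty, sub_zero]

theorem exp_connFun (k r q : ℕ) (ν : σ → ℕ) (hk : Fintype.card σ < k) :
    IsNilpotent.exp (connFun k r q ν) = discFun r q ν := by
  rw [connFun, SetFun.exp_logTrunc (discFun_sub_one_empty r q ν) (discFun_sub_one_pow r q ν hk),
    add_sub_cancel]

/-- Exponential formula: the connected function of the enlarged system is the sum of the components
that meet `[m]` and those that do not. The exponential of the latter factors out as `discFun r q ν`.
-/
theorem top_discFun (k r q : ℕ) (ν : σ → ℕ) {m : ℕ} (a : Fin m → ℕ)
    (hk : Fintype.card σ + m < k) :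
    SetFun.top (discFun r q (Sum.elim ν a)) =
      SetFun.top (IsNilpotent.exp (linkFun k r q ν a)) * discFun r q ν := by
  have hn1 : IsNilpotent (linkFun k r q ν a) :=
    SetFun.isNilpotent_of_empty (linkFun_empty k r q ν a)
  have hn2 : IsNilpotent (connFun k r q ν) :=
    SetFun.isNilpotent_of_empty (connFun_empty k r q ν)
  have hn3 : IsNilpotent (SetFun.extend (Fin m) (connFun k r q ν)) := hn2.map _
  rw [← SetFun.top_mul_extend, ← exp_connFun k r q ν (by omega), IsNilpotent.map_exp hn2,
    ← IsNilpotent.exp_add_of_commute (Commute.all _ _) hn1 hn3, linkFun, sub_add_cancel,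
    exp_connFun k r q (Sum.elim ν a) (by simp; omega)]

/-- On sets inside `σ` the two connected functions agree, because the logarithm commutes with
restriction. The difference is supported on sets meeting `[m]`. -/
theorem linkFun_apply (k r q : ℕ) (ν : σ → ℕ) {m : ℕ} (a : Fin m → ℕ)
    (hk : Fintype.card σ + m < k) (A : Finset (σ ⊕ Fin m)) :
    linkFun k r q ν a A =
      if A.toRight.Nonempty then connSeries r q A (Sum.elim ν a) else 0 := by
  rw [linkFun, SetFun.sub_apply, SetFun.extend_apply]
  split_ifs with h1 h2 h2
  · exact absurd h1 h2.ne_empty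
  · have h3 : SetFun.restrict Function.Embedding.inl (connFun k r q (Sum.elim ν a)) =
        connFun k r q ν := by
      rw [connFun, map_logTrunc, connFun]
      congr 1
      ext1 S
      rw [map_sub, map_one, SetFun.sub_apply, SetFun.sub_apply, SetFun.restrict_apply, discFun_apply,
        discFun_apply, ← disjSum_empty, map_elim_disjSum]
      simp
    have h4 : A.toLeft.map Function.Embedding.inl = A := by
      rw [← disjSum_empty]
      conv_rhs => rw [← toLeft_disjSum_toRight (u := A), h1]
    rw [← h3, SetFun.restrict_apply, h4, sub_self]
  · rw [sub_zero]
    refine connFun_apply k r q _ ?_ ((card_le_univ A).trans (by simp; omega))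
    obtain ⟨x, hx⟩ := h2
    exact ⟨_, mem_toRight.1 hx⟩
  · exact absurd (not_nonempty_iff_eq_empty.1 h2) h1

theorem isSplitting_disjSum {α β : Type*} [DecidableEq α] [DecidableEq β] {l : ℕ}
    {A : Fin l → Finset (α ⊕ β)} {S : Finset α} {T : Finset β} :
    IsSplitting A (S.disjSum T) ↔
      IsSplitting (fun j => (A j).toLeft) S ∧ IsSplitting (fun j => (A j).toRight) T := by
  simp only [isSplitting_iff, Sum.forall, inl_mem_disjSum, inr_mem_disjSum, mem_toLeft,
    mem_toRight, subset_iff]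
  exact ⟨fun h => ⟨⟨fun i x hx => (h.1 i).1 x hx, h.2.1⟩, ⟨fun i x hx => (h.1 i).2 x hx, h.2.2⟩⟩,
    fun h => ⟨fun i => ⟨fun x hx => h.1.1 i hx, fun x hx => h.2.1 i hx⟩, h.1.2, h.2.2⟩⟩

/-- Sums over configurations of connected components, each meeting `[m]`. -/
def linkSum (k r q : ℕ) (ν : σ → ℕ) {m : ℕ} (a : Fin m → ℕ) (S : Finset σ) : PowerSeries ℚ :=
  ∑ l ∈ range k, (1 / (l ! : ℚ)) • ∑ K : Fin l → Finset σ with IsSplitting K S,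
    ∑ N : Fin l → Finset (Fin m) with IsSplitting N univ ∧ ∀ j, (N j).Nonempty,
      ∏ j, connSeries r q ((K j).disjSum (N j)) (Sum.elim ν a)

/-- A splitting of `S ⊔ [m]` is a pair of splittings; it contributes nothing when some block misses
`[m]`. -/
theorem top_exp_linkFun (k r q : ℕ) (ν : σ → ℕ) {m : ℕ} (a : Fin m → ℕ)
    (hk : Fintype.card σ + m < k) (S : Finset σ) :
    SetFun.top (IsNilpotent.exp (linkFun k r q ν a)) S = linkSum k r q ν a S := by
  have h0 : linkFun k r q ν a ^ k = 0 :=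
    pow_eq_zero_of_le (by simp; omega)
      (SetFun.pow_eq_zero_of_empty (linkFun_empty k r q ν a))
  rw [SetFun.top, SetFun.mk_apply, IsNilpotent.exp_eq_sum h0, SetFun.sum_apply, linkSum]
  refine sum_congr rfl fun l _ => ?_
  rw [SetFun.smul_apply, SetFun.pow_apply, one_div]
  congr 1
  rw [sum_sigma']
  symm
  refine sum_of_injOn (fun x j => (x.1 j).disjSum (x.2 j)) ?_ ?_ ?_ ?_
  · rintro ⟨K, N⟩ _ ⟨K', N'⟩ _ h
    have h1 : K = K' := by
      funext j
      simpa only [toLeft_disjSum] using congrArg toLeft (congrFun h j)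
    have h2 : N = N' := by
      funext j
      simpa only [toRight_disjSum] using congrArg toRight (congrFun h j)
    rw [h1, h2]
  · rintro ⟨K, N⟩ hx
    rw [mem_coe] at hx ⊢
    simp only [mem_sigma, mem_filter, mem_univ, true_and] at hx ⊢
    rw [isSplitting_disjSum]
    simp only [toLeft_disjSum, toRight_disjSum]
    exact ⟨hx.1, hx.2.1⟩
  · intro A hA hA'
    simp only [mem_filter, mem_univ, true_and] at hA
    rw [isSplitting_disjSum] at hA
    have : ∃ j, ¬ (A j).toRight.Nonempty := by
      by_contra! h
      refine hA' ⟨⟨fun j => (A j).toLeft, fun j => (A j).toRight⟩, ?_, ?_⟩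
      · rw [mem_coe]
        simp only [mem_sigma, mem_filter, mem_univ, true_and]
        exact ⟨hA.1, hA.2, h⟩
      · funext j; exact toLeft_disjSum_toRight
    obtain ⟨j, hj⟩ := this
    exact prod_eq_zero (mem_univ j) (by rw [linkFun_apply k r q ν a hk, if_neg hj])
  · rintro ⟨K, N⟩ hx
    simp only [mem_sigma, mem_filter, mem_univ, true_and] at hx
    refine prod_congr rfl fun j _ => ?_
    rw [linkFun_apply k r q ν a hk, toRight_disjSum, if_pos (hx.2.2 j)]

/-- The cut-and-join equation for the connected series. -/
theorem derivative_connSeries (r q : ℕ) (ν : σ → ℕ) (hν : ∀ i, 0 < ν i) (M : ℕ)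
    (hM : ∑ i, ν i ≤ M) (k : ℕ) (hk : Fintype.card σ + M < k) (B : Finset σ) (hB : B.Nonempty) :
    derivative ℚ (connSeries r q B ν) =
      ∑ L ∈ B.powerset with L.Nonempty, ∑ m ∈ range M, ∑ a ∈ tuples (m + 1) (∑ i ∈ L, ν i),
        ((r ! : ℚ) * (1 / ((m + 1)! : ℚ)) * cutJoinWeight (r + 1) L ν a) •
          linkSum k r q ν a (B \ L) := by
  have hX := discFun_sub_one_pow r q ν (k := k) (by omega)
  have h1 := derivation_logTrunc (SetFun.mapDer (derivative ℚ)) hX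
  have h2 := one_add_mul_geom hX
  rw [map_sub, Derivation.map_one_eq_zero, sub_zero, add_sub_cancel] at h1
  rw [add_sub_cancel] at h2
  have h3 : SetFun.mapDer (derivative ℚ) (discFun r q ν) =
      discFun r q ν * ∑ m ∈ range M, ∑ a ∈ box M m,
        weightFun r ν m a * SetFun.top (IsNilpotent.exp (linkFun k r q ν a)) := by
    rw [mapDer_discFun r q ν hν M hM, mul_sum]
    refine sum_congr rfl fun m hm => ?_
    rw [mem_range] at hm
    rw [mul_sum]
    refine sum_congr rfl fun a _ => ?_
    rw [top_discFun k r q ν a (by omega)]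
    ring
  -- Logarithmic derivative: the common factor `discFun r q ν` is cancelled by its inverse, the
  -- geometric series in `h2`.
  have h4 : SetFun.mapDer (derivative ℚ) (connFun k r q ν) =
      ∑ m ∈ range M, ∑ a ∈ box M m,
        weightFun r ν m a * SetFun.top (IsNilpotent.exp (linkFun k r q ν a)) := by
    rw [h3] at h1
    have := congrArg (fun x => x * ∑ l ∈ range k, (-(discFun r q ν - 1)) ^ l) h1
    beta_reduce at this
    rw [mul_right_comm, h2, one_mul, mul_right_comm, h2, one_mul] at this
    exact this
  rw [← connFun_apply k r q ν hB ((card_le_univ B).trans (by omega)), ← SetFun.mapDer_apply, h4,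
    sum_weightFun r ν M hM]
  refine sum_congr rfl fun L _ => sum_congr rfl fun m hm => sum_congr rfl fun a _ => ?_
  rw [mem_range] at hm
  rw [top_exp_linkFun k r q ν a (by omega)]

end Connected

/-! ### The genus of a connected cover -/

section Genus

open PowerSeries (derivative)

/-- The symbol of the cut-and-join operators, without the power of `z`. -/
def linkSymbol {ι : Type*} (L : Finset ι) (ν : ι → ℕ) {m : ℕ} (a : Fin m → ℕ) : PowerSeries ℚ :=
  zetaOverZ⁻¹ * (∏ i ∈ L, zetaScaledOverAZ (ν i)) * ∏ j, zetaScaledOverZ (a j)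

/-! ### Parity and powers of `z` in the cut-and-join weights -/

theorem coeff_succ_zetaSeries_of_odd {j : ℕ} (hj : Odd j) :
    PowerSeries.coeff (j + 1) zetaSeries = 0 := by
  have h : Even (j + 1) := hj.add_one
  rw [zetaSeries, map_sub, PowerSeries.coeff_rescale, PowerSeries.coeff_rescale, neg_div,
    h.neg_pow, sub_self]

theorem rescale_neg_one_mk {f : ℕ → ℚ} (hf : ∀ j, Odd j → f j = 0) :
    PowerSeries.rescale (-1 : ℚ) (PowerSeries.mk f) = PowerSeries.mk f := by
  ext j
  rw [PowerSeries.coeff_rescale, PowerSeries.coeff_mk]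
  rcases Nat.even_or_odd j with h | h
  · rw [h.neg_one_pow, one_mul]
  · rw [hf j h, mul_zero]

theorem rescale_neg_one_linkSymbol {ι : Type*} (L : Finset ι) (ν : ι → ℕ) {m : ℕ}
    (a : Fin m → ℕ) :
    PowerSeries.rescale (-1 : ℚ) (linkSymbol L ν a) = linkSymbol L ν a := by
  have h0 : PowerSeries.rescale (-1 : ℚ) zetaOverZ = zetaOverZ :=
    rescale_neg_one_mk fun j hj => coeff_succ_zetaSeries_of_odd hj
  have h1 : PowerSeries.rescale (-1 : ℚ) zetaOverZ⁻¹ = zetaOverZ⁻¹ := by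
    have := congrArg (PowerSeries.rescale (-1 : ℚ)) zetaOverZ_mul_inv
    rw [map_mul, h0, map_one] at this
    calc _ = zetaOverZ⁻¹ * (zetaOverZ * PowerSeries.rescale (-1 : ℚ) zetaOverZ⁻¹) := by
          rw [← mul_assoc, mul_comm _ zetaOverZ, zetaOverZ_mul_inv, one_mul]
      _ = _ := by rw [this, mul_one]
  rw [linkSymbol, map_mul, map_mul, map_prod, map_prod, h1]
  congr 1
  · congr 1
    refine prod_congr rfl fun i _ => rescale_neg_one_mk fun j hj => ?_
    rw [coeff_succ_zetaSeries_of_odd hj, zero_mul]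
  · refine prod_congr rfl fun i _ => rescale_neg_one_mk fun j hj => ?_
    rw [coeff_succ_zetaSeries_of_odd hj, zero_mul]

theorem coeff_linkSymbol_of_odd {ι : Type*} (L : Finset ι) (ν : ι → ℕ) {m : ℕ}
    (a : Fin m → ℕ) {j : ℕ} (hj : Odd j) : PowerSeries.coeff j (linkSymbol L ν a) = 0 := by
  have := congrArg (PowerSeries.coeff j) (rescale_neg_one_linkSymbol L ν a)
  rw [PowerSeries.coeff_rescale, hj.neg_one_pow] at this
  linarith

/-- Each joined part and each new part brings one factor `z`, and `ζ(z)⁻¹` takes one away. For `m +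
1` new parts this gives `z^{#L + m}`. -/
theorem cutJoinWeight_eq_coeff {ι : Type*} (p : ℕ) (L : Finset ι) (ν : ι → ℕ) {m : ℕ}
    (a : Fin (m + 1) → ℕ) : cutJoinWeight p L ν a =
      PowerSeries.coeff p (PowerSeries.X ^ (#L + m) * linkSymbol L ν a) := by
  rw [cutJoinWeight, creSymbol, linkSymbol, prod_mul_distrib, prod_const, Nat.add_sub_cancel,
    pow_add]
  congr 1
  ring

theorem cutJoinWeight_eq {ι : Type*} {p : ℕ} {L : Finset ι} (ν : ι → ℕ) {m d : ℕ}
    (a : Fin (m + 1) → ℕ) (h : #L + m + 2 * d = p) :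
    cutJoinWeight p L ν a = PowerSeries.coeff (2 * d) (linkSymbol L ν a) := by
  rw [cutJoinWeight_eq_coeff, ← h, add_comm _ (2 * d), PowerSeries.coeff_X_pow_mul]

theorem exists_of_cutJoinWeight_ne_zero {ι : Type*} {p : ℕ} {L : Finset ι} {ν : ι → ℕ} {m : ℕ}
    {a : Fin (m + 1) → ℕ} (h : cutJoinWeight p L ν a ≠ 0) : ∃ d, #L + m + 2 * d = p := by
  rw [cutJoinWeight_eq_coeff, PowerSeries.coeff_X_pow_mul'] at h
  split_ifs at h with h1
  · rcases Nat.even_or_odd (p - (#L + m)) with ⟨d, hd⟩ | h2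
    · exact ⟨d, by omega⟩
    · exact absurd (coeff_linkSymbol_of_odd L ν a h2) h
  · exact absurd rfl h

theorem linkSymbol_eq_zero {ι : Type*} (L : Finset ι) (ν : ι → ℕ) {m : ℕ}
    {a : Fin m → ℕ} {j : Fin m} (hj : a j = 0) : linkSymbol L ν a = 0 := by
  rw [linkSymbol, prod_eq_zero (mem_univ j), mul_zero]
  rw [hj, Nat.cast_zero, zetaScaledOverZ_zero]

/-- The Riemann–Hurwitz relation between the number of completed cycles and the genus. -/
def IsGenus {σ : Type*} (r q : ℕ) (B : Finset σ) (ν : σ → ℕ) (b g : ℕ) : Prop :=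
  (b : ℤ) * (r * q) = (2 * g - 2 + #B) * q + ∑ i ∈ B, (ν i : ℤ)

theorem IsSplitting.sum_sum {α M : Type*} [DecidableEq α] [AddCommMonoid M] {l : ℕ}
    {A : Fin l → Finset α} {S : Finset α} (h : IsSplitting A S) (f : α → M) :
    ∑ j, ∑ x ∈ A j, f x = ∑ x ∈ S, f x := by
  rw [← h.2, sum_biUnion]
  intro i _ j _ hij
  exact h.1 i j hij

theorem IsSplitting.sum_card {α : Type*} [DecidableEq α] {l : ℕ}
    {A : Fin l → Finset α} {S : Finset α} (h : IsSplitting A S) : ∑ j, #(A j) = #S := by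
  have := h.sum_sum fun _ => 1
  rw [← card_eq_sum_ones] at this
  rw [← this]
  exact sum_congr rfl fun j _ => card_eq_sum_ones _

theorem IsSplitting.le_card {α : Type*} [DecidableEq α] {l : ℕ}
    {A : Fin l → Finset α} {S : Finset α} (h : IsSplitting A S) (h' : ∀ j, (A j).Nonempty) :
    l ≤ #S := by
  rw [← h.sum_card]
  calc l = ∑ _j : Fin l, 1 := by simp
    _ ≤ _ := sum_le_sum fun j _ => (h' j).card_pos

/-- The relations of the components are added, using that the new parts have the same sum as the
joined ones. The extra cycle contributes `r * q = (#L + m + 2d - 2) * q`, which supplies `m + d` to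
the genus and restores `#L` in the count of parts. -/
theorem genus_relation {σ : Type*} [DecidableEq σ] {r q : ℕ} {B L : Finset σ} {ν : σ → ℕ}
    {m d l : ℕ} {a : Fin m → ℕ} {K : Fin l → Finset σ} {N : Fin l → Finset (Fin m)}
    {β γ : Fin l → ℕ} (hL : L ⊆ B) (hK : IsSplitting K (B \ L)) (hN : IsSplitting N univ)
    (ha : ∑ j, a j = ∑ i ∈ L, ν i) (hd : #L + m + 2 * d = r + 2)
    (h : ∀ j, IsGenus r q ((K j).disjSum (N j)) (Sum.elim ν a) (β j) (γ j)) :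
    (∑ j, (β j : ℤ) + 1) * (r * q) =
      (2 * (∑ j, (γ j : ℤ) + m - l + d) - 2 + #B) * q + ∑ i ∈ B, (ν i : ℤ) := by
  have h1 := sum_congr (rfl : (univ : Finset (Fin l)) = univ) fun j _ => h j
  simp only [sum_disjSum, Sum.elim_inl, Sum.elim_inr, card_disjSum, sum_add_distrib, ← sum_mul,
    ← mul_sum, sum_sub_distrib, sum_const, card_univ, Fintype.card_fin, Nat.cast_add] at h1
  rw [hK.sum_sum fun x => (ν x : ℤ), hN.sum_sum fun x => (a x : ℤ)] at h1
  have h2 : ∑ j, (#(K j) : ℤ) = #(B \ L) := by exact_mod_cast hK.sum_card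
  have h3 : ∑ j, (#(N j) : ℤ) = m := by
    have := hN.sum_card
    rw [card_univ, Fintype.card_fin] at this
    exact_mod_cast this
  have h4 : (#(B \ L) : ℤ) + #L = #B := by exact_mod_cast card_sdiff_add_card_eq_card hL
  have h5 : ∑ i ∈ B \ L, (ν i : ℤ) + ∑ i ∈ L, (ν i : ℤ) = ∑ i ∈ B, (ν i : ℤ) := sum_sdiff hL
  have h6 : ∑ j, (a j : ℤ) = ∑ i ∈ L, (ν i : ℤ) := by exact_mod_cast ha
  have h7 : (#L : ℤ) + m + 2 * d = r + 2 := by exact_mod_cast hd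
  rw [h2, h3] at h1
  simp only [nsmul_eq_mul] at h1
  linear_combination h1 + h5 + h6 + (q : ℤ) * h4 - (q : ℤ) * h7

/-- A ring homomorphism applied to the values of a set function. -/
def SetFun.mapHom {σ R R' : Type*} [DecidableEq σ] [CommRing R] [Algebra ℚ R] [CommRing R']
    [Algebra ℚ R'] (f : R →+* R') : SetFun σ R →+* SetFun σ R' where
  toFun x := SetFun.mk fun S => f (x S)
  map_zero' := by ext1 S; exact map_zero f
  map_add' x y := by ext1 S; exact map_add f _ _
  map_one' := by
    ext1 S
    simp only [SetFun.mk_apply, SetFun.one_apply]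
    split_ifs <;> simp
  map_mul' x y := by
    ext1 S
    simp only [SetFun.mk_apply, SetFun.mul_apply, map_sum, map_mul]

/-- At `β = 0` the disconnected function is `W(S) = ∏ y_i`, and `cardDer W = W * Y` with `Y`
supported on singletons. So `Y` is the `cardDer` of the logarithm of `W`. -/
theorem coeff_zero_connSeries {σ : Type*} [DecidableEq σ] [Fintype σ] (r : ℕ) {q : ℕ}
    (hq : 0 < q) (ν : σ → ℕ) (hν : ∀ i, 0 < ν i) {B : Finset σ}
    (h : PowerSeries.coeff 0 (connSeries r q B ν) ≠ 0) (hB : B.Nonempty) :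
    ∃ i, B = {i} ∧ ν i = q := by
  set k := Fintype.card σ + 1 with hk
  set y : σ → ℚ := fun i => if ν i = q then 1 / (q : ℚ) else 0 with hy
  set W : SetFun σ ℚ := SetFun.mk fun S => ∏ i ∈ S, y i with hW
  set Y : SetFun σ ℚ := SetFun.mk fun S => if #S = 1 then ∏ i ∈ S, y i else 0 with hY
  have hWY : W * Y = SetFun.cardDer W := by
    rw [mul_comm]
    ext1 S
    rw [SetFun.mul_apply, SetFun.cardDer_apply]
    have : ∀ T ∈ S.powerset, Y T * W (S \ T) = if #T = 1 then ∏ i ∈ S, y i else 0 := by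
      intro T hT
      rw [mem_powerset] at hT
      rw [hY, hW, SetFun.mk_apply, SetFun.mk_apply]
      split_ifs
      · rw [mul_comm, prod_sdiff hT]
      · rw [zero_mul]
    rw [sum_congr rfl this, ← sum_filter, ← powersetCard_eq_filter, sum_const, card_powersetCard,
      Nat.choose_one_right, ← Nat.cast_smul_eq_nsmul ℚ]
    rfl
  have hmap : SetFun.mapHom PowerSeries.constantCoeff (discFun r q ν) = W := by
    ext1 S
    have := coeff_zero_discSeries r hq S ν fun i _ => hν i
    rwa [PowerSeries.coeff_zero_eq_constantCoeff_apply] at this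
  have hC : SetFun.mapHom PowerSeries.constantCoeff (connFun k r q ν) = logTrunc k (W - 1) := by
    rw [connFun, map_logTrunc, map_sub, map_one, hmap]
  have hnil : (W - 1) ^ k = 0 := by
    have := congrArg (SetFun.mapHom PowerSeries.constantCoeff)
      (discFun_sub_one_pow r q ν (k := k) (by omega))
    rwa [map_pow, map_sub, map_one, hmap, map_zero] at this
  have h1 := derivation_logTrunc SetFun.cardDer hnil
  have h2 := one_add_mul_geom hnil
  rw [map_sub, Derivation.map_one_eq_zero, sub_zero, add_sub_cancel, ← hWY] at h1
  rw [add_sub_cancel] at h2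
  have h3 : SetFun.cardDer (logTrunc k (W - 1)) = Y := by
    have := congrArg (fun x => x * ∑ l ∈ range k, (-(W - 1)) ^ l) h1
    beta_reduce at this
    rw [mul_right_comm, h2, one_mul, mul_right_comm, h2, one_mul] at this
    exact this
  have h4 : (#B : ℚ) • PowerSeries.coeff 0 (connSeries r q B ν) = Y B := by
    rw [← h3, SetFun.cardDer_apply, ← hC, PowerSeries.coeff_zero_eq_constantCoeff_apply,
      ← connFun_apply k r q ν hB ((card_le_univ B).trans (by omega))]
    rfl
  have h5 : Y B ≠ 0 := by
    rw [← h4, smul_eq_mul]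
    exact mul_ne_zero (by exact_mod_cast hB.card_pos.ne') h
  rw [hY, SetFun.mk_apply] at h5
  have h6 : #B = 1 := by
    by_contra h; rw [if_neg h] at h5; exact h5 rfl
  obtain ⟨i, rfl⟩ := card_eq_one.1 h6
  refine ⟨i, rfl, ?_⟩
  by_contra hne
  rw [if_pos h6, prod_singleton, hy] at h5
  exact h5 (if_neg hne)

/-- A nonzero coefficient with `b + 1` cycles comes, by cut-and-join, from components with at most
`b` cycles each. Every component contains a new part, so `l` is at most the number of new parts and
the resulting genus is non-negative. The base case is a single part `q` in genus `0`. The index type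
varies in the induction because new parts are adjoined. -/
theorem exists_isGenus {r q : ℕ} (hq : 0 < q) (b : ℕ) : ∀ {σ : Type} [DecidableEq σ] [Fintype σ]
    (ν : σ → ℕ) (_ : ∀ i, 0 < ν i) (B : Finset σ) (_ : B.Nonempty)
    (_ : PowerSeries.coeff b (connSeries r q B ν) ≠ 0), ∃ g, IsGenus r q B ν b g := by
  induction b using Nat.strong_induction_on with
  | _ b ih =>
  intro σ _ _ ν hν B hB h
  rcases b with _ | b
  · obtain ⟨i, rfl, hi⟩ := coeff_zero_connSeries r hq ν hν h hB
    refine ⟨0, ?_⟩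
    simp [IsGenus, hi]
  · have h1 : PowerSeries.coeff b (derivative ℚ (connSeries r q B ν)) ≠ 0 := by
      rw [PowerSeries.coeff_derivative]
      exact mul_ne_zero h (by positivity)
    rw [derivative_connSeries r q ν hν _ le_rfl _ (Nat.lt_succ_self _) B hB, map_sum] at h1
    obtain ⟨L, hL, h1⟩ := exists_ne_zero_of_sum_ne_zero h1
    rw [map_sum] at h1
    obtain ⟨m, -, h1⟩ := exists_ne_zero_of_sum_ne_zero h1
    rw [map_sum] at h1
    obtain ⟨a, ha, h1⟩ := exists_ne_zero_of_sum_ne_zero h1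
    rw [PowerSeries.coeff_smul, smul_eq_mul] at h1
    have hw := right_ne_zero_of_mul (left_ne_zero_of_mul h1)
    replace h1 := right_ne_zero_of_mul h1
    rw [linkSum, map_sum] at h1
    obtain ⟨l, -, h1⟩ := exists_ne_zero_of_sum_ne_zero h1
    rw [PowerSeries.coeff_smul, smul_eq_mul] at h1
    replace h1 := right_ne_zero_of_mul h1
    rw [map_sum] at h1
    obtain ⟨K, hK, h1⟩ := exists_ne_zero_of_sum_ne_zero h1
    rw [map_sum] at h1
    obtain ⟨N, hN, h1⟩ := exists_ne_zero_of_sum_ne_zero h1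
    rw [PowerSeries.coeff_prod] at h1
    obtain ⟨β, hβ, h1⟩ := exists_ne_zero_of_sum_ne_zero h1
    rw [mem_filter, mem_powerset] at hL
    rw [mem_tuples] at ha
    rw [mem_filter] at hK hN
    rw [mem_finsuppAntidiag] at hβ
    obtain ⟨d, hd⟩ := exists_of_cutJoinWeight_ne_zero hw
    -- A zero part would make the weight vanish; the induction hypothesis needs positive parts.
    have ha0 : ∀ j, 0 < a j := by
      intro j
      by_contra h0
      rw [cutJoinWeight_eq ν a hd, linkSymbol_eq_zero L ν (j := j) (by omega), map_zero] at hw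
      exact hw rfl
    have hβ' : ∀ j, β j < b + 1 := by
      intro j
      have := single_le_sum (f := β) (fun _ _ => Nat.zero_le _) (mem_univ j)
      rw [hβ.1] at this
      omega
    have hg : ∀ j, ∃ g, IsGenus r q ((K j).disjSum (N j)) (Sum.elim ν a) (β j) g := by
      intro j
      refine ih (β j) (hβ' j) (Sum.elim ν a) ?_ _ ?_ ?_
      · rintro (i | i)
        · exact hν i
        · exact ha0 i
      · obtain ⟨x, hx⟩ := hN.2.2 j
        exact ⟨Sum.inr x, inr_mem_disjSum.2 hx⟩
      · exact prod_ne_zero_iff.1 h1 j (mem_univ j)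
    choose γ hγ using hg
    have hrel := genus_relation hL.1 hK.2 hN.2.1 ha (show #L + (m + 1) + 2 * d = r + 2 by omega) hγ
    have hl := hN.2.1.le_card hN.2.2
    rw [card_univ, Fintype.card_fin] at hl
    refine ⟨∑ j, γ j + (m + 1 - l) + d, ?_⟩
    rw [IsGenus]
    have hb : ∑ j, (β j : ℤ) = b := by exact_mod_cast hβ.1
    rw [hb] at hrel
    push_cast [Nat.cast_sub hl] at hrel ⊢
    linear_combination hrel

end Genus

/-! ### Sums over the pole -/

section Lagrange

open MvPowerSeries (X coeff)

variable {n : ℕ}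

/-- `∑_{k ∈ L} y_k ∏_{i ∈ L, i ≠ k} x_i / (x_k - x_i)`. -/
def poleSum (y : Fin n → PolarSeries (id : Fin n → Fin n)) (L : Finset (Fin n)) :
    PolarSeries (id : Fin n → Fin n) :=
  ∑ k ∈ L, (∏ i ∈ L.erase k, polarFactor id k i) * y k

/-- The variable `x_i` among the series with poles. -/
def polarX (i : Fin n) : PolarSeries (id : Fin n → Fin n) :=
  algebraMap (MvPowerSeries (Fin n) ℚ) _ (X i)

theorem isUnit_polarX_sub {i j : Fin n} (h : i ≠ j) : IsUnit (polarX i - polarX j) := by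
  rw [polarX, polarX, ← map_sub]
  exact IsLocalization.map_units (PolarSeries (id : Fin n → Fin n))
      (⟨_, Submonoid.subset_closure ⟨i, j, h, rfl⟩⟩ : diagMonoid (id : Fin n → Fin n))

theorem polarFactor_mul_sub {k i : Fin n} (h : i ≠ k) :
    polarFactor id k i * (polarX k - polarX i) = polarX i := by
  have := polarFactor_mul (id : Fin n → Fin n) h
  rw [map_sub] at this
  exact this

/-- Termwise for `k ∈ L` this is the partial fraction `1/(x_k - x_i) - 1/(x_k - x_j) = (x_i -
x_j)/((x_k - x_i)(x_k - x_j))` times `x_i x_j`; the terms `k = i, j` match by the definition of the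
factors. -/
theorem poleSum_insert_insert (y : Fin n → PolarSeries (id : Fin n → Fin n)) {L : Finset (Fin n)}
    {i j : Fin n} (hij : i ≠ j) (hi : i ∉ L) (hj : j ∉ L) :
    (polarX i - polarX j) * poleSum y (insert i (insert j L)) =
      polarX j * poleSum y (insert i L) - polarX i * poleSum y (insert j L) := by
  have hi' : i ∉ insert j L := by simp [hij, hi]
  simp only [poleSum]
  rw [sum_insert hi', sum_insert hj, sum_insert hi, sum_insert hj]
  rw [erase_insert hi', erase_insert hi, erase_insert hj, prod_insert hj]
  have e1 : (insert i (insert j L)).erase j = insert i L := by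
    rw [insert_comm, erase_insert]; simp [hij.symm, hj]
  rw [e1, prod_insert hi]
  have h1 := polarFactor_mul_sub hij.symm
  have h2 := polarFactor_mul_sub hij
  have h3 : (polarX i - polarX j) * ∑ k ∈ L, (∏ x ∈ (insert i (insert j L)).erase k,
        polarFactor id k x) * y k =
      polarX j * ∑ k ∈ L, (∏ x ∈ (insert i L).erase k, polarFactor id k x) * y k -
        polarX i * ∑ k ∈ L, (∏ x ∈ (insert j L).erase k, polarFactor id k x) * y k := by
    rw [mul_sum, mul_sum, mul_sum, ← sum_sub_distrib]
    refine sum_congr rfl fun k hk => ?_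
    have hki : i ≠ k := by rintro rfl; exact hi hk
    have hkj : j ≠ k := by rintro rfl; exact hj hk
    rw [erase_insert_of_ne hki, erase_insert_of_ne hkj, erase_insert_of_ne hki,
      prod_insert, prod_insert, prod_insert]
    · have h4 := polarFactor_mul_sub hki
      have h5 := polarFactor_mul_sub hkj
      linear_combination (polarFactor id k i * (∏ x ∈ L.erase k, polarFactor id k x) * y k) * h5 -
        (polarFactor id k j * (∏ x ∈ L.erase k, polarFactor id k x) * y k) * h4
    · simp [hi]
    · simp [hj]
    · simp [hij, hi]
  linear_combination h3 + (∏ x ∈ L, polarFactor id i x) * y i * h1 -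
    (∏ x ∈ L, polarFactor id j x) * y j * h2

/-- The series whose coefficients depend on the exponents of the variables in `L` through their
sum only, all these exponents being positive. -/
def lagrange (G : (Fin n → ℕ) → ℕ → ℚ) (L : Finset (Fin n)) : MvPowerSeries (Fin n) ℚ := fun ν =>
  if ∀ i ∈ L, 0 < ν i then G (fun i => if i ∈ L then 0 else ν i) (∑ i ∈ L, ν i) else 0

theorem coeff_lagrange (G : (Fin n → ℕ) → ℕ → ℚ) (L : Finset (Fin n)) (ν : Fin n →₀ ℕ) :
    coeff ν (lagrange G L) =
      if ∀ i ∈ L, 0 < ν i then G (fun i => if i ∈ L then 0 else ν i) (∑ i ∈ L, ν i) else 0 := rfl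

theorem coeff_X_mul_eq {τ : Type*} (i : τ) (F : MvPowerSeries τ ℚ) (ν : τ →₀ ℕ) :
    coeff ν (X i * F) = if 0 < ν i then coeff (ν - Finsupp.single i 1) F else 0 := by
  rw [MvPowerSeries.X, MvPowerSeries.coeff_monomial_mul, one_mul]
  congr 1
  rw [Finsupp.single_le_iff, Nat.succ_le_iff]

/-- On the left the two shifted series carry the same value and cancel wherever both `ν i` and `ν j`
exceed `1`. The boundary terms, with one exponent equal to `1`, are the right-hand side, since `G`
lives on exponents vanishing at `i` and `j`. -/
theorem lagrange_insert_insert (G : (Fin n → ℕ) → ℕ → ℚ) {L : Finset (Fin n)}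
    {i j : Fin n} (hij : i ≠ j) (hi : i ∉ L) (hj : j ∉ L)
    (hG : ∀ f s, G f s ≠ 0 → f i = 0 ∧ f j = 0) :
    (X i - X j) * lagrange G (insert i (insert j L)) =
      X j * lagrange G (insert i L) - X i * lagrange G (insert j L) := by
  ext ν
  rw [sub_mul, map_sub, map_sub, coeff_X_mul_eq, coeff_X_mul_eq, coeff_X_mul_eq, coeff_X_mul_eq]
  by_cases hL : ∀ x ∈ L, 0 < ν x
  swap
  · have h0 : ∀ (s t : Fin n) (M : Finset (Fin n)), L ⊆ M → s ∉ L →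
        coeff (ν - Finsupp.single s 1) (lagrange G M) = 0 := by
      intro s t M hM hs
      rw [coeff_lagrange, if_neg]
      intro h
      refine hL fun x hx => ?_
      have := h x (hM hx)
      rw [Finsupp.tsub_apply] at this
      omega
    rw [h0 i i _ ((subset_insert _ _).trans (subset_insert _ _)) hi,
      h0 j i _ ((subset_insert _ _).trans (subset_insert _ _)) hj,
      h0 j i _ (subset_insert _ _) hj, h0 i i _ (subset_insert _ _) hi]
    simp
  have hs : ∀ s, s ∉ L → ∀ x ∈ L, (ν - Finsupp.single s 1 : Fin n →₀ ℕ) x = ν x := by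
    intro s hs x hx
    have : s ≠ x := by rintro rfl; exact hs hx
    simp [Finsupp.single_eq_of_ne this.symm]
  have hsum : ∀ s, s ∉ L → ∑ x ∈ L, (ν - Finsupp.single s 1 : Fin n →₀ ℕ) x = ∑ x ∈ L, ν x :=
    fun s h => sum_congr rfl fun x hx => hs s h x hx
  have hi' : i ∉ insert j L := by simp [hij, hi]
  have v1 : (ν - Finsupp.single i 1 : Fin n →₀ ℕ) i = ν i - 1 := by simp
  have v2 : (ν - Finsupp.single i 1 : Fin n →₀ ℕ) j = ν j := by simp [Finsupp.single_eq_of_ne hij.symm]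
  have v3 : (ν - Finsupp.single j 1 : Fin n →₀ ℕ) i = ν i := by simp [Finsupp.single_eq_of_ne hij]
  have v4 : (ν - Finsupp.single j 1 : Fin n →₀ ℕ) j = ν j - 1 := by simp
  -- The common value of all four terms; the `- 1` is the degree taken up by the factor `X i` or `X
  -- j`.
  set Φ := G (fun x => if x ∈ insert i (insert j L) then 0 else ν x)
    (ν i + ν j + ∑ x ∈ L, ν x - 1) with hΦ
  have c1 : (if 0 < ν i then coeff (ν - Finsupp.single i 1) (lagrange G (insert i (insert j L)))
      else 0) = if 1 < ν i ∧ 0 < ν j then Φ else 0 := by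
    rw [coeff_lagrange, ← ite_and]
    refine if_ctx_congr ?_ (fun h => ?_) fun _ => rfl
    · rw [forall_mem_insert, forall_mem_insert, v1, v2]
      constructor
      · rintro ⟨-, h1, h2, -⟩; omega
      · intro h; exact ⟨by omega, by omega, h.2, fun x hx => by rw [hs i hi x hx]; exact hL x hx⟩
    · rw [hΦ]
      congr 1
      · funext x
        split_ifs with hx
        · rfl
        · have : i ≠ x := by rintro rfl; simp at hx
          simp [Finsupp.single_eq_of_ne this.symm]
      · rw [sum_insert hi', sum_insert hj, hsum i hi, v1, v2]
        omega
  have c2 : (if 0 < ν j then coeff (ν - Finsupp.single j 1) (lagrange G (insert i (insert j L)))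
      else 0) = if 0 < ν i ∧ 1 < ν j then Φ else 0 := by
    rw [coeff_lagrange, ← ite_and]
    refine if_ctx_congr ?_ (fun h => ?_) fun _ => rfl
    · rw [forall_mem_insert, forall_mem_insert, v3, v4]
      constructor
      · rintro ⟨-, h1, h2, -⟩; omega
      · intro h; exact ⟨by omega, by omega, by omega,
          fun x hx => by rw [hs j hj x hx]; exact hL x hx⟩
    · rw [hΦ]
      congr 1
      · funext x
        split_ifs with hx
        · rfl
        · have : j ≠ x := by rintro rfl; simp at hx
          simp [Finsupp.single_eq_of_ne this.symm]
      · rw [sum_insert hi', sum_insert hj, hsum j hj, v3, v4]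
        omega
  have c3 : (if 0 < ν j then coeff (ν - Finsupp.single j 1) (lagrange G (insert i L))
      else 0) = if 0 < ν i ∧ ν j = 1 then Φ else 0 := by
    rw [coeff_lagrange, ← ite_and]
    by_cases h : ν j = 1
    · refine if_ctx_congr ?_ (fun h' => ?_) fun _ => rfl
      · rw [forall_mem_insert, v3]
        constructor
        · rintro ⟨-, h1, -⟩; exact ⟨h1, h⟩
        · intro h'; exact ⟨by omega, h'.1, fun x hx => by rw [hs j hj x hx]; exact hL x hx⟩
      · rw [hΦ]
        congr 1
        · funext x
          by_cases hx : x = j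
          · subst hx; simp [h]
          · simp only [mem_insert, hx, false_or]
            split_ifs with hx'
            · rfl
            · simp [Finsupp.single_eq_of_ne hx]
        · rw [sum_insert hi, hsum j hj, v3]
          omega
    · rw [if_neg (c := 0 < ν i ∧ ν j = 1) (fun h' => h h'.2)]
      split_ifs with h'
      · by_contra hne
        have := (hG _ _ hne).2
        rw [if_neg (by simp [hij.symm, hj]), v4] at this
        omega
      · rfl
  have c4 : (if 0 < ν i then coeff (ν - Finsupp.single i 1) (lagrange G (insert j L))
      else 0) = if 0 < ν j ∧ ν i = 1 then Φ else 0 := by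
    rw [coeff_lagrange, ← ite_and]
    by_cases h : ν i = 1
    · refine if_ctx_congr ?_ (fun h' => ?_) fun _ => rfl
      · rw [forall_mem_insert, v2]
        constructor
        · rintro ⟨-, h1, -⟩; exact ⟨h1, h⟩
        · intro h'; exact ⟨by omega, h'.1, fun x hx => by rw [hs i hi x hx]; exact hL x hx⟩
      · rw [hΦ]
        congr 1
        · funext x
          by_cases hx : x = i
          · subst hx; simp [h]
          · simp only [mem_insert, hx, false_or]
            split_ifs with hx'
            · rfl
            · simp [Finsupp.single_eq_of_ne hx]
        · rw [sum_insert hj, hsum i hi, v2]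
          omega
    · rw [if_neg (c := 0 < ν j ∧ ν i = 1) (fun h' => h h'.2)]
      split_ifs with h'
      · by_contra hne
        have := (hG _ _ hne).1
        rw [if_neg (by simp [hij, hi]), v1] at this
        omega
      · rfl
  rw [c1, c2, c3, c4]
  split_ifs <;> first | omega | simp

/-- Lagrange interpolation, in which all poles cancel. Both sides obey the same recursion on `L`,
the difference `x_i - x_j` is a unit, and singletons are trivial. -/
theorem poleSum_lagrange (G : (Fin n → ℕ) → ℕ → ℚ) {L : Finset (Fin n)} (hL : L.Nonempty)
    (hG : ∀ f s, G f s ≠ 0 → ∀ i ∈ L, f i = 0) :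
    poleSum (fun k => algebraMap (MvPowerSeries (Fin n) ℚ) _ (lagrange G {k})) L =
      algebraMap (MvPowerSeries (Fin n) ℚ) _ (lagrange G L) := by
  induction L using Finset.strongInduction with
  | H L ih =>
  obtain ⟨i, hi⟩ := hL
  rcases (L.erase i).eq_empty_or_nonempty with h | ⟨j, hj⟩
  · obtain rfl : L = {i} := by rw [← insert_erase hi, h]; rfl
    simp [poleSum]
  · set L' := (L.erase i).erase j with hL'
    have h1 : L = insert i (insert j L') := by rw [hL', insert_erase hj, insert_erase hi]
    have hj' : j ∉ L' := by simp [hL']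
    have hi' : i ∉ L' := by simp [hL']
    have hij : i ≠ j := (ne_of_mem_erase hj).symm
    have s1 : insert i L' ⊂ L := by
      rw [h1, insert_comm]; exact ssubset_insert (by simp [hij.symm, hj'])
    have s2 : insert j L' ⊂ L := by
      rw [h1]; exact ssubset_insert (by simp [hij, hi'])
    refine (isUnit_polarX_sub hij).mul_left_cancel ?_
    have key := congrArg (algebraMap (MvPowerSeries (Fin n) ℚ) (PolarSeries (id : Fin n → Fin n)))
      (lagrange_insert_insert G hij hi' hj' fun f s h =>
        ⟨hG f s h i hi, hG f s h j (mem_of_mem_erase hj)⟩)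
    rw [map_mul, map_sub, map_sub, map_mul, map_mul] at key
    rw [h1, poleSum_insert_insert _ hij hi' hj', ih _ s1 ⟨i, mem_insert_self _ _⟩
      fun f s h x hx => hG f s h x (s1.1 hx), ih _ s2 ⟨j, mem_insert_self _ _⟩
      fun f s h x hx => hG f s h x (s2.1 hx)]
    exact key.symm

end Lagrange

/-! ### Diagonal operators -/

section Diagonal

open MvPowerSeries (X coeff)

/-- Multiplication of the coefficients of a series by the values of `w`. -/
def diagOp {τ : Type*} (w : (τ →₀ ℕ) → ℚ) : Module.End ℚ (MvPowerSeries τ ℚ) where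
  toFun F := fun μ => w μ * coeff μ F
  map_add' F G := by ext μ; exact mul_add _ _ _
  map_smul' c F := by ext μ; exact mul_left_comm _ _ _

theorem coeff_diagOp {τ : Type*} (w : (τ →₀ ℕ) → ℚ) (F : MvPowerSeries τ ℚ) (μ : τ →₀ ℕ) :
    coeff μ (diagOp w F) = w μ * coeff μ F := rfl

theorem euler_eq_diagOp {τ : Type*} (s : τ) (F : MvPowerSeries τ ℚ) :
    euler s F = diagOp (fun μ => (μ s : ℚ)) F := by
  ext μ
  rw [coeff_diagOp, euler, Derivation.smul_apply, smul_eq_mul, coeff_X_mul_eq]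
  split_ifs with h
  · rw [MvPowerSeries.coeff_pderiv, tsub_add_cancel_of_le (Finsupp.single_le_iff.2 h), mul_comm,
      Finsupp.tsub_apply, Finsupp.single_eq_same, Nat.cast_sub h]
    simp
  · obtain h0 : μ s = 0 := by omega
    rw [h0, Nat.cast_zero, zero_mul]

variable {τ V : Type*} [AddCommGroup V] [Module ℚ V]

/-- The operator series `T` acts on the series embedded by `ι` diagonally, with symbol `W`. -/
def ActsDiag (ι : MvPowerSeries τ ℚ →ₗ[ℚ] V) (T : PowerSeries (Module.End ℚ V))
    (W : (τ →₀ ℕ) → PowerSeries ℚ) : Prop :=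
  ∀ c F, PowerSeries.coeff c T (ι F) = ι (diagOp (fun μ => PowerSeries.coeff c (W μ)) F)

theorem ActsDiag.one (ι : MvPowerSeries τ ℚ →ₗ[ℚ] V) : ActsDiag ι 1 fun _ => 1 := by
  intro c F
  rw [PowerSeries.coeff_one]
  have : diagOp (fun _ => PowerSeries.coeff c 1) F = (if c = 0 then (1 : ℚ) else 0) • F := by
    ext μ
    rw [coeff_diagOp, PowerSeries.coeff_one]
    rfl
  rw [this, map_smul]
  split_ifs <;> simp

theorem ActsDiag.mul {ι : MvPowerSeries τ ℚ →ₗ[ℚ] V} {T T' : PowerSeries (Module.End ℚ V)}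
    {W W' : (τ →₀ ℕ) → PowerSeries ℚ} (h : ActsDiag ι T W) (h' : ActsDiag ι T' W') :
    ActsDiag ι (T * T') fun μ => W μ * W' μ := by
  intro c F
  rw [PowerSeries.coeff_mul, LinearMap.sum_apply]
  have : diagOp (fun μ => PowerSeries.coeff c (W μ * W' μ)) F =
      ∑ x ∈ antidiagonal c, diagOp (fun μ => PowerSeries.coeff x.1 (W μ))
        (diagOp (fun μ => PowerSeries.coeff x.2 (W' μ)) F) := by
    ext μ
    rw [coeff_diagOp, map_sum, PowerSeries.coeff_mul, sum_mul]
    exact sum_congr rfl fun x _ => by rw [coeff_diagOp, coeff_diagOp, mul_assoc]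
  rw [this, map_sum]
  refine sum_congr rfl fun x _ => ?_
  rw [Module.End.mul_apply, h', h]

theorem ActsDiag.list_prod {α : Type*} {ι : MvPowerSeries τ ℚ →ₗ[ℚ] V}
    {T : α → PowerSeries (Module.End ℚ V)} {W : α → (τ →₀ ℕ) → PowerSeries ℚ} (l : List α)
    (h : ∀ x ∈ l, ActsDiag ι (T x) (W x)) :
    ActsDiag ι (l.map T).prod fun μ => (l.map fun x => W x μ).prod := by
  induction l with
  | nil => exact ActsDiag.one ι
  | cons x l ih =>
    simp only [List.map_cons, List.prod_cons]
    exact (h x List.mem_cons_self).mul (ih fun y hy => h y (List.mem_cons_of_mem _ hy))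

theorem ActsDiag.map_algebraMap (ι : MvPowerSeries τ ℚ →ₗ[ℚ] V) (f : PowerSeries ℚ) :
    ActsDiag ι (PowerSeries.map (algebraMap ℚ (Module.End ℚ V)) f) fun _ => f := by
  intro c F
  rw [PowerSeries.coeff_map, Module.algebraMap_end_apply, ← map_smul]
  rfl

theorem pow_apply_of_intertwines {ι : MvPowerSeries τ ℚ →ₗ[ℚ] V} {D : Module.End ℚ V} {s : τ}
    (h : ∀ F, D (ι F) = ι (euler s F)) (j : ℕ) (F : MvPowerSeries τ ℚ) :
    (D ^ j) (ι F) = ι (diagOp (fun μ => (μ s : ℚ) ^ j) F) := by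
  induction j generalizing F with
  | zero =>
    rw [pow_zero, Module.End.one_apply]
    congr 1
    ext μ
    rw [coeff_diagOp, pow_zero, one_mul]
  | succ j ih =>
    rw [pow_succ, Module.End.mul_apply, h, ih, euler_eq_diagOp]
    congr 1
    ext μ
    rw [coeff_diagOp, coeff_diagOp, coeff_diagOp, pow_succ, mul_assoc]

theorem ActsDiag.zetaOverZD {ι : MvPowerSeries τ ℚ →ₗ[ℚ] V} {D : Module.End ℚ V} {s : τ}
    (h : ∀ F, D (ι F) = ι (euler s F)) :
    ActsDiag ι (zetaOverZD D) fun μ => zetaScaledOverAZ (μ s) := by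
  intro c F
  rw [SpinHurwitz.zetaOverZD, PowerSeries.coeff_mk, LinearMap.smul_apply,
    pow_apply_of_intertwines h, ← map_smul]
  congr 1
  ext μ
  rw [MvPowerSeries.coeff_smul, coeff_diagOp, coeff_diagOp]
  simp only [zetaScaledOverAZ, PowerSeries.coeff_mk, mul_assoc]

theorem ActsDiag.zetaDOverZ {ι : MvPowerSeries τ ℚ →ₗ[ℚ] V} {D : Module.End ℚ V} {s : τ}
    (h : ∀ F, D (ι F) = ι (euler s F)) :
    ActsDiag ι (zetaDOverZ D) fun μ => zetaScaledOverZ (μ s) := by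
  intro c F
  rw [SpinHurwitz.zetaDOverZ, PowerSeries.coeff_mk, LinearMap.smul_apply,
    pow_apply_of_intertwines h, ← map_smul]
  congr 1
  ext μ
  rw [MvPowerSeries.coeff_smul, coeff_diagOp, coeff_diagOp]
  simp only [zetaScaledOverZ, PowerSeries.coeff_mk, mul_assoc]

end Diagonal

/-! ### The action of the operators `Q` -/

section Qaction

open MvPowerSeries (X coeff)

variable {n m : ℕ}

theorem polarEuler_algebraMap {τ : Type*} (v : Fin n → τ) (s : τ) (F : MvPowerSeries τ ℚ) :
    polarEuler v s (algebraMap _ _ F) = algebraMap _ _ (euler s F) :=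
  extendDerivation_algebraMap _ _ _

theorem polarEuler_mul {τ : Type*} (v : Fin n → τ) (s : τ) (f g : PolarSeries v) :
    polarEuler v s (f * g) = f * polarEuler v s g + g * polarEuler v s f :=
  Derivation.leibniz (extendDerivation (diagMonoid v) (euler s)) f g

theorem euler_X_of_ne {τ : Type*} {s t : τ} (h : t ≠ s) :
    euler s (X t : MvPowerSeries τ ℚ) = 0 := by
  classical
  ext μ
  rw [euler_eq_diagOp, coeff_diagOp, MvPowerSeries.coeff_X, map_zero]
  split_ifs with h'
  · rw [h', Finsupp.single_eq_of_ne h.symm]; simp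
  · rw [mul_zero]

/-- The factor does not involve `ξ_j`: differentiate its defining relation and cancel the unit `x_k
- x_i`. -/
theorem polarEuler_polarFactor {k i : Fin n} (h : i ≠ k) (j : Fin m) :
    polarEuler (Sum.inl : Fin n → Fin n ⊕ Fin m) (Sum.inr j) (polarFactor Sum.inl k i) = 0 := by
  have h1 := congrArg (polarEuler (Sum.inl : Fin n → Fin n ⊕ Fin m) (Sum.inr j))
    (polarFactor_mul (Sum.inl : Fin n → Fin n ⊕ Fin m) h)
  rw [polarEuler_mul, polarEuler_algebraMap, polarEuler_algebraMap, map_sub,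
    euler_X_of_ne Sum.inl_ne_inr, euler_X_of_ne Sum.inl_ne_inr, sub_zero, map_zero, mul_zero,
    zero_add] at h1
  have hu : IsUnit (algebraMap (MvPowerSeries (Fin n ⊕ Fin m) ℚ)
      (PolarSeries (Sum.inl : Fin n → Fin n ⊕ Fin m)) (X (Sum.inl k) - X (Sum.inl i))) :=
    IsLocalization.map_units (PolarSeries (Sum.inl : Fin n → Fin n ⊕ Fin m))
      (⟨_, Submonoid.subset_closure ⟨k, i, h.symm, rfl⟩⟩ :
        diagMonoid (Sum.inl : Fin n → Fin n ⊕ Fin m))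
  exact hu.mul_right_eq_zero.1 h1

theorem polarEuler_prod_polarFactor {k : Fin n} {K : Finset (Fin n)} (h : k ∉ K) (j : Fin m) :
    polarEuler (Sum.inl : Fin n → Fin n ⊕ Fin m) (Sum.inr j)
      (∏ i ∈ K, polarFactor Sum.inl k i) = 0 := by
  refine prod_induction (fun i => polarFactor Sum.inl k i)
    (fun f => polarEuler (Sum.inl : Fin n → Fin n ⊕ Fin m) (Sum.inr j) f = 0) ?_ ?_ ?_
  · intro f g hf hg
    rw [polarEuler_mul, hf, hg, mul_zero, mul_zero, add_zero]
  · rw [← map_one (algebraMap (MvPowerSeries (Fin n ⊕ Fin m) ℚ) _), polarEuler_algebraMap,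
      Derivation.map_one_eq_zero, map_zero]
  · intro i hi
    exact polarEuler_polarFactor (by rintro rfl; exact h hi) j

/-- Multiplication of a power series by a series with poles. -/
def mulPolar {τ : Type*} {v : Fin n → τ} (p : PolarSeries v) :
    MvPowerSeries τ ℚ →ₗ[ℚ] PolarSeries v :=
  LinearMap.mulLeft ℚ p ∘ₗ (IsScalarTower.toAlgHom ℚ (MvPowerSeries τ ℚ) _).toLinearMap

theorem mulPolar_apply {τ : Type*} {v : Fin n → τ} (p : PolarSeries v) (F : MvPowerSeries τ ℚ) :
    mulPolar p F = p * algebraMap _ _ F := rfl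

theorem actsDiag_innerSeries {k : Fin n} {K : Finset (Fin n)} (h : k ∉ K) :
    ActsDiag (mulPolar (∏ i ∈ K, polarFactor (Sum.inl : Fin n → Fin n ⊕ Fin m) k i))
      (innerSeries n m) fun μ => ∏ j, zetaScaledOverZ (μ (Sum.inr j)) := by
  have := ActsDiag.list_prod (List.finRange m) (T := fun j =>
    zetaDOverZ (polarEuler (Sum.inl : Fin n → Fin n ⊕ Fin m) (Sum.inr j)))
    (ι := mulPolar (∏ i ∈ K, polarFactor (Sum.inl : Fin n → Fin n ⊕ Fin m) k i)) fun j _ =>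
    ActsDiag.zetaDOverZ (s := Sum.inr j) fun F => by
      rw [mulPolar_apply, mulPolar_apply, polarEuler_mul, polarEuler_algebraMap,
        polarEuler_prod_polarFactor h, mul_zero, add_zero]
  simp only [← List.ofFn_eq_map, List.prod_ofFn] at this
  rw [innerSeries, ← List.ofFn_eq_map]
  exact this

/-- Diagonality is asserted only on genuine power series, since `D_{x_i}` also differentiates the
polar factors. The sum over `k` has to be taken before this is used. -/
theorem actsDiag_outerSeries (L : Finset (Fin n)) :
    ActsDiag (mulPolar (1 : PolarSeries (id : Fin n → Fin n))) (outerSeries L)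
      fun μ => zetaOverZ⁻¹ * ∏ i ∈ L, zetaScaledOverAZ (μ i) := by
  refine (ActsDiag.map_algebraMap _ _).mul ?_
  have := ActsDiag.list_prod L.sort (T := fun i =>
    zetaOverZD (polarEuler (id : Fin n → Fin n) i))
    (ι := mulPolar (1 : PolarSeries (id : Fin n → Fin n))) fun j _ =>
    ActsDiag.zetaOverZD (s := j) fun F => by
      rw [mulPolar_apply, mulPolar_apply, one_mul, polarEuler_algebraMap, one_mul]
  convert this using 2 with μ
  rw [← Multiset.prod_coe, ← Multiset.map_coe, sort_eq]
  rfl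

theorem specialize_algebraMap (k : Fin n) (F : MvPowerSeries (Fin n ⊕ Fin m) ℚ) :
    specialize (m := m) k (algebraMap _ _ F) =
      algebraMap _ _ (MvPowerSeries.rename (mergeVar (m := m) k) F) :=
  IsLocalization.map_eq (diagMonoid_le_comap (m := m) k) F

theorem specialize_polarFactor {k i : Fin n} (h : i ≠ k) :
    specialize (m := m) k (polarFactor Sum.inl k i) = polarFactor id k i := by
  have h1 := congrArg (specialize (m := m) k)
    (polarFactor_mul (Sum.inl : Fin n → Fin n ⊕ Fin m) h)
  rw [map_mul, specialize_algebraMap, specialize_algebraMap, map_sub, MvPowerSeries.rename_X,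
    MvPowerSeries.rename_X, map_sub] at h1
  refine (isUnit_polarX_sub h.symm).mul_right_cancel (h1.trans ?_)
  exact (polarFactor_mul_sub h).symm

/-- The sums of the coefficients of `F` over the exponents of `ξ_1, …, ξ_m` with a given sum. -/
def fiberSum (F : MvPowerSeries (Fin n ⊕ Fin m) ℚ) (f : Fin n → ℕ) (s : ℕ) : ℚ :=
  ∑ a ∈ tuples m s, coeff (Finsupp.equivFunOnFinite.symm (Sum.elim f a)) F

/-- Setting `ξ_j = x_k` adds exponents, and `F` itself contains no `x_k`. That some `ξ_j` always
occurs matches the positivity condition in `lagrange`. -/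
theorem rename_eq_lagrange (k : Fin n) (F : MvPowerSeries (Fin n ⊕ Fin m) ℚ)
    (hF : ∀ μ, coeff μ F ≠ 0 → μ (Sum.inl k) = 0 ∧ ∃ j, 0 < μ (Sum.inr j)) :
    MvPowerSeries.rename (mergeVar (m := m) k) F = lagrange (fiberSum F) {k} := by
  ext ν
  rw [MvPowerSeries.coeff_rename, coeff_lagrange]
  simp only [mem_singleton, forall_eq, sum_singleton]
  have hmd : ∀ (μ : Fin n ⊕ Fin m →₀ ℕ) (i : Fin n), Finsupp.mapDomain (mergeVar k) μ i =
      μ (Sum.inl i) + if i = k then ∑ j, μ (Sum.inr j) else 0 := by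
    intro μ i
    rw [Finsupp.mapDomain, Finsupp.sum_fintype _ _ (by simp), Finsupp.finsetSum_apply,
      Fintype.sum_sum_type]
    congr 1
    · simp [mergeVar, Finsupp.single_apply]
    · split_ifs with h
      · simp [mergeVar, h]
      · simp [mergeVar, Ne.symm h]
  have hrhs : (if 0 < ν k then fiberSum F (fun i => if i = k then 0 else ν i) (ν k) else 0) =
      fiberSum F (fun i => if i = k then 0 else ν i) (ν k) := by
    split_ifs with h
    · rfl
    · symm
      refine sum_eq_zero fun a ha => ?_
      rw [mem_tuples] at ha
      by_contra hne
      obtain ⟨j, hj⟩ := (hF _ hne).2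
      simp only [Finsupp.equivFunOnFinite_symm_apply_apply, Sum.elim_inr] at hj
      have := single_le_sum (f := a) (fun _ _ => Nat.zero_le _) (mem_univ j)
      omega
  rw [hrhs, fiberSum]
  symm
  refine sum_bij_ne_zero
    (fun a _ _ => Finsupp.equivFunOnFinite.symm (Sum.elim (fun i => if i = k then 0 else ν i) a))
    ?_ ?_ ?_ ?_
  · intro a ha _
    rw [mem_tuples] at ha
    rw [Set.Finite.mem_toFinset, Set.mem_preimage, Set.mem_singleton_iff]
    ext i
    rw [hmd]
    simp only [Finsupp.equivFunOnFinite_symm_apply_apply, Sum.elim_inl, Sum.elim_inr, ha]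
    split_ifs with h
    · rw [h, zero_add]
    · rw [add_zero]
  · intro a _ _ a' _ _ h
    have := Finsupp.equivFunOnFinite.symm.injective h
    funext j
    exact congrFun this (Sum.inr j)
  · intro μ hμ hne
    rw [Set.Finite.mem_toFinset, Set.mem_preimage, Set.mem_singleton_iff] at hμ
    have hk := (hF μ hne).1
    have e : Finsupp.equivFunOnFinite.symm (Sum.elim (fun i => if i = k then 0 else ν i)
        fun j => μ (Sum.inr j)) = μ := by
      ext (i | j)
      · simp only [Finsupp.equivFunOnFinite_symm_apply_apply, Sum.elim_inl]
        split_ifs with h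
        · rw [h, hk]
        · rw [← hμ, hmd, if_neg h, add_zero]
      · rfl
    refine ⟨fun j => μ (Sum.inr j), ?_, ?_, e⟩
    · rw [mem_tuples, ← hμ, hmd, hk, if_pos rfl, zero_add]
    · rwa [e]
  · intros; rfl

/-- The operators `Q^{(k)}_{d;K₀,m}`, summed over the elements `k` of `L = K₀ ∪ {k}`. -/
theorem sum_Qop (d : ℕ) {L : Finset (Fin n)} (hL : L.Nonempty)
    (F : MvPowerSeries (Fin n ⊕ Fin m) ℚ)
    (hF : ∀ μ, coeff μ F ≠ 0 → (∀ i ∈ L, μ (Sum.inl i) = 0) ∧ ∃ j, 0 < μ (Sum.inr j)) :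
    ∃ P : MvPowerSeries (Fin n) ℚ, (∑ k ∈ L, Qop k d (L.erase k) m
      ((∏ i ∈ L.erase k, polarFactor Sum.inl k i) * algebraMap _ _ F) = algebraMap _ _ P) ∧
      ∀ ν : Fin n →₀ ℕ, coeff ν P = if ∀ i ∈ L, 0 < ν i then
        ∑ a ∈ tuples m (∑ i ∈ L, ν i), PowerSeries.coeff (2 * d) (linkSymbol L ν a) *
          coeff (Finsupp.equivFunOnFinite.symm
            (Sum.elim (fun i => if i ∈ L then 0 else ν i) a)) F else 0 := by
  set G : ℕ → MvPowerSeries (Fin n ⊕ Fin m) ℚ := fun c =>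
    diagOp (fun μ => PowerSeries.coeff c (∏ j, zetaScaledOverZ (μ (Sum.inr j)))) F with hG
  have hGF : ∀ c μ, coeff μ (G c) ≠ 0 → (∀ i ∈ L, μ (Sum.inl i) = 0) ∧ ∃ j, 0 < μ (Sum.inr j) := by
    intro c μ h
    rw [hG, coeff_diagOp] at h
    exact hF μ (right_ne_zero_of_mul h)
  -- The inner operators pass the polar factors, which are constant in `ξ`. The outer operator
  -- depends only on `L = K₀ ∪ {k}`, so the sum over `k` can be moved inside it.
  have h1 : ∀ k ∈ L, Qop k d (L.erase k) m
      ((∏ i ∈ L.erase k, polarFactor Sum.inl k i) * algebraMap _ _ F) =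
      ∑ x ∈ antidiagonal (2 * d), PowerSeries.coeff x.1 (outerSeries L)
        ((∏ i ∈ L.erase k, polarFactor id k i) *
          algebraMap _ _ (lagrange (fiberSum (G x.2)) {k})) := by
    intro k hk
    rw [Qop, LinearMap.sum_apply, insert_erase hk]
    refine sum_congr rfl fun x _ => ?_
    rw [LinearMap.comp_apply, LinearMap.comp_apply, ← mulPolar_apply,
      actsDiag_innerSeries (notMem_erase k L), mulPolar_apply]
    congr 1
    rw [AlgHom.toLinearMap_apply, map_mul, map_prod, specialize_algebraMap,
      rename_eq_lagrange k _ fun μ h => ⟨(hGF x.2 μ h).1 k hk, (hGF x.2 μ h).2⟩]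
    congr 1
    exact prod_congr rfl fun i hi => specialize_polarFactor (ne_of_mem_erase hi)
  refine ⟨∑ x ∈ antidiagonal (2 * d), diagOp (fun μ => PowerSeries.coeff x.1
    (zetaOverZ⁻¹ * ∏ i ∈ L, zetaScaledOverAZ (μ i))) (lagrange (fiberSum (G x.2)) L), ?_, ?_⟩
  · rw [sum_congr rfl h1, sum_comm, map_sum]
    refine sum_congr rfl fun x _ => ?_
    rw [← map_sum]
    have h2 := poleSum_lagrange (fiberSum (G x.2)) hL ?_
    · rw [poleSum] at h2
      rw [h2]
      have h3 := actsDiag_outerSeries L x.1 (lagrange (fiberSum (G x.2)) L)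
      rw [mulPolar_apply, mulPolar_apply, one_mul, one_mul] at h3
      exact h3
    · intro f s h i hi
      obtain ⟨a, -, ha⟩ := exists_ne_zero_of_sum_ne_zero h
      exact (hGF _ _ ha).1 i hi
  · intro ν
    simp only [map_sum, coeff_diagOp, coeff_lagrange]
    split_ifs with h
    · simp only [fiberSum, mul_sum]
      rw [sum_comm]
      refine sum_congr rfl fun a _ => ?_
      rw [linkSymbol, PowerSeries.coeff_mul, sum_mul]
      refine sum_congr rfl fun x _ => ?_
      rw [hG, coeff_diagOp, mul_assoc]
      rfl
    · simp
end Qaction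

/-! ### Products of correlators -/

section Correlators

open MvPowerSeries (coeff)

theorem connSeries_congr {σ : Type*} [DecidableEq σ] (r q : ℕ) {B : Finset σ} {ν ν' : σ → ℕ}
    (h : ∀ i ∈ B, ν i = ν' i) : connSeries r q B ν = connSeries r q B ν' := by
  refine sum_congr rfl fun P _ => ?_
  congr 1
  refine prod_congr rfl fun C hC => ?_
  congr 2
  exact Multiset.map_congr rfl fun i hi => h i (P.le hC hi)

theorem IsGenus.congr {σ : Type*} {r q : ℕ} {B : Finset σ} {ν ν' : σ → ℕ} {b g : ℕ}
    (h : IsGenus r q B ν b g) (h' : ∀ i ∈ B, ν i = ν' i) : IsGenus r q B ν' b g := by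
  rw [IsGenus] at h ⊢
  rw [h]
  congr 1
  exact sum_congr rfl fun i hi => by rw [h' i hi]

variable {σ : Type*} [DecidableEq σ]

theorem coeff_correlator_of_isGenus {r q g b : ℕ} (hr : 0 < r) (hq : 0 < q) {B : Finset σ}
    {κ : σ →₀ ℕ} (hκ : κ.support = B) (h : IsGenus r q B κ b g) :
    coeff κ (correlator r q g B) = PowerSeries.coeff b (connSeries r q B κ) := by
  change correlator r q g B κ = _
  have hqr : (q : ℤ) * r ≠ 0 := by positivity
  have hN : (2 * (g : ℤ) - 2 + #B) * q + ∑ i ∈ B, (κ i : ℤ) = (b : ℤ) * ((q : ℤ) * r) := by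
    rw [← h, mul_comm (r : ℤ)]
  rw [correlator]
  simp only [hN, Int.mul_ediv_cancel _ hqr, Int.toNat_natCast]
  rw [if_pos ⟨hκ, by positivity, dvd_mul_left _ _⟩, connHurwitz, mul_div_assoc, mul_comm,
    div_mul_cancel₀ _ (by positivity)]

theorem of_coeff_correlator_ne_zero {r q g : ℕ} (hr : 0 < r) (hq : 0 < q) {B : Finset σ}
    {κ : σ →₀ ℕ} (h : coeff κ (correlator r q g B) ≠ 0) :
    κ.support = B ∧ ∃ b, IsGenus r q B κ b g := by
  change correlator r q g B κ ≠ 0 at h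
  rw [correlator] at h
  simp only [ne_eq, ite_eq_right_iff, Classical.not_imp] at h
  obtain ⟨⟨h1, h2, c, hc⟩, -⟩ := h
  refine ⟨h1, c.toNat, ?_⟩
  have hqr : 0 < (q : ℤ) * r := by positivity
  have hc0 : 0 ≤ c := by
    rw [hc] at h2
    exact nonneg_of_mul_nonneg_right h2 hqr
  rw [IsGenus, hc, Int.toNat_of_nonneg hc0]
  ring

/-- The factors involve disjoint sets of variables, so an exponent can be distributed among them in
only one way. -/
theorem coeff_prod_of_isSplitting {τ : Type*} [DecidableEq τ] {l : ℕ} {A : Fin l → Finset τ}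
    {S : Finset τ} (hA : IsSplitting A S) (F : Fin l → MvPowerSeries τ ℚ)
    (hF : ∀ j κ, coeff κ (F j) ≠ 0 → κ.support ⊆ A j) (μ : τ →₀ ℕ) (hμ : μ.support ⊆ S) :
    coeff μ (∏ j, F j) = ∏ j, coeff (μ.filter (· ∈ A j)) (F j) := by
  rw [isSplitting_iff] at hA
  rw [MvPowerSeries.coeff_prod]
  rw [sum_eq_single (Finsupp.equivFunOnFinite.symm fun j => μ.filter (· ∈ A j))]
  · rfl
  · intro κ hκ hne
    by_contra h
    refine hne ?_
    rw [mem_finsuppAntidiag] at hκ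
    have hs : ∀ j x, x ∉ A j → κ j x = 0 := by
      intro j x hx
      have := hF j _ (prod_ne_zero_iff.1 h j (mem_univ j))
      by_contra h0
      exact hx (this (Finsupp.mem_support_iff.2 h0))
    ext j x
    rw [Finsupp.equivFunOnFinite_symm_apply_apply, Finsupp.filter_apply]
    split_ifs with hx
    · rw [← hκ.1, Finsupp.finsetSum_apply, sum_eq_single j]
      · intro i _ hij
        refine hs i x fun hx' => hij ?_
        exact (hA.2 x (hA.1 j hx)).unique hx' hx
      · simp
    · exact hs j x hx
  · intro h
    refine absurd ?_ h
    rw [mem_finsuppAntidiag]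
    refine ⟨?_, subset_univ _⟩
    ext x
    simp only [Finsupp.finsetSum_apply, Finsupp.equivFunOnFinite_symm_apply_apply,
      Finsupp.filter_apply]
    by_cases hx : x ∈ S
    · obtain ⟨j, hj, hj'⟩ := hA.2 x hx
      rw [sum_eq_single j, if_pos hj]
      · intro i _ hij
        exact if_neg fun h' => hij (hj' i h')
      · simp
    · have h0 : μ x = 0 := by
        by_contra h0
        exact hx (hμ (Finsupp.mem_support_iff.2 h0))
      simp [h0]

theorem support_of_coeff_prod_ne_zero {τ : Type*} [DecidableEq τ] {l : ℕ} {A : Fin l → Finset τ}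
    {S : Finset τ} (hA : IsSplitting A S) (F : Fin l → MvPowerSeries τ ℚ)
    (hF : ∀ j κ, coeff κ (F j) ≠ 0 → κ.support = A j) {μ : τ →₀ ℕ}
    (h : coeff μ (∏ j, F j) ≠ 0) : μ.support = S := by
  rw [MvPowerSeries.coeff_prod] at h
  obtain ⟨κ, hκ, h⟩ := exists_ne_zero_of_sum_ne_zero h
  rw [mem_finsuppAntidiag] at hκ
  have hs : ∀ j, (κ j).support = A j := fun j => hF j _ (prod_ne_zero_iff.1 h j (mem_univ j))
  ext x
  rw [← hA.2, Finsupp.mem_support_iff, ← hκ.1, Finsupp.finsetSum_apply, mem_biUnion, ne_eq,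
    sum_eq_zero_iff]
  simp only [← hs, Finsupp.mem_support_iff, not_forall, exists_prop]

variable {n m l : ℕ}

/-- The exponents of a monomial in the variables outside `L` and `ξ_1, …, ξ_m`. -/
def offExponent (L : Finset (Fin n)) (ν : Fin n → ℕ) (a : Fin m → ℕ) : Fin n ⊕ Fin m →₀ ℕ :=
  Finsupp.equivFunOnFinite.symm (Sum.elim (fun i => if i ∈ L then 0 else ν i) a)

/-- The product of the correlators of the components. -/
def corrProd (r q : ℕ) (K : Fin l → Finset (Fin n)) (N : Fin l → Finset (Fin m))
    (γ : Fin l → ℕ) : MvPowerSeries (Fin n ⊕ Fin m) ℚ :=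
  ∏ j, correlator r q (γ j) ((K j).disjSum (N j))

theorem IsSplitting.disjSum {L : Finset (Fin n)} {K : Fin l → Finset (Fin n)}
    {N : Fin l → Finset (Fin m)} (hK : IsSplitting K L) (hN : IsSplitting N univ) :
    IsSplitting (fun j => (K j).disjSum (N j)) (L.disjSum univ) := by
  rw [isSplitting_disjSum]
  simp only [toLeft_disjSum, toRight_disjSum]
  exact ⟨hK, hN⟩

/-! ### Products of correlators for a fixed splitting into components -/

section Components

variable {r q : ℕ} {L : Finset (Fin n)} {K : Fin l → Finset (Fin n)}
  {N : Fin l → Finset (Fin m)}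

theorem support_of_coeff_corrProd_ne_zero (hr : 0 < r) (hq : 0 < q) {γ : Fin l → ℕ}
    (hK : IsSplitting K (univ \ L)) (hN : IsSplitting N univ) {μ : Fin n ⊕ Fin m →₀ ℕ}
    (h : coeff μ (corrProd r q K N γ) ≠ 0) : μ.support = (univ \ L).disjSum univ :=
  support_of_coeff_prod_ne_zero (hK.disjSum hN) _
    (fun _ _ h => (of_coeff_correlator_ne_zero hr hq h).1) h

variable {ν : Fin n → ℕ} {a : Fin m → ℕ}

theorem offExponent_apply (hK : IsSplitting K (univ \ L)) (j : Fin l) :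
    ∀ x ∈ (K j).disjSum (N j), (offExponent L ν a).filter (· ∈ (K j).disjSum (N j)) x =
      Sum.elim ν a x := by
  intro x hx
  rw [Finsupp.filter_apply, if_pos hx, offExponent, Finsupp.equivFunOnFinite_symm_apply_apply]
  rcases x with i | i
  · have := (isSplitting_iff.1 hK).1 j (inl_mem_disjSum.1 hx)
    exact if_neg (mem_sdiff.1 this).2
  · rfl

theorem coeff_offExponent_corrProd (hr : 0 < r) (hq : 0 < q) {γ : Fin l → ℕ}
    (hK : IsSplitting K (univ \ L)) (hN : IsSplitting N univ) :
    coeff (offExponent L ν a) (corrProd r q K N γ) =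
      ∏ j, coeff ((offExponent L ν a).filter (· ∈ (K j).disjSum (N j)))
        (correlator r q (γ j) ((K j).disjSum (N j))) := by
  refine coeff_prod_of_isSplitting (hK.disjSum hN) _
    (fun _ _ h => (of_coeff_correlator_ne_zero hr hq h).1.subset) _ ?_
  rintro (i | i) hi
  · rw [inl_mem_disjSum, mem_sdiff]
    refine ⟨mem_univ i, fun h => ?_⟩
    rw [Finsupp.mem_support_iff] at hi
    exact hi (if_pos h)
  · exact inr_mem_disjSum.2 (mem_univ i)

theorem exists_isGenus_of_coeff_corrProd_ne_zero (hr : 0 < r) (hq : 0 < q) {γ : Fin l → ℕ}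
    (hK : IsSplitting K (univ \ L)) (hN : IsSplitting N univ)
    (h : coeff (offExponent L ν a) (corrProd r q K N γ) ≠ 0) :
    ∃ β : Fin l → ℕ, ∀ j, IsGenus r q ((K j).disjSum (N j)) (Sum.elim ν a) (β j) (γ j) := by
  rw [coeff_offExponent_corrProd hr hq hK hN] at h
  have h' : ∀ j, ∃ b, IsGenus r q ((K j).disjSum (N j)) (Sum.elim ν a) b (γ j) := by
    intro j
    obtain ⟨b, hb⟩ := (of_coeff_correlator_ne_zero hr hq
      (prod_ne_zero_iff.1 h j (mem_univ j))).2
    exact ⟨b, hb.congr (offExponent_apply hK j)⟩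
  choose β hβ using h'
  exact ⟨β, hβ⟩

theorem coeff_corrProd_of_isGenus (hr : 0 < r) (hq : 0 < q) {β γ : Fin l → ℕ}
    (hK : IsSplitting K (univ \ L)) (hN : IsSplitting N univ) (hν : ∀ i, 0 < ν i)
    (ha : ∀ j, 0 < a j)
    (h : ∀ j, IsGenus r q ((K j).disjSum (N j)) (Sum.elim ν a) (β j) (γ j)) :
    coeff (offExponent L ν a) (corrProd r q K N γ) =
      ∏ j, PowerSeries.coeff (β j) (connSeries r q ((K j).disjSum (N j)) (Sum.elim ν a)) := by
  rw [coeff_offExponent_corrProd hr hq hK hN]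
  refine prod_congr rfl fun j _ => ?_
  have e := offExponent_apply (N := N) (ν := ν) (a := a) hK j
  rw [coeff_correlator_of_isGenus hr hq ?_ ((h j).congr fun x hx => (e x hx).symm),
    connSeries_congr r q e]
  ext x
  rw [Finsupp.mem_support_iff]
  constructor
  · intro hx
    by_contra hne
    exact hx (Finsupp.filter_apply_neg _ _ hne)
  · intro hx
    rw [e x hx]
    rcases x with i | i
    · exact (hν i).ne'
    · exact (ha i).ne'

/-- The sum over the genera of the components is a sum over the numbers of completed cycles. -/
theorem sum_coeff_corrProd (hr : 0 < r) (hq : 0 < q) {d b g : ℕ}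
    (hK : IsSplitting K (univ \ L)) (hN : IsSplitting N univ) (hN' : ∀ j, (N j).Nonempty)
    (hν : ∀ i, 0 < ν i) (ha : ∀ j, 0 < a j) (hsum : ∑ j, a j = ∑ i ∈ L, ν i)
    (hd : #L + m + 2 * d = r + 2) (hb : IsGenus r q univ ν (b + 1) g) :
    ∑ γ : Fin l → Fin (g + 1) with
        (g : ℤ) = ∑ j, ((γ j : ℕ) : ℤ) + (m : ℤ) - (l : ℤ) + (d : ℤ),
      coeff (offExponent L ν a) (corrProd r q K N fun j => (γ j : ℕ)) =
    PowerSeries.coeff b (∏ j, connSeries r q ((K j).disjSum (N j)) (Sum.elim ν a)) := by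
  have hr' : (r : ℤ) ≠ 0 := by positivity
  have hq' : (q : ℤ) ≠ 0 := by positivity
  rw [IsGenus] at hb
  have hl := hN.le_card hN'
  rw [card_univ, Fintype.card_fin] at hl
  rw [PowerSeries.coeff_prod]
  have hex : ∀ γ : Fin l → Fin (g + 1),
      coeff (offExponent L ν a) (corrProd r q K N fun j => (γ j : ℕ)) ≠ 0 →
      ∃ β : Fin l → ℕ, ∀ j, IsGenus r q ((K j).disjSum (N j)) (Sum.elim ν a) (β j) (γ j) :=
    fun γ h => exists_isGenus_of_coeff_corrProd_ne_zero hr hq hK hN h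
  have hrel := fun {β γ : Fin l → ℕ} => genus_relation (β := β) (γ := γ) (r := r) (q := q)
    (subset_univ L) hK hN hsum hd
  -- For given parts, Riemann–Hurwitz determines cycle numbers from genera and conversely. The
  -- bijection is restricted to nonzero terms, for which both are non-negative integers.
  refine sum_bij_ne_zero (fun γ _ h => Finsupp.equivFunOnFinite.symm (hex γ h).choose) ?_ ?_ ?_ ?_
  · intro γ hγ h
    have hβ := hrel (hex γ h).choose_spec
    set β := (hex γ h).choose
    rw [mem_filter] at hγ
    rw [mem_finsuppAntidiag]
    refine ⟨?_, subset_univ _⟩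
    rw [← hγ.2, ← hb] at hβ
    have := mul_right_cancel₀ (mul_ne_zero hr' hq') hβ
    push_cast at this
    exact_mod_cast add_right_cancel this
  · intro γ hγ h γ' hγ' h' e
    have e' := Finsupp.equivFunOnFinite.symm.injective e
    have hβ := (hex γ h).choose_spec
    have hβ' := (hex γ' h').choose_spec
    rw [← e'] at hβ'
    funext j
    have h1 := hβ j
    have h2 := hβ' j
    rw [IsGenus] at h1 h2
    rw [h1] at h2
    have h3 := mul_right_cancel₀ hq' (add_right_cancel h2)
    exact Fin.ext (by omega)
  · intro β hβ h
    rw [mem_finsuppAntidiag] at hβ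
    -- Surjectivity: a nonzero connected coefficient has a genus, and the total genus relation then
    -- places it in the index set.
    have hg : ∀ j, ∃ g, IsGenus r q ((K j).disjSum (N j)) (Sum.elim ν a) (β j) g := by
      intro j
      refine exists_isGenus hq (β j) (Sum.elim ν a) ?_ _ ?_ ?_
      · rintro (i | i)
        · exact hν i
        · exact ha i
      · obtain ⟨x, hx⟩ := hN' j
        exact ⟨Sum.inr x, inr_mem_disjSum.2 hx⟩
      · exact prod_ne_zero_iff.1 h j (mem_univ j)
    choose γ hγ using hg
    have h1 := hrel hγ
    have h2 : ∑ j, (β j : ℤ) = b := by exact_mod_cast hβ.1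
    rw [h2] at h1
    push_cast at hb
    rw [hb] at h1
    have h3 := mul_right_cancel₀ hq' (add_right_cancel h1)
    have h4 : (g : ℤ) = ∑ j, (γ j : ℤ) + m - l + d := by omega
    -- Here `l ≤ m` and `0 ≤ d` bound each component genus by `g`, so the range `Fin (g + 1)` is
    -- large enough.
    have h5 : ∀ j, γ j < g + 1 := by
      intro j
      have h6 : γ j ≤ ∑ j, γ j := single_le_sum (f := γ) (fun _ _ => Nat.zero_le _) (mem_univ j)
      have h7 : ((∑ j, γ j : ℕ) : ℤ) = ∑ j, (γ j : ℤ) := by push_cast; rfl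
      omega
    have h8 := coeff_corrProd_of_isGenus hr hq hK hN hν ha hγ
    have hne : coeff (offExponent L ν a)
        (corrProd r q K N fun j => ((⟨γ j, h5 j⟩ : Fin (g + 1)) : ℕ)) ≠ 0 := by
      rw [h8]; exact h
    refine ⟨fun j => ⟨γ j, h5 j⟩, ?_, hne, ?_⟩
    · rw [mem_filter]; exact ⟨mem_univ _, h4⟩
    · ext j
      have h9 := (hex _ hne).choose_spec j
      have h10 := hγ j
      rw [IsGenus] at h9 h10
      rw [← h10] at h9
      exact_mod_cast mul_right_cancel₀ (mul_ne_zero hr' hq') h9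
  · intro γ _ h
    exact coeff_corrProd_of_isGenus hr hq hK hN hν ha (hex γ h).choose_spec

end Components

end Correlators

/-! ### Comparison of coefficients -/

section Comparison

open MvPowerSeries (coeff)

variable {n : ℕ}

/-- The sum over the elements `k` of `L` of the operators `Q^{(k)}_{d;L∖k,m}`, applied to `F`
times the product of the polar factors. -/
def qSeries {m : ℕ} (L : Finset (Fin n)) (d : ℕ) (F : MvPowerSeries (Fin n ⊕ Fin m) ℚ) :
    MvPowerSeries (Fin n) ℚ := fun ν =>
  if ∀ i ∈ L, 0 < ν i then ∑ a ∈ tuples m (∑ i ∈ L, ν i),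
    PowerSeries.coeff (2 * d) (linkSymbol L ν a) * coeff (offExponent L ν a) F else 0

theorem coeff_qSeries {m : ℕ} (L : Finset (Fin n)) (d : ℕ) (F : MvPowerSeries (Fin n ⊕ Fin m) ℚ)
    (ν : Fin n →₀ ℕ) : coeff ν (qSeries L d F) =
      if ∀ i ∈ L, 0 < ν i then ∑ a ∈ tuples m (∑ i ∈ L, ν i),
        PowerSeries.coeff (2 * d) (linkSymbol L ν a) * coeff (offExponent L ν a) F else 0 := rfl

theorem sum_Qop_eq_qSeries {m : ℕ} (d : ℕ) {L : Finset (Fin n)} (hL : L.Nonempty)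
    (F : MvPowerSeries (Fin n ⊕ Fin m) ℚ)
    (hF : ∀ μ, coeff μ F ≠ 0 → (∀ i ∈ L, μ (Sum.inl i) = 0) ∧ ∃ j, 0 < μ (Sum.inr j)) :
    ∑ k ∈ L, Qop k d (L.erase k) m
      ((∏ i ∈ L.erase k, polarFactor Sum.inl k i) * algebraMap _ _ F) =
      algebraMap _ _ (qSeries L d F) := by
  obtain ⟨P, h1, h2⟩ := sum_Qop d hL F hF
  rw [h1]
  congr 1
  ext ν
  rw [h2, coeff_qSeries]
  rfl

/-- Grouping by the joined set `L = K₀ ∪ {k}` makes the sum over `k ∈ L` available for Lagrange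
interpolation. -/
theorem sum_sum_notMem {M : Type*} [AddCommMonoid M] (f : Fin n → Finset (Fin n) → M) :
    ∑ k, ∑ K₀ : Finset (Fin n) with k ∉ K₀, f k K₀ =
      ∑ L : Finset (Fin n) with L.Nonempty, ∑ k ∈ L, f k (L.erase k) := by
  rw [sum_sigma', sum_sigma']
  refine sum_bij' (fun x _ => ⟨insert x.1 x.2, x.1⟩) (fun x _ => ⟨x.2, x.1.erase x.2⟩)
    ?_ ?_ ?_ ?_ ?_
  · rintro ⟨k, K⟩ _
    simp
  · rintro ⟨L, k⟩ _
    simp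
  · rintro ⟨k, K⟩ h
    simp only [mem_sigma, mem_filter, mem_univ, true_and] at h
    simp [erase_insert h]
  · rintro ⟨L, k⟩ h
    simp only [mem_sigma] at h
    simp [insert_erase h.2]
  · rintro ⟨k, K⟩ h
    simp only [mem_sigma, mem_filter, mem_univ, true_and] at h
    simp [erase_insert h]

/-- The right-hand side of the recursion, as a power series. -/
def recSeries (r q g n : ℕ) : MvPowerSeries (Fin n) ℚ :=
  ∑ L : Finset (Fin n) with L.Nonempty, ∑ l ∈ range (r + 2),
    ∑ K : Fin l → Finset (Fin n) with IsSplitting K (univ \ L), (1 / (l ! : ℚ)) •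
      ∑ md ∈ Icc 1 (r + 1) ×ˢ range (r + 1) with #L + md.1 + 2 * md.2 = r + 2,
        (1 / (md.1 ! : ℚ)) •
        ∑ M : Fin l → Finset (Fin md.1) with IsSplitting M univ ∧ ∀ j, (M j).Nonempty,
          ∑ γ : Fin l → Fin (g + 1) with
              (g : ℤ) = ∑ j, ((γ j : ℕ) : ℤ) + (md.1 : ℤ) - (l : ℤ) + (md.2 : ℤ),
            qSeries L md.2 (corrProd r q K M fun j => (γ j : ℕ))

theorem sum_Qop_eq_recSeries {r q : ℕ} (hr : 0 < r) (hq : 0 < q) (g n : ℕ) :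
    ∑ k : Fin n, ∑ K₀ : Finset (Fin n) with k ∉ K₀,
        ∑ l ∈ range (r + 2), ∑ K : Fin l → Finset (Fin n) with
            IsSplitting K (univ \ insert k K₀),
          (1 / (l ! : ℚ)) •
          ∑ md ∈ Icc 1 (r + 1) ×ˢ range (r + 1) with #K₀ + md.1 + 2 * md.2 = r + 1,
            (1 / (md.1 ! : ℚ)) •
            ∑ M : Fin l → Finset (Fin md.1) with
                IsSplitting M univ ∧ ∀ j, (M j).Nonempty,
              ∑ γ : Fin l → Fin (g + 1) with
                  (g : ℤ) = ∑ j, ((γ j : ℕ) : ℤ) + (md.1 : ℤ) - (l : ℤ) + (md.2 : ℤ),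
                Qop k md.2 K₀ md.1
                  ((∏ i ∈ K₀, polarFactor Sum.inl k i) *
                    algebraMap (MvPowerSeries (Fin n ⊕ Fin md.1) ℚ) _
                      (∏ j, correlator r q (γ j : ℕ) ((K j).disjSum (M j)))) =
      algebraMap (MvPowerSeries (Fin n) ℚ) (PolarSeries (id : Fin n → Fin n))
        (recSeries r q g n) := by
  have hsmul : ∀ (c : ℚ) (F : MvPowerSeries (Fin n) ℚ),
      algebraMap (MvPowerSeries (Fin n) ℚ) (PolarSeries (id : Fin n → Fin n)) (c • F) =
        c • algebraMap _ _ F :=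
    fun c F => map_rat_smul (algebraMap (MvPowerSeries (Fin n) ℚ)
      (PolarSeries (id : Fin n → Fin n))) c F
  rw [sum_sum_notMem, recSeries, map_sum]
  refine sum_congr rfl fun L hL => ?_
  rw [mem_filter] at hL
  rw [sum_comm, map_sum]
  refine sum_congr rfl fun l _ => ?_
  rw [map_sum]
  rw [sum_congr rfl (g := fun k => ∑ K : Fin l → Finset (Fin n) with IsSplitting K (univ \ L),
      (1 / (l ! : ℚ)) •
          ∑ md ∈ Icc 1 (r + 1) ×ˢ range (r + 1) with #L + md.1 + 2 * md.2 = r + 2,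
            (1 / (md.1 ! : ℚ)) •
            ∑ M : Fin l → Finset (Fin md.1) with
                IsSplitting M univ ∧ ∀ j, (M j).Nonempty,
              ∑ γ : Fin l → Fin (g + 1) with
                  (g : ℤ) = ∑ j, ((γ j : ℕ) : ℤ) + (md.1 : ℤ) - (l : ℤ) + (md.2 : ℤ),
                Qop k md.2 (L.erase k) md.1
                  ((∏ i ∈ L.erase k, polarFactor Sum.inl k i) *
                    algebraMap (MvPowerSeries (Fin n ⊕ Fin md.1) ℚ) _
                      (corrProd r q K M fun j => (γ j : ℕ)))) ?_]
  swap
  · intro k hk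
    rw [insert_erase hk]
    have hc : ∀ md : ℕ × ℕ, (#(L.erase k) + md.1 + 2 * md.2 = r + 1) ↔
        (#L + md.1 + 2 * md.2 = r + 2) := by
      intro md
      have := card_erase_add_one hk
      omega
    simp only [hc]
    rfl
  rw [sum_comm]
  refine sum_congr rfl fun K hK => ?_
  rw [mem_filter] at hK
  rw [← smul_sum, hsmul, sum_comm, map_sum]
  congr 1
  refine sum_congr rfl fun md hmd => ?_
  rw [mem_filter, mem_product, mem_Icc] at hmd
  rw [← smul_sum, hsmul, sum_comm, map_sum]
  congr 1
  refine sum_congr rfl fun M hM => ?_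
  rw [mem_filter] at hM
  rw [sum_comm, map_sum]
  refine sum_congr rfl fun γ _ => ?_
  refine sum_Qop_eq_qSeries md.2 hL.2 _ fun μ hμ => ?_
  have hs := support_of_coeff_corrProd_ne_zero hr hq hK.2 hM.2.1 hμ
  constructor
  · intro i hi
    rw [← Finsupp.notMem_support_iff, hs, inl_mem_disjSum]
    simp [hi]
  · refine ⟨⟨0, by omega⟩, Nat.pos_of_ne_zero ?_⟩
    rw [← Finsupp.mem_support_iff, hs, inr_mem_disjSum]
    exact mem_univ _

theorem coeff_Bop (r q g : ℕ) (F : MvPowerSeries (Fin n) ℚ) (ν : Fin n →₀ ℕ) :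
    coeff ν (Bop r q g F) =
      1 / (r : ℚ) * ((2 * g - 2 + n) + 1 / q * ∑ i, (ν i : ℚ)) * coeff ν F := by
  have h : ∀ i, coeff ν (euler i F) = (ν i : ℚ) * coeff ν F := by
    intro i
    rw [euler_eq_diagOp, coeff_diagOp]
  simp only [Bop, MvPowerSeries.coeff_smul, map_add, map_sum, h, ← sum_mul]
  ring

theorem coeff_recSeries_eq_zero {r q g n : ℕ} (ν : Fin n →₀ ℕ)
    (h : ∀ (L : Finset (Fin n)) (l m d : ℕ) (K : Fin l → Finset (Fin n))
      (M : Fin l → Finset (Fin m)) (γ : Fin l → Fin (g + 1)) (a : Fin m → ℕ),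
      (∀ i ∈ L, 0 < ν i) → IsSplitting K (univ \ L) → IsSplitting M univ →
      #L + m + 2 * d = r + 2 → ∑ j, a j = ∑ i ∈ L, ν i →
      (g : ℤ) = ∑ j, ((γ j : ℕ) : ℤ) + (m : ℤ) - (l : ℤ) + (d : ℤ) →
      coeff (offExponent L ν a) (corrProd r q K M fun j => (γ j : ℕ)) = 0) :
    coeff ν (recSeries r q g n) = 0 := by
  simp only [recSeries, map_sum, MvPowerSeries.coeff_smul]
  refine sum_eq_zero fun L _ => sum_eq_zero fun l _ => sum_eq_zero fun K hK => ?_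
  rw [sum_eq_zero, mul_zero]
  intro md hmd
  rw [sum_eq_zero, mul_zero]
  intro M hM
  refine sum_eq_zero fun γ hγ => ?_
  rw [coeff_qSeries]
  split_ifs with hL
  · refine sum_eq_zero fun a ha => ?_
    rw [mem_filter] at hK hmd hM hγ
    rw [mem_tuples] at ha
    rw [h L l md.1 md.2 K M γ a hL hK.2 hM.2.1 hmd.2 ha hγ.2, mul_zero]
  · rfl

/-- The sum over the configurations of components, for given new parts. -/
def compSum (r q b : ℕ) (L : Finset (Fin n)) (ν : Fin n → ℕ) (k m : ℕ) (a : Fin m → ℕ) : ℚ :=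
  ∑ l ∈ range k, ∑ K : Fin l → Finset (Fin n) with IsSplitting K (univ \ L), 1 / (l ! : ℚ) *
    ∑ M : Fin l → Finset (Fin m) with IsSplitting M univ ∧ ∀ j, (M j).Nonempty,
      PowerSeries.coeff b (∏ j, connSeries r q ((K j).disjSum (M j)) (Sum.elim ν a))

/-- Every component contains a new part, so there are at most `m` components and larger ranges add
nothing. -/
theorem compSum_eq_of_le (r q b : ℕ) (L : Finset (Fin n)) (ν : Fin n → ℕ) {k k' m : ℕ}
    (hk : m < k) (hk' : k ≤ k') (a : Fin m → ℕ) :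
    compSum r q b L ν k m a = compSum r q b L ν k' m a := by
  refine sum_subset (range_subset_range.2 hk') fun l _ hl => ?_
  rw [mem_range, not_lt] at hl
  refine sum_eq_zero fun K _ => ?_
  rw [sum_eq_zero, mul_zero]
  intro M hM
  rw [mem_filter] at hM
  have := hM.2.1.le_card hM.2.2
  rw [card_univ, Fintype.card_fin] at this
  omega

theorem coeff_linkSum (r q b k : ℕ) (L : Finset (Fin n)) (ν : Fin n → ℕ) {m : ℕ}
    (a : Fin m → ℕ) : PowerSeries.coeff b (linkSum k r q ν a (univ \ L)) =
      compSum r q b L ν k m a := by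
  simp only [linkSum, compSum, map_sum, PowerSeries.coeff_smul, mul_sum, smul_eq_mul]

theorem sum_mul_sum_rearrange {κ : Type*} {X : ℕ → Type*} {Y : ℕ → κ → Type*} {Z : κ → Type*}
    (S : Finset ℕ) (SX : ∀ l, Finset (X l)) (T : Finset κ) (SY : ∀ l t, Finset (Y l t))
    (SZ : ∀ t, Finset (Z t)) (c : ℕ → ℚ) (e : κ → ℚ) (w : ∀ t, Z t → ℚ)
    (f : ∀ l t, X l → Y l t → Z t → ℚ) :
    ∑ l ∈ S, ∑ x ∈ SX l, c l * ∑ t ∈ T, e t * ∑ y ∈ SY l t, ∑ z ∈ SZ t, w t z * f l t x y z =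
      ∑ t ∈ T, ∑ z ∈ SZ t, e t * w t z *
        ∑ l ∈ S, ∑ x ∈ SX l, c l * ∑ y ∈ SY l t, f l t x y z := by
  have h1 : ∀ l x t, e t * ∑ y ∈ SY l t, ∑ z ∈ SZ t, w t z * f l t x y z =
      ∑ z ∈ SZ t, e t * w t z * ∑ y ∈ SY l t, f l t x y z := by
    intro l x t
    rw [sum_comm, mul_sum]
    refine sum_congr rfl fun z _ => ?_
    rw [← mul_sum, mul_assoc]
  simp only [h1, mul_sum]
  rw [sum_congr rfl fun l _ => sum_comm, sum_comm]
  refine sum_congr rfl fun t _ => ?_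
  rw [sum_congr rfl fun l _ => sum_comm, sum_comm]
  refine sum_congr rfl fun z _ => sum_congr rfl fun l _ => sum_congr rfl fun x _ =>
    sum_congr rfl fun y _ => ?_
  ring

theorem coeff_recSeries_of_isGenus {r q g b : ℕ} (hr : 0 < r) (hq : 0 < q) {ν : Fin n →₀ ℕ}
    (hν : ∀ i, 0 < ν i) (hb : IsGenus r q univ ν (b + 1) g) :
    coeff ν (recSeries r q g n) = ∑ L : Finset (Fin n) with L.Nonempty,
      ∑ md ∈ Icc 1 (r + 1) ×ˢ range (r + 1) with #L + md.1 + 2 * md.2 = r + 2,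
        ∑ a ∈ tuples md.1 (∑ i ∈ L, ν i), 1 / (md.1 ! : ℚ) *
          PowerSeries.coeff (2 * md.2) (linkSymbol L ν a) *
            compSum r q b L ν (r + 2) md.1 a := by
  have key : ∀ (L : Finset (Fin n)) (l : ℕ) (K : Fin l → Finset (Fin n)) (md : ℕ × ℕ)
      (M : Fin l → Finset (Fin md.1)), IsSplitting K (univ \ L) → IsSplitting M univ →
      (∀ j, (M j).Nonempty) → #L + md.1 + 2 * md.2 = r + 2 →
      ∑ γ : Fin l → Fin (g + 1) with
          (g : ℤ) = ∑ j, ((γ j : ℕ) : ℤ) + (md.1 : ℤ) - (l : ℤ) + (md.2 : ℤ),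
        coeff ν (qSeries L md.2 (corrProd r q K M fun j => (γ j : ℕ))) =
      ∑ a ∈ tuples md.1 (∑ i ∈ L, ν i), PowerSeries.coeff (2 * md.2) (linkSymbol L ν a) *
        PowerSeries.coeff b (∏ j, connSeries r q ((K j).disjSum (M j)) (Sum.elim ν a)) := by
    intro L l K md M hK hM hM' hd
    simp only [coeff_qSeries, if_pos fun i (_ : i ∈ L) => hν i]
    rw [sum_comm]
    refine sum_congr rfl fun a ha => ?_
    rw [mem_tuples] at ha
    rw [← mul_sum]
    -- The passage from genera to cycle numbers needs positive parts; tuples with a zero entry have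
    -- vanishing symbol.
    by_cases h0 : ∀ j, 0 < a j
    · rw [sum_coeff_corrProd hr hq hK hM hM' hν h0 ha hd hb]
    · push Not at h0
      obtain ⟨j, hj⟩ := h0
      rw [linkSymbol_eq_zero L ν (j := j) (by omega), map_zero, zero_mul, zero_mul]
  simp only [recSeries, map_sum, MvPowerSeries.coeff_smul]
  refine sum_congr rfl fun L _ => ?_
  have e : ∀ (l : ℕ), ∀ K ∈ (univ : Finset (Fin l → Finset (Fin n))).filter
      (IsSplitting · (univ \ L)),
      ∑ md ∈ Icc 1 (r + 1) ×ˢ range (r + 1) with #L + md.1 + 2 * md.2 = r + 2,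
        1 / (md.1 ! : ℚ) *
        ∑ M : Fin l → Finset (Fin md.1) with IsSplitting M univ ∧ ∀ j, (M j).Nonempty,
          ∑ γ : Fin l → Fin (g + 1) with
              (g : ℤ) = ∑ j, ((γ j : ℕ) : ℤ) + (md.1 : ℤ) - (l : ℤ) + (md.2 : ℤ),
            coeff ν (qSeries L md.2 (corrProd r q K M fun j => (γ j : ℕ))) =
      ∑ md ∈ Icc 1 (r + 1) ×ˢ range (r + 1) with #L + md.1 + 2 * md.2 = r + 2,
        1 / (md.1 ! : ℚ) *
        ∑ M : Fin l → Finset (Fin md.1) with IsSplitting M univ ∧ ∀ j, (M j).Nonempty,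
          ∑ a ∈ tuples md.1 (∑ i ∈ L, ν i), PowerSeries.coeff (2 * md.2) (linkSymbol L ν a) *
            PowerSeries.coeff b (∏ j, connSeries r q ((K j).disjSum (M j)) (Sum.elim ν a)) := by
    intro l K hK
    refine sum_congr rfl fun md hmd => ?_
    refine congrArg _ (sum_congr rfl fun M hM => ?_)
    rw [mem_filter] at hK hmd hM
    exact key L l K md M hK.2 hM.2.1 hM.2.2 hmd.2
  refine (sum_congr rfl fun l _ => sum_congr rfl fun K hK => congrArg (1 / (l ! : ℚ) * ·) (e l K hK)).trans ?_
  exact sum_mul_sum_rearrange (X := fun l => Fin l → Finset (Fin n))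
    (Y := fun l (md : ℕ × ℕ) => Fin l → Finset (Fin md.1)) (Z := fun md => Fin md.1 → ℕ)
    (range (r + 2)) (fun l => univ.filter (IsSplitting · (univ \ L))) _
    (fun l md => univ.filter fun M => IsSplitting M univ ∧ ∀ j, (M j).Nonempty)
    (fun md => tuples md.1 (∑ i ∈ L, ν i)) (fun l => 1 / (l ! : ℚ)) (fun md => 1 / (md.1 ! : ℚ))
    (fun md a => PowerSeries.coeff (2 * md.2) (linkSymbol L ν a))
    (fun l md K M a =>
      PowerSeries.coeff b (∏ j, connSeries r q ((K j).disjSum (M j)) (Sum.elim ν a)))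

theorem coeff_derivative_connSeries (r q b : ℕ) (hn : 0 < n) {ν : Fin n → ℕ}
    (hν : ∀ i, 0 < ν i) :
    1 / (r ! : ℚ) * PowerSeries.coeff b (PowerSeries.derivative ℚ (connSeries r q univ ν)) =
      ∑ L : Finset (Fin n) with L.Nonempty,
        ∑ md ∈ Icc 1 (r + 1) ×ˢ range (r + 1) with #L + md.1 + 2 * md.2 = r + 2,
          ∑ a ∈ tuples md.1 (∑ i ∈ L, ν i), 1 / (md.1 ! : ℚ) *
            PowerSeries.coeff (2 * md.2) (linkSymbol L ν a) *
              compSum r q b L ν (r + 2) md.1 a := by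
  -- The cut-and-join equation needs a bound `M ≥ |ν|`; the summand `r + 1` makes the range contain
  -- every number of new parts that the weight allows.
  set M := ∑ i, ν i + (r + 1) with hM
  have hne : (univ : Finset (Fin n)).Nonempty := ⟨⟨0, hn⟩, mem_univ _⟩
  rw [derivative_connSeries r q ν hν M (by omega) (n + M + 1) (by simp) univ hne, powerset_univ,
    map_sum, mul_sum]
  refine sum_congr rfl fun L hL => ?_
  rw [mem_filter] at hL
  have hL0 := hL.2.card_pos
  simp only [map_sum, PowerSeries.coeff_smul, coeff_linkSum, smul_eq_mul]
  have h1 : ∀ m ∈ range M, m ∉ range (r + 1) → ∑ a ∈ tuples (m + 1) (∑ i ∈ L, ν i),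
      (r ! : ℚ) * (1 / ((m + 1)! : ℚ)) * cutJoinWeight (r + 1) L ν a *
        compSum r q b L ν (n + M + 1) (m + 1) a = 0 := by
    intro m _ hm
    rw [mem_range, not_lt] at hm
    refine sum_eq_zero fun a _ => ?_
    have : cutJoinWeight (r + 1) L ν a = 0 := by
      by_contra hne
      obtain ⟨d, hd⟩ := exists_of_cutJoinWeight_ne_zero hne
      omega
    rw [this, mul_zero, zero_mul]
  rw [← sum_subset (range_subset_range.2 (by omega)) h1, sum_filter, sum_product,
    show Icc 1 (r + 1) = Ico 1 (r + 2) by ext; simp only [mem_Icc, mem_Ico]; omega,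
    sum_Ico_eq_sum_range, mul_sum]
  refine sum_congr rfl fun m hm => ?_
  rw [mem_range] at hm
  rw [add_comm 1 m, mul_sum, ← sum_filter]
  dsimp only
  rw [sum_comm]
  refine sum_congr rfl fun a _ => ?_
  rw [← compSum_eq_of_le r q b L ν (k := r + 2) (by omega) (by omega)]
  by_cases h0 : cutJoinWeight (r + 1) L ν a = 0
  · rw [h0, sum_eq_zero]
    · ring
    · intro d hd
      rw [mem_filter] at hd
      rw [← cutJoinWeight_eq (p := r + 1) ν a (by omega), h0, mul_zero, zero_mul]
  · obtain ⟨d, hd⟩ := exists_of_cutJoinWeight_ne_zero h0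
    rw [sum_eq_single d]
    · rw [← cutJoinWeight_eq (p := r + 1) ν a hd]
      field_simp
    · intro d' hd' hne
      rw [mem_filter] at hd'
      exact absurd (by omega) hne
    · intro hd'
      refine absurd ?_ hd'
      rw [mem_filter, mem_range]
      exact ⟨by omega, by omega⟩

/-- On a monomial with `b` cycles `B_{g,n}` acts as multiplication by `b`, and `b` times the
coefficient of `β^b` is a coefficient of the derivative. Where no `b ≥ 1` fits the genus, both sides
vanish: the right one because its components would add up to such a `b`. -/
theorem smul_Bop_correlator_eq_recSeries {r q : ℕ} (hr : 0 < r) (hq : 0 < q) (g : ℕ)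
    (hn : 0 < n) :
    (1 / (r ! : ℚ)) • Bop r q g (correlator r q g (univ : Finset (Fin n))) =
      recSeries r q g n := by
  have hr' : (r : ℤ) ≠ 0 := by positivity
  have hq' : (q : ℤ) ≠ 0 := by positivity
  ext ν
  rw [MvPowerSeries.coeff_smul, coeff_Bop]
  by_cases hν : ∀ i, 0 < ν i
  swap
  · have h1 : coeff ν (correlator r q g (univ : Finset (Fin n))) = 0 := by
      by_contra h
      refine hν fun i => Nat.pos_of_ne_zero ?_
      rw [← Finsupp.mem_support_iff, (of_coeff_correlator_ne_zero hr hq h).1]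
      exact mem_univ i
    rw [h1, mul_zero, mul_zero, coeff_recSeries_eq_zero]
    intro L l m d K M γ a hL hK hM _ _ _
    by_contra h
    have hs := support_of_coeff_corrProd_ne_zero hr hq hK hM h
    refine hν fun i => ?_
    by_cases hi : i ∈ L
    · exact hL i hi
    · have : Sum.inl i ∈ (offExponent L ν a).support := by
        rw [hs, inl_mem_disjSum]; simp [hi]
      rw [Finsupp.mem_support_iff, offExponent, Finsupp.equivFunOnFinite_symm_apply_apply,
        Sum.elim_inl, if_neg hi] at this
      exact Nat.pos_of_ne_zero this
  have hs : ν.support = univ := by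
    ext i; simp [(hν i).ne']
  by_cases hb : ∃ b, IsGenus r q univ ν (b + 1) g
  · obtain ⟨b, hb⟩ := hb
    rw [coeff_recSeries_of_isGenus hr hq hν hb, ← coeff_derivative_connSeries r q b hn hν,
      coeff_correlator_of_isGenus hr hq hs hb, PowerSeries.coeff_derivative]
    rw [IsGenus, card_univ, Fintype.card_fin] at hb
    have hb' : ((b : ℚ) + 1) * (r * q) = (2 * g - 2 + n) * q + ∑ i, (ν i : ℚ) := by
      exact_mod_cast hb
    have : 1 / (r : ℚ) * ((2 * g - 2 + n) + 1 / q * ∑ i, (ν i : ℚ)) = b + 1 := by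
      field_simp
      linear_combination -hb'
    rw [this]
    ring
  · rw [coeff_recSeries_eq_zero]
    · by_cases h0 : coeff ν (correlator r q g (univ : Finset (Fin n))) = 0
      · rw [h0, mul_zero, mul_zero]
      · obtain ⟨-, b, hb'⟩ := of_coeff_correlator_ne_zero hr hq h0
        -- For `b = 0` the correlator may be nonzero, but the eigenvalue of `B_{g,n}` is then zero.
        rcases b with _ | b
        · rw [IsGenus, card_univ, Fintype.card_fin] at hb'
          have hb'' : 0 = (2 * (g : ℚ) - 2 + n) * q + ∑ i, (ν i : ℚ) := by
            have : (0 : ℤ) = (2 * (g : ℤ) - 2 + n) * q + ∑ i, (ν i : ℤ) := by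
              rw [← hb']; simp
            exact_mod_cast this
          have : 1 / (r : ℚ) * ((2 * g - 2 + n) + 1 / q * ∑ i, (ν i : ℚ)) = 0 := by
            field_simp
            linear_combination -hb''
          rw [this, zero_mul, mul_zero]
        · exact absurd ⟨b, hb'⟩ hb
    · intro L l m d K M γ a hL hK hM hd ha hγ
      by_contra h
      obtain ⟨β, hβ⟩ := exists_isGenus_of_coeff_corrProd_ne_zero hr hq hK hM h
      refine hb ⟨∑ j, β j, ?_⟩
      have := genus_relation (subset_univ L) hK hM ha hd hβ
      rw [← hγ] at this
      rw [IsGenus]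
      push_cast
      exact this

end Comparison

end

end SpinHurwitz

/-- The finite ranges lose nothing: `#K₀ + m + 2d = r + 1` with `m ≥ 1` bounds `m` and `d`, nonempty
`M_j` give `l ≤ m ≤ r + 1`, and the genus constraint with `l ≤ m` gives `g_j ≤ g`. -/
theorem proposition3p1 (r q : ℕ) (hr : 1 ≤ r) (hq : 1 ≤ q) (g n : ℕ) (hn : 1 ≤ n) :
    (1 / (r ! : ℚ)) • algebraMap (MvPowerSeries (Fin n) ℚ)
        (SpinHurwitz.PolarSeries (id : Fin n → Fin n))
        (SpinHurwitz.Bop r q g (SpinHurwitz.correlator r q g (univ : Finset (Fin n)))) =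
      ∑ k : Fin n, ∑ K₀ : Finset (Fin n) with k ∉ K₀,
        ∑ l ∈ range (r + 2), ∑ K : Fin l → Finset (Fin n) with
            SpinHurwitz.IsSplitting K (univ \ insert k K₀),
          (1 / (l ! : ℚ)) •
          ∑ md ∈ Icc 1 (r + 1) ×ˢ range (r + 1) with #K₀ + md.1 + 2 * md.2 = r + 1,
            (1 / (md.1 ! : ℚ)) •
            ∑ M : Fin l → Finset (Fin md.1) with
                SpinHurwitz.IsSplitting M univ ∧ ∀ j, (M j).Nonempty,
              ∑ γ : Fin l → Fin (g + 1) with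
                  (g : ℤ) = ∑ j, ((γ j : ℕ) : ℤ) + (md.1 : ℤ) - (l : ℤ) + (md.2 : ℤ),
                SpinHurwitz.Qop k md.2 K₀ md.1
                  ((∏ i ∈ K₀, SpinHurwitz.polarFactor Sum.inl k i) *
                    algebraMap (MvPowerSeries (Fin n ⊕ Fin md.1) ℚ) _
                      (∏ j, SpinHurwitz.correlator r q (γ j : ℕ) ((K j).disjSum (M j)))) := by
  have h : ∀ (c : ℚ) (F : MvPowerSeries (Fin n) ℚ),
      algebraMap (MvPowerSeries (Fin n) ℚ)
        (SpinHurwitz.PolarSeries (id : Fin n → Fin n)) (c • F) = c • algebraMap _ _ F :=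
    fun c F => map_rat_smul (algebraMap (MvPowerSeries (Fin n) ℚ)
      (SpinHurwitz.PolarSeries (id : Fin n → Fin n))) c F
  rw [← h, SpinHurwitz.smul_Bop_correlator_eq_recSeries hr hq g hn]
  exact (SpinHurwitz.sum_Qop_eq_recSeries hr hq g n).symm
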